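/- Let $n\ge 0$ and $[n]=\{1,\dots,n\}$; rows are numbered from top to bottom, columns from left to right. **Marked bumpless pipedreams.** There are seven tiles: blank, horizontal, vertical, plus, R (joining right and down), J (joining left and up), and marked J (drawn as J). A tile connects to the right (left, up, down) if its drawing contains the segment from its center in that direction. $\mathrm{MBPD}(n)$ is the set of $n\times n$ matrices $D$ of such tiles in which every row has a pipe entering from the right, every column has a pipe leaving to the south, no pipe enters from the top or leaves to the left, and neighbouring tiles agree on whether a pipe crosses their common edge. Blank and marked J tiles are *heavy*, the others *light*. The weight $\mathrm{wt}(D)\in\mathbb Z_{\ge0}^n$ records the number of heavy tiles in each row. The associated permutation $w(D)$ sends $i$ to the column in which the pipe entering at the right border of row $i$ exits the bottom border, where any crossing of two pipes that have already crossed is treated as a bump (the pipe from the right turns down, the pipe from the top turns left). $D$ is *unmarked* if it has no marked J, and *reduced* if no two of its pipes cross more than once. $D_{\mathrm{id}}$ is the element with R on the diagonal, horizontal tiles above it and vertical tiles below it. **Reverse compatible pairs.** A biletter is a pair $(i,a)$ with $1\le i\le a<n$; $(i_1,a_1)>(i_2,a_2)$ means $i_1>i_2$, or $i_1=i_2$ and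 $a_1<a_2$. $\mathrm{RCP}(n)$ is the set of finite strictly decreasing sequences $B=((i_1,a_1),\dots,(i_\ell,a_\ell))$ of biletters. $\mathrm{wt}(B)$ records, for each $i\in[n]$, the number of biletters of the form $(i,a)$. The associated permutation is $w(B)=s_{a_\ell}*\cdots*s_{a_1}$, where $s_a=(a\ a{+}1)$ and $*$ is the Demazure product ($s_a*w=s_aw$ if $\ell(s_aw)>\ell(w)$, and $s_a*w=w$ otherwise). $B$ is *reduced* if $s_{a_\ell}\cdots s_{a_1}$ is a reduced word. **Droops.** For $b<c$, $D_{r,[b,c]}$ is a *pipe segment* if $D_{r,b}$ connects to the right, $D_{r,c}$ connects to the left, and all tiles strictly between are horizontal or plus. The tiles of row $r$ strictly between columns $b$ and $d$ are *paired* if they are light, $D_{r,b}$ does not connect to the right and $D_{r,d}$ does not connect to the left. $D$ admits the $(r,[b,d])$-*droop* ($b<d$) if all tiles in $[r,r+1]\times[b,d]$ are light, except that $(r+1,d)$ may be blank; $D_{r,[b,d]}$ is a pipe segment; the tiles of row $r+1$ strictly between columns $b$ and $d$ are paired; and $D_{r,b}$ is not horizontal, $D_{r,d}$ is not plus. The droop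 then yields $D'\in\mathrm{MBPD}(n)$, which differs from $D$ only in this rectangle: at $(r,b)$ an R becomes blank and a plus becomes J; at $(r+1,b)$ a J becomes horizontal and a vertical becomes R; at $(r,d)$ a J becomes vertical and a horizontal becomes R; at $(r+1,d)$ a blank becomes J and an R becomes plus; and for $b<x<d$, $D'_{r,x}=D_{r+1,x}$, while $D'_{r+1,x}$ is plus if $D_{r+1,x}$ connects down and horizontal otherwise. The $(r,[b,d])$-*undroop* is the inverse operation. $D_{[r,r+1],[b,d]}$ ($b<d$) is a *doublecross* if $D_{r,[b,d]}$ and $D_{r+1,[b,d]}$ are pipe segments, $D_{r,b}$ is R and $D_{r+1,d}$ is an (unmarked) J. **F-moves.** Let $D_{r,c}$ be the rightmost heavy tile of row $r<n$. Then $(r,c)$ is an *$f$-target* if there is a minimal $c'>c$ with $D_{r+1,c'}$ an unmarked J and all $D_{r+1,j}$ with $j<c'$ are light. It is an *$f^*$-target* if row $r+1$ has no J and no marked J to the right of column $c$ and all $D_{r+1,j}$ with $j<c'$ are light, where $c'$ is the largest index with $D_{r,c'}$ an R. The result $f_r(D)$, resp. $f^*_r(D)$, is obtained as follows. (i) Remove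 the marking at $(r,c)$, if any. (ii) If $D_{r,c}$ was blank, or if $D_{r,c}$ was a marked J and $D_{r+1,[b,c]}$ is a pipe segment for the largest $b<c$ with $D_{r,b}$ an R, perform the $(r,[c,\rho])$-undroop; here $\rho=d$ if $(r,c)$ is an $f$-target and there is a doublecross $D_{[r,r+1],[d,c']}$ with $c<d<c'$, and $\rho=c'$ otherwise. (iii) If the tile at $(r+1,c')$ is J, mark it. **E-moves.** Let $1\le r<n$. The position $(r+1,c)$ is an *$e$-target* if $D_{r+1,c}$ is the leftmost heavy tile of row $r+1$, and an *$e^*$-target* if row $r+1$ has no heavy tile and $c$ is the largest index such that $D_{r,c}$ or $D_{r+1,c}$ is R; in both cases it is also required that there is a maximal $c'<c$ such that $D_{r,c'}$ is R and $D_{r+1,[c',c]}$ is not a pipe segment, and that $D_{r,j}$ is light for all $j>c'$. Let $\rho$ be the largest $d<c$ with $D_{r+1,d}$ an R if $(r+1,c)$ is an $e$-target and $D_{r,c}$ is plus, and $\rho=c$ otherwise. Let $\lambda$ be: the least $d>c'$ with $D_{r,d}$ an unmarked J, if $D_{r,[c',c]}$ is not a pipe segment; the least $d>c'$ with $D_{r+1,d}$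 an unmarked J, if $D_{r,[c',c]}$ is a pipe segment and $(r,c')$ is the top left corner of a doublecross in rows $r,r+1$; and $c'$ otherwise. The result $e_r(D)$, resp. $e^*_r(D)$, is obtained as follows. (i) Remove the marking at $(r+1,c)$, if any. (ii) If $D_{r,[c',c]}$ is a pipe segment, perform the $(r,[\lambda,\rho])$-droop. (iii) If the tile at $(r,\lambda)$ is J, mark it. **Theorem 1.1.** The following recursions define maps $\Phi:\mathrm{MBPD}(n)\to\mathrm{RCP}(n)$ and $\Psi:\mathrm{RCP}(n)\to\mathrm{MBPD}(n)$ (in particular, all moves that are used are defined). - $\Phi(D_{\mathrm{id}})=()$. For $D\ne D_{\mathrm{id}}$, let $(i,c)$ be the bottommost, then rightmost, heavy tile of $D$. If it is an $f^*$-target, then $\Phi(D)$ is $\Phi(f_i^*(D))$ with $(i,i)$ prepended. If it is an $f$-target, then $\Phi(f_i(D))$ starts with a biletter $(i+1,a)$, and $\Phi(D)$ is obtained from it by replacing this first biletter by $(i,a)$. - $\Psi(())=D_{\mathrm{id}}$. Let $B=((i,a),(i_2,a_2),\dots)$ be nonempty. If $i=a$, then $\Psi(B)=e_i^*(\Psi((i_2,a_2),\dots))$.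 If $i<a$, then $\Psi(B)=e_i(\Psi((i+1,a),(i_2,a_2),\dots))$. The maps $\Phi$ and $\Psi$ are mutually inverse bijections. They preserve the weight and the associated permutation: $\mathrm{wt}(\Phi(D))=\mathrm{wt}(D)$, $w(\Phi(D))=w(D)$, $\mathrm{wt}(\Psi(B))=\mathrm{wt}(B)$, and $w(\Psi(B))=w(B)$. They restrict to mutually inverse bijections between the reduced, unmarked bumpless pipedreams in $\mathrm{MBPD}(n)$ and the reduced elements of $\mathrm{RCP}(n)$. -/

import Mathlib

/-
Rows and columns of the `n × n` grid are indexed by `Fin n`: the index with value `k` stands for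
row (column) `k + 1`.  Rows are numbered from top to bottom, columns from left to right.
-/

namespace BPD

/-! ### Tiles and marked bumpless pipedreams -/

/-- The seven tiles: blank, horizontal, vertical, plus, R (joins right and down),
J (joins left and up), and marked J. -/
inductive Tile where
  | blank | hor | ver | plus | rt | jt | mjt
  deriving DecidableEq

namespace Tile

/-- The tile connects to the right. -/
def right : Tile → Bool
  | hor | plus | rt => true
  | _ => false

/-- The tile connects to the left. -/
def left : Tile → Bool
  | hor | plus | jt | mjt => true
  | _ => false

/-- The tile connects up. -/
def up : Tile → Bool
  | ver | plus | jt | mjt => true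
  | _ => false

/-- The tile connects down. -/
def down : Tile → Bool
  | ver | plus | rt => true
  | _ => false

/-- Heavy tiles are the blank and the marked J; all others are light. -/
def heavy : Tile → Bool
  | blank | mjt => true
  | _ => false

end Tile

open Tile

/-- An `n × n` matrix of tiles. -/
abbrev Grid (n : ℕ) := Fin n → Fin n → Tile

variable {n : ℕ}

/-- Every row has a pipe entering from the right, every column has a pipe leaving to the south,
no pipe enters from the top, no pipe leaves to the left, and the pipes are connected. -/
structure IsMBPD (D : Grid n) : Prop where
  right_border : ∀ i j : Fin n, (j : ℕ) + 1 = n → (D i j).right = true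
  left_border : ∀ i j : Fin n, (j : ℕ) = 0 → (D i j).left = false
  bottom_border : ∀ i j : Fin n, (i : ℕ) + 1 = n → (D i j).down = true
  top_border : ∀ i j : Fin n, (i : ℕ) = 0 → (D i j).up = false
  horizontal : ∀ i j k : Fin n, (k : ℕ) = j + 1 → (D i j).right = (D i k).left
  vertical : ∀ i k j : Fin n, (k : ℕ) = i + 1 → (D i j).down = (D k j).up

/-- The set `MBPD(n)`. -/
def MBPD (n : ℕ) := {D : Grid n // IsMBPD D}

/-- No tile is marked. -/
def IsUnmarked (D : Grid n) : Prop := ∀ i j, D i j ≠ mjt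

/-- The Rothe bumpless pipedream of the identity: the `i`-th pipe turns only at `(i, i)`. -/
def idGrid (n : ℕ) : Grid n := fun i j => if i = j then rt else if i < j then hor else ver

/-- The weight: number of heavy tiles in each row. -/
def gridWeight (D : Grid n) (i : Fin n) : ℕ := (Finset.univ.filter fun j => (D i j).heavy).card

/-! ### Following the pipes -/

/-- State while reading the tiles row by row from top to bottom, each row from right to left.
Pipes travel left and down, so this order is compatible with the order of tiles along each pipe.
`below j` is the pipe leaving downwards from the lowest tile read so far in column `j`,
`toLeft` is the pipe leaving the last read tile to the left, `crossings` lists the pairs of pipes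
that have crossed so far, once for every crossing.  A pipe is named by the row where it enters. -/
structure PipeState (n : ℕ) where
  below : Fin n → Option (Fin n)
  toLeft : Option (Fin n)
  crossings : List (Sym2 (Fin n))

/-- Read the tile `t` in column `j`.  When `ignore = true`, a plus at which two pipes meet that
have already crossed is treated as a bump: the pipe from the right goes down, the pipe from
the top goes left. -/
def PipeState.step (ignore : Bool) (t : Tile) (j : Fin n) (S : PipeState n) : PipeState n :=
  match t with
  | blank | hor | ver => S
  | rt => ⟨Function.update S.below j S.toLeft, none, S.crossings⟩
  | jt | mjt => ⟨Function.update S.below j none, S.below j, S.crossings⟩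
  | plus =>
    match S.toLeft, S.below j with
    | some p, some q =>
      if ignore = true ∧ s(p, q) ∈ S.crossings then
        ⟨Function.update S.below j (some p), some q, S.crossings⟩
      else ⟨S.below, S.toLeft, s(p, q) :: S.crossings⟩
    | _, _ => S

/-- Read row `i` from right to left; pipe `i` enters at the right border. -/
def PipeState.row (ignore : Bool) (D : Grid n) (S : PipeState n) (i : Fin n) : PipeState n :=
  (List.finRange n).reverse.foldl (fun S j => S.step ignore (D i j) j)
    ⟨S.below, some i, S.crossings⟩

/-- The state after reading the whole grid. -/
def trace (ignore : Bool) (D : Grid n) : PipeState n :=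
  (List.finRange n).foldl (PipeState.row ignore D) ⟨fun _ => none, none, []⟩

/-- `w` is the permutation associated to `D`: the pipe entering at the right border of row `i` exits
at the bottom border of column `w i`, where crossings of two pipes that have already crossed are
treated as bumps. -/
def HasPerm (D : Grid n) (w : Equiv.Perm (Fin n)) : Prop :=
  ∀ i, (trace true D).below (w i) = some i

/-- `D` is reduced: no two of its pipes cross more than once. -/
def IsReduced (D : Grid n) : Prop := (trace false D).crossings.Nodup

/-! ### Reverse compatible pairs -/

/-- `p` is a biletter `(i, a)`: `1 ≤ i ≤ a < n`. -/
def IsBiletter (p : Fin n × Fin n) : Prop := p.1 ≤ p.2 ∧ (p.2 : ℕ) + 1 < n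

/-- The order on biletters: `(i₁, a₁) > (i₂, a₂)` if `i₁ > i₂`, or `i₁ = i₂` and `a₁ < a₂`. -/
def BiletterGT (p q : Fin n × Fin n) : Prop := q.1 < p.1 ∨ (p.1 = q.1 ∧ p.2 < q.2)

/-- The set `RCP(n)` of strictly decreasing sequences of biletters. -/
def RCP (n : ℕ) :=
  {B : List (Fin n × Fin n) // (∀ p ∈ B, IsBiletter p) ∧ B.Pairwise BiletterGT}

/-- The weight: number of biletters `(i, a)` for each `i`. -/
def pairWeight (B : List (Fin n × Fin n)) (i : Fin n) : ℕ := B.countP fun p => p.1 = i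

/-- The simple reflection exchanging `a` and `a + 1` (for `a < n`, in 1-based indexing). -/
def simpleRefl (a : Fin n) : Equiv.Perm (Fin n) :=
  if h : (a : ℕ) + 1 < n then Equiv.swap a ⟨a + 1, h⟩ else 1

/-- Coxeter length: the number of inversions. -/
def permLength (w : Equiv.Perm (Fin n)) : ℕ :=
  (Finset.univ.filter fun p : Fin n × Fin n => p.1 < p.2 ∧ w p.2 < w p.1).card

/-- The Demazure product `s_a * w`. -/
def demazureMul (a : Fin n) (w : Equiv.Perm (Fin n)) : Equiv.Perm (Fin n) :=
  if permLength w < permLength (simpleRefl a * w) then simpleRefl a * w else w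

/-- The associated permutation, i.e. the Demazure product
`s_{a_ℓ} * (s_{a_{ℓ-1}} * (⋯ * (s_{a_1} * 1)))`. -/
def pairPerm (B : List (Fin n × Fin n)) : Equiv.Perm (Fin n) :=
  B.foldl (fun w p => demazureMul p.2 w) 1

/-- `B` is reduced: `s_{a_ℓ} s_{a_{ℓ-1}} ⋯ s_{a_1}` is a reduced word (for the ordinary product of
permutations). -/
def IsReducedPair (B : List (Fin n × Fin n)) : Prop :=
  permLength (B.reverse.map fun p => simpleRefl p.2).prod = B.length

/-! ### Pipe segments, droops and undroops -/

/-- `D_{r,[b,c]}` is a pipe segment: a pipe runs horizontally from `(r, b)` to `(r, c)`, so that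
all tiles strictly between are horizontal or plus. -/
def IsPipeSegment (D : Grid n) (r b c : Fin n) : Prop :=
  (b = c ∧ D r b ≠ blank) ∨
    (b < c ∧ (D r b).right = true ∧ (D r c).left = true ∧
      ∀ j, b < j → j < c → D r j = hor ∨ D r j = plus)

/-- The tiles of row `r` strictly between columns `b` and `d` form a paired light sequence: they are
light, no pipe enters them from `(r, b)`, and none leaves them to `(r, d)`; so along the row every
R in between is followed by its J, and every J is preceded by its R. -/
def IsPairedBetween (D : Grid n) (r b d : Fin n) : Prop :=
  (∀ j, b < j → j < d → (D r j).heavy = false) ∧ (D r b).right = false ∧ (D r d).left = false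

/-- `D` admits the `(r,[b,d])`-droop; here `s` is the row `r + 1`. -/
structure AdmitsDroop (D : Grid n) (r s b d : Fin n) : Prop where
  next_row : (s : ℕ) = r + 1
  lt : b < d
  light : ∀ i j, (i = r ∨ i = s) → b ≤ j → j ≤ d →
    (D i j).heavy = false ∨ (i = s ∧ j = d ∧ D i j = blank)
  top : IsPipeSegment D r b d
  bottom : IsPairedBetween D s b d
  left_corner : D r b ≠ hor
  right_corner : D r d ≠ plus

/-- The outcome of the `(r,[b,d])`-droop (`s` is the row `r + 1`).  The pipe segment in row `r` drops
to row `s`, and the kinks in row `s` between columns `b` and `d` are shifted up to row `r`.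
At the corners: `(r,b)` loses an R (R becomes blank, plus becomes J); `(s,d)` gains a J (blank becomes
J, R becomes plus); at `(r,d)` J becomes vertical and horizontal becomes R; at `(s,b)` J becomes
horizontal and vertical becomes R. -/
def droop (D : Grid n) (r s b d : Fin n) : Grid n := fun i j =>
  if i = r then
    if j = b then (if D r b = plus then jt else blank)
    else if j = d then (if D r d = hor then rt else ver)
    else if b < j ∧ j < d then D s j
    else D i j
  else if i = s then
    if j = b then (if D s b = jt then hor else rt)
    else if j = d then (if D s d = rt then plus else jt)
    else if b < j ∧ j < d then (if (D s j).down = true then plus else hor)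
    else D i j
  else D i j

/-- `D → D'` is the `(r,[b,d])`-droop of marked bumpless pipedreams; equivalently `D' → D` is the
`(r,[b,d])`-undroop. -/
def IsDroop (D D' : Grid n) (r s b d : Fin n) : Prop :=
  IsMBPD D ∧ IsMBPD D' ∧ AdmitsDroop D r s b d ∧ D' = droop D r s b d

/-- `D_{[r,r+1],[b,d]}` is a doublecross (`s` is the row `r + 1`). -/
def IsDoublecross (D : Grid n) (r s b d : Fin n) : Prop :=
  b < d ∧ IsPipeSegment D r b d ∧ IsPipeSegment D s b d ∧ D r b = rt ∧ D s d = jt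

/-- Remove the marking, if any, at `(i₀, j₀)`. -/
def unmarkAt (D : Grid n) (i₀ j₀ : Fin n) : Grid n := fun i j =>
  if i = i₀ ∧ j = j₀ ∧ D i j = mjt then jt else D i j

/-- If the tile at `(i₀, j₀)` is a J, mark it. -/
def markAt (D : Grid n) (i₀ j₀ : Fin n) : Grid n := fun i j =>
  if i = i₀ ∧ j = j₀ ∧ D i j = jt then mjt else D i j

/-! ### F-moves (`s` always denotes the row `r + 1`) -/

/-- `(r, c)` is an `f`-target and `c'` is the right column of its window. -/
structure IsfTarget (D : Grid n) (r s c c' : Fin n) : Prop where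
  next_row : (s : ℕ) = r + 1
  f1_heavy : (D r c).heavy = true
  f1_rightmost : ∀ j, c < j → (D r j).heavy = false
  f2_gt : c < c'
  f2_jt : D s c' = jt
  f2_min : ∀ j, c < j → j < c' → D s j ≠ jt
  f3 : ∀ j, j < c' → (D s j).heavy = false

/-- `(r, c)` is an `f*`-target and `c'` is the right column of its window. -/
structure IsfStarTarget (D : Grid n) (r s c c' : Fin n) : Prop where
  next_row : (s : ℕ) = r + 1
  f1_heavy : (D r c).heavy = true
  f1_rightmost : ∀ j, c < j → (D r j).heavy = false
  fs2 : ∀ j, c < j → D s j ≠ jt ∧ D s j ≠ mjt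
  fs2_rt : D r c' = rt
  fs2_max : ∀ j, c' < j → D r j ≠ rt
  f3 : ∀ j, j < c' → (D s j).heavy = false

/-- Case C (crossing): `D_{r,c}` is a marked J and, `b` being the nearest column to the left of `c`
with `D_{r,b}` an R, `D_{r+1,[b,c]}` is a pipe segment. -/
def IsCaseC (D : Grid n) (r s c : Fin n) : Prop :=
  D r c = mjt ∧ ∃ b, b < c ∧ D r b = rt ∧ (∀ j, b < j → j < c → D r j ≠ rt) ∧ IsPipeSegment D s b c

/-- The steps of an F-move with target `(r, c)`, right window column `c'` and right droop column
`ρ`: remove the marking at `(r, c)`; in Case B (`D_{r,c}` blank) and Case C perform the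
`(r,[c,ρ])`-undroop; if the tile at `(r+1, c')` is a J, mark it. -/
def FSteps (D : Grid n) (r s c c' ρ : Fin n) (D' : Grid n) : Prop :=
  ∃ M : Grid n,
    (((D r c = blank ∨ IsCaseC D r s c) ∧ IsDroop M (unmarkAt D r c) r s c ρ) ∨
      (¬ (D r c = blank ∨ IsCaseC D r s c) ∧ M = unmarkAt D r c)) ∧
    D' = markAt M s c'

/-- `(D, (r, c))` is an `f`-target and `D' = f_r(D)`.  The right droop column is the left column `d` of
the doublecross `D_{[r,r+1],[d,c']}` with `c < d < c'` if there is one, and `c'` otherwise. -/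
def IsfMove (D : Grid n) (r c : Fin n) (D' : Grid n) : Prop :=
  ∃ s c' ρ : Fin n, IsfTarget D r s c c' ∧
    ((c < ρ ∧ ρ < c' ∧ IsDoublecross D r s ρ c') ∨
      ((¬ ∃ d, c < d ∧ d < c' ∧ IsDoublecross D r s d c') ∧ ρ = c')) ∧
    FSteps D r s c c' ρ D'

/-- `(D, (r, c))` is an `f*`-target and `D' = f*_r(D)`.  The right droop column is `c'`. -/
def IsfStarMove (D : Grid n) (r c : Fin n) (D' : Grid n) : Prop :=
  ∃ s c' : Fin n, IsfStarTarget D r s c c' ∧ FSteps D r s c c' c' D'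

/-- `(r, c)` is the bottommost then rightmost heavy tile of `D` (the maximum F-target). -/
def IsMaxHeavy (D : Grid n) (r c : Fin n) : Prop :=
  (D r c).heavy = true ∧ ∀ i j, (D i j).heavy = true → i < r ∨ (i = r ∧ j ≤ c)

/-! ### E-moves (`s` always denotes the row `r + 1`) -/

/-- Conditions common to `e`- and `e*`-targets `(r+1, c)`; `c'` is the left column of the window. -/
structure IsEWindow (D : Grid n) (r s c c' : Fin n) : Prop where
  next_row : (s : ℕ) = r + 1
  e2_lt : c' < c
  e2_rt : D r c' = rt
  e2_not : ¬ IsPipeSegment D s c' c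
  e2_max : ∀ j, c' < j → j < c → D r j = rt → IsPipeSegment D s j c
  e3 : ∀ j, c' < j → (D r j).heavy = false

/-- `(r+1, c)` is an `e`-target with left window column `c'`. -/
structure IseTarget (D : Grid n) (r s c c' : Fin n) : Prop extends IsEWindow D r s c c' where
  e1_heavy : (D s c).heavy = true
  e1_leftmost : ∀ j, j < c → (D s j).heavy = false

/-- `(r+1, c)` is an `e*`-target with left window column `c'`. -/
structure IseStarTarget (D : Grid n) (r s c c' : Fin n) : Prop extends IsEWindow D r s c c' where
  es1_light : ∀ j, (D s j).heavy = false
  es1_rt : D r c = rt ∨ D s c = rt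
  es1_max : ∀ j, c < j → D r j ≠ rt ∧ D s j ≠ rt

/-- `d` is the first column to the right of `c'` with a J in row `i`. -/
def IsFirstJ (D : Grid n) (i c' d : Fin n) : Prop :=
  c' < d ∧ D i d = jt ∧ ∀ j, c' < j → j < d → D i j ≠ jt

/-- `lam` is the left droop column of the E-target `(r+1, c)` with left window column `c'`. -/
def IsELeft (D : Grid n) (r s c c' lam : Fin n) : Prop :=
  -- Case L
  (¬ IsPipeSegment D r c' c ∧ IsFirstJ D r c' lam) ∨
  -- Case D
  (IsPipeSegment D r c' c ∧ (∃ d, IsDoublecross D r s c' d) ∧ IsFirstJ D s c' lam) ∨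
  -- Case S
  (IsPipeSegment D r c' c ∧ (¬ ∃ d, IsDoublecross D r s c' d) ∧ lam = c')

/-- The steps of an E-move with target `(r+1, c)`, left window column `c'`, right droop column
`ρ`: remove the marking at `(r+1, c)`; in Cases S and D (`D_{r,[c',c]}` is a pipe segment) perform the
`(r,[lam,ρ])`-droop; if the tile at `(r, lam)` is a J, mark it. -/
def ESteps (D : Grid n) (r s c c' ρ : Fin n) (D' : Grid n) : Prop :=
  ∃ (lam : Fin n) (M : Grid n), IsELeft D r s c c' lam ∧
    ((IsPipeSegment D r c' c ∧ IsDroop (unmarkAt D s c) M r s lam ρ) ∨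
      (¬ IsPipeSegment D r c' c ∧ M = unmarkAt D s c)) ∧
    D' = markAt M r lam

/-- `D` has an `e`-target in row `r + 1` and `D' = e_r(D)`.  If `D_{r,c}` is a plus, the right droop
column is the nearest column to the left of `c` with an R in row `r + 1`; otherwise it is `c`. -/
def IseMove (D : Grid n) (r : Fin n) (D' : Grid n) : Prop :=
  ∃ s c c' ρ : Fin n, IseTarget D r s c c' ∧
    ((D r c = plus ∧ ρ < c ∧ D s ρ = rt ∧ ∀ j, ρ < j → j < c → D s j ≠ rt) ∨
      (D r c ≠ plus ∧ ρ = c)) ∧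
    ESteps D r s c c' ρ D'

/-- `D` has an `e*`-target in row `r + 1` and `D' = e*_r(D)`.  The right droop column is `c`. -/
def IseStarMove (D : Grid n) (r : Fin n) (D' : Grid n) : Prop :=
  ∃ s c c' : Fin n, IseStarTarget D r s c c' ∧ ESteps D r s c c' c D'

/-! ### Iterating the moves -/

/-- `PhiRel D B`: iterating F-moves at the maximum F-target, starting from `D`, produces `B`. -/
inductive PhiRel : MBPD n → List (Fin n × Fin n) → Prop
  | nil (D : MBPD n) : D.1 = idGrid n → PhiRel D []
  | terminal (D D' : MBPD n) (i c : Fin n) (B : List (Fin n × Fin n)) :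
      IsMaxHeavy D.1 i c → IsfStarMove D.1 i c D'.1 → PhiRel D' B →
      PhiRel D ((i, i) :: B)
  | nonterminal (D D' : MBPD n) (i i' c a : Fin n) (B : List (Fin n × Fin n)) :
      IsMaxHeavy D.1 i c → IsfMove D.1 i c D'.1 → (i' : ℕ) = i + 1 →
      PhiRel D' ((i', a) :: B) → PhiRel D ((i, a) :: B)

/-- `PsiRel B D`: iterating E-moves as prescribed by `B`, starting from the identity grid,
produces `D`. -/
inductive PsiRel : List (Fin n × Fin n) → MBPD n → Prop
  | nil (D : MBPD n) : D.1 = idGrid n → PsiRel [] D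
  | star (D' D : MBPD n) (i : Fin n) (B : List (Fin n × Fin n)) :
      PsiRel B D' → IseStarMove D'.1 i D.1 → PsiRel ((i, i) :: B) D
  | move (D' D : MBPD n) (i i' a : Fin n) (B : List (Fin n × Fin n)) :
      (i' : ℕ) = i + 1 → i < a → PsiRel ((i', a) :: B) D' → IseMove D'.1 i D.1 →
      PsiRel ((i, a) :: B) D

/-- The reduced, unmarked bumpless pipedreams. -/
def reducedBPD (n : ℕ) : Set (MBPD n) := {D | IsUnmarked D.1 ∧ IsReduced D.1}

/-- The reduced reverse compatible sequences. -/
def reducedRCP (n : ℕ) : Set (RCP n) := {B | IsReducedPair B.1}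

end BPD

/-! F-moves and E-moves are two readings of one relation. `GridMove D D' r s c c' star` says tile by
tile how two adjacent rows change, symmetrically in source and outcome: either the columns [c, p]
are undrooped, or only markings change. A move carries one heavy tile from row r to the next row, or
deletes it if `star` holds. Every F-target is the source of such a move, every E-target its outcome,
and each such pair satisfies the literal definitions of both moves. As the moves are deterministic,
`isfMove_iff`, `isfStarMove_iff`, `iseMove_iff` and `iseStarMove_iff` identify them with `GridMove`
read forwards or backwards, so that f and e are inverse to each other.

One biletter (i, a) stands for a chain `Peel D i a D'`: f-moves in rows i, ..., a - 1 and then an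
f*-move in row a. Iterating, `PsiRel B D` becomes `Peels D B`, and `PhiRel D B` becomes the same
together with the strict decrease of B. Two facts about the order remain. Peels made successively
from the lowest heavy row have increasing a (`Peel.lt_of_peel`), and conversely every peel that the
order allows can be put in front (`exists_peel`). Both rest on commuting squares: an f-move landing
in column c' uses its lower row only up to c', whereas a move starting in that row at a heavy tile
right of c' uses it only beyond c'. Hence two consecutive peels from row i can be rearranged so that
both heavy tiles first drop to row i + 1, and induction on a - i applies.

For the permutation, list the pipes from left to right along a cut through the grid. With repeated
crossings ignored, a plus tile sorts two neighbouring labels decreasingly. These operators `sortAt`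
satisfy the 0-Hecke relations, and a grid becomes a product of them. An undroop rewrites this
product by braid, commutation and idempotence relations: f-moves preserve it, and an f*-move in row
r splits off `sortAt r` on the right. The grid and its biletters therefore act alike, and the latter
give the Demazure product.

For reducedness, a grid has as many plus tiles as blanks. The length of B is the number of heavy
tiles, hence the number of plus tiles plus the number of marked J's. The number of inversions is at
most the number of plus tiles, with equality exactly if no two pipes cross twice. So B is reduced
exactly if D is unmarked and reduced. -/

namespace BPD

open Tile

variable {n : ℕ}

/-! ### Rows -/

/-- The tiles of a row fit together, and a pipe enters at its right end but none leaves at its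
left end. -/
structure RowValid (x : Fin n → Tile) : Prop where
  right_border : ∀ j : Fin n, (j : ℕ) + 1 = n → (x j).right = true
  left_border : ∀ j : Fin n, (j : ℕ) = 0 → (x j).left = false
  horizontal : ∀ j k : Fin n, (k : ℕ) = j + 1 → (x j).right = (x k).left

theorem IsMBPD.rowValid {D : Grid n} (h : IsMBPD D) (i : Fin n) : RowValid (D i) :=
  ⟨h.right_border i, h.left_border i, h.horizontal i⟩

theorem Tile.eq_hor_or_plus_of_left {t : Tile} (hl : t.left = true) (hr : t.right = true) :
    t = hor ∨ t = plus := by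
  cases t <;> simp_all [Tile.left, Tile.right]

theorem RowValid.exists_rt {x : Fin n → Tile} (hx : RowValid x) (j : Fin n)
    (hl : (x j).left = true) :
    ∃ z < j, x z = rt ∧ ∀ k, z < k → k < j → x k = hor ∨ x k = plus := by
  obtain ⟨m, hm⟩ : ∃ m, m = (j : ℕ) := ⟨_, rfl⟩
  induction m generalizing j with
  | zero => exact absurd (hx.left_border j hm.symm) (by simp [hl])
  | succ m ih =>
    have hjn := j.2
    set k : Fin n := ⟨m, by omega⟩ with hk
    have hr : (x k).right = true := by rw [hx.horizontal k j (by simp [hk, ← hm]), hl]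
    have hkj : k < j := by simp [hk, Fin.lt_def, ← hm]
    by_cases hkl : (x k).left = true
    · obtain ⟨z, hz, hzr, hzk⟩ := ih k hkl rfl
      refine ⟨z, hz.trans hkj, hzr, fun i h1 h2 => ?_⟩
      rcases lt_or_ge i k with h | h
      · exact hzk i h1 h
      · have : i = k := by
          apply Fin.ext; simp only [Fin.lt_def, Fin.le_def] at *; simp [hk] at *; omega
        exact this ▸ Tile.eq_hor_or_plus_of_left hkl hr
    · refine ⟨k, hkj, ?_, fun i h1 h2 => ?_⟩
      · cases h : x k <;> simp_all [Tile.left, Tile.right]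
      · simp only [Fin.lt_def, hk] at h1 h2; omega

theorem RowValid.right_cases {x : Fin n → Tile} (hx : RowValid x) (z : Fin n)
    (hr : (x z).right = true) :
    (∀ k, z < k → x k = hor ∨ x k = plus) ∨
      ∃ j, z < j ∧ (x j = jt ∨ x j = mjt) ∧ ∀ k, z < k → k < j → x k = hor ∨ x k = plus := by
  obtain ⟨m, hm⟩ : ∃ m, m + z + 1 = n := ⟨n - 1 - z, by omega⟩
  induction m generalizing z with
  | zero => exact .inl fun k hk => by simp only [Fin.lt_def] at hk; omega
  | succ m ih =>
    set j : Fin n := ⟨z + 1, by omega⟩ with hj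
    have hl : (x j).left = true := by rw [← hx.horizontal z j (by simp [hj]), hr]
    have hzj : z < j := by simp [hj, Fin.lt_def]
    have hle : ∀ k, z < k → k = j ∨ j < k := fun k hk => by
      simp only [Fin.lt_def, Fin.ext_iff, hj] at *; omega
    by_cases hjr : (x j).right = true
    · have hj' := Tile.eq_hor_or_plus_of_left hl hjr
      rcases ih j hjr (by simp [hj]; omega) with h | ⟨k, hk, hk', hb⟩
      · left; intro k hk; rcases hle k hk with rfl | h'
        · exact hj'
        · exact h k h'
      · refine .inr ⟨k, hzj.trans hk, hk', fun i h1 h2 => ?_⟩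
        rcases hle i h1 with rfl | h'
        · exact hj'
        · exact hb i h' h2
    · refine .inr ⟨j, hzj, ?_, fun k h1 h2 => ?_⟩
      · cases h : x j <;> simp_all [Tile.left, Tile.right]
      · simp only [Fin.lt_def, hj] at h1 h2; omega

theorem RowValid.exists_jt_between {x : Fin n → Tile} (hx : RowValid x) {z j : Fin n} (hzj : z < j)
    (hr : (x z).right = true) (hl : (x j).left = false) :
    ∃ k, z < k ∧ k < j ∧ (x k = jt ∨ x k = mjt) := by
  rcases hx.right_cases z hr with h | ⟨k, hk, hk', hb⟩
  · rcases h j hzj with h | h <;> simp [h, Tile.left] at hl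
  · refine ⟨k, hk, ?_, hk'⟩
    rcases lt_trichotomy k j with h | rfl | h
    · exact h
    · rcases hk' with h | h <;> simp [h, Tile.left] at hl
    · rcases hb j hzj h with h | h <;> simp [h, Tile.left] at hl

theorem RowValid.exists_rt_between {x : Fin n → Tile} (hx : RowValid x) {z j : Fin n} (hzj : z < j)
    (hr : (x z).right = false) (hl : (x j).left = true) :
    ∃ k, z < k ∧ k < j ∧ x k = rt ∧ ∀ i, k < i → i < j → x i = hor ∨ x i = plus := by
  obtain ⟨k, hk, hk', hb⟩ := hx.exists_rt j hl
  refine ⟨k, ?_, hk, hk', hb⟩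
  rcases lt_trichotomy z k with h | rfl | h
  · exact h
  · simp [hk', Tile.right] at hr
  · rcases hb z h hzj with h' | h' <;> simp [h', Tile.right] at hr

/-- To the right of the last R of a row, all tiles are horizontal or plus. -/
theorem RowValid.exists_rt_after {x : Fin n → Tile} (hx : RowValid x) (z : Fin n)
    (hr : (x z).right = false) :
    ∃ k, z < k ∧ x k = rt ∧ ∀ i, k < i → x i = hor ∨ x i = plus := by
  set e : Fin n := ⟨n - 1, by have := z.2; omega⟩ with he
  have her : (x e).right = true := hx.right_border e (by have := z.2; simp [he]; omega)
  have hle : ∀ i, i ≤ e := fun i => by simp only [Fin.le_def, he]; omega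
  have hze : z < e := lt_of_le_of_ne (hle z) (fun h => by rw [← h, hr] at her; simp at her)
  by_cases hel : (x e).left = true
  · obtain ⟨k, h1, h2, h3, h4⟩ := hx.exists_rt_between hze hr hel
    refine ⟨k, h1, h3, fun i hi => ?_⟩
    rcases lt_or_eq_of_le (hle i) with h | h
    · exact h4 i hi h
    · exact h ▸ Tile.eq_hor_or_plus_of_left hel her
  · refine ⟨e, hze, ?_, fun i hi => absurd hi (not_lt.2 (hle i))⟩
    cases h : x e <;> simp_all [Tile.left, Tile.right]

/-! ### Two-row configurations of the moves -/

/-- The hypotheses common to all moves on the source rows `x` (upper) and `y` (lower): `c` is the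
rightmost heavy tile of `x`, and the pipe of `y` below it runs straight to column `c'`.
Either it turns up there, or (`star`) it enters at the right border. -/
structure Window (x y : Fin n → Tile) (c c' : Fin n) (star : Prop) : Prop where
  lt : c < c'
  heavy : (x c).heavy = true
  rightmost : ∀ j, c < j → (x j).heavy = false
  light : ∀ j, j < c' → (y j).heavy = false
  right : (y c).right = true
  seg : ∀ j, c < j → j < c' → y j = hor ∨ y j = plus
  last : (¬ star ∧ y c' = jt) ∨ (star ∧ x c' = rt ∧ y c' = plus ∧
    ∀ j, c' < j → (x j = hor ∨ x j = plus) ∧ (y j = hor ∨ y j = plus))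

/-- The left end of an undroop in column `c`. -/
def LeftEnd (x y x' y' : Fin n → Tile) (c : Fin n) : Prop :=
  (x c = blank ∧ x' c = rt ∧ (y c = hor ∧ y' c = jt ∨ y c = rt ∧ y' c = ver)) ∨
  (x c = mjt ∧ x' c = plus ∧ y c = hor ∧ y' c = jt ∧ ∃ b < c, x b = rt ∧ y b = plus ∧
    ∀ j, b < j → j < c → (x j = hor ∨ x j = plus) ∧ (y j = hor ∨ y j = plus))

/-- The columns strictly inside an undroop. -/
def Inner (a b a' b' : Tile) : Prop :=
  (a = hor ∧ b = hor ∧ a' = hor ∧ b' = hor) ∨ (a = ver ∧ b = plus ∧ a' = plus ∧ b' = ver) ∨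
  (a = plus ∧ b = plus ∧ a' = plus ∧ b' = plus) ∨ (a = rt ∧ b = plus ∧ a' = hor ∧ b' = rt) ∨
  (a = jt ∧ b = hor ∧ a' = plus ∧ b' = jt)

/-- The right end of an undroop in column `p`, and the tiles up to column `c'`. -/
def RightEnd (x y x' y' : Fin n → Tile) (p c' : Fin n) (star : Prop) : Prop :=
  (¬ star ∧ p = c' ∧ (x p = ver ∧ x' p = jt ∨ x p = rt ∧ x' p = hor) ∧ y' p = blank) ∨
  (¬ star ∧ p < c' ∧ x p = rt ∧ y p = plus ∧ x' p = hor ∧ y' p = rt ∧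
    (∀ j, p < j → j < c' → (x j = hor ∨ x j = plus) ∧ x' j = x j ∧ y' j = y j) ∧
    x c' = plus ∧ x' c' = plus ∧ y' c' = mjt) ∨
  (star ∧ p = c' ∧ x' p = hor ∧ y' p = rt)

/-- A move that undroops columns `[c, p]`. -/
structure UndroopMove (x y x' y' : Fin n → Tile) (c p c' : Fin n) (star : Prop) : Prop where
  window : Window x y c c' star
  lt : c < p
  le : p ≤ c'
  out : ∀ j, j < c ∨ c' < j → x' j = x j ∧ y' j = y j
  inner : ∀ j, c < j → j < p → Inner (x j) (y j) (x' j) (y' j)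
  leftEnd : LeftEnd x y x' y' c
  rightEnd : RightEnd x y x' y' p c' star

/-- A move that only changes markings. -/
structure MarkMove (x y x' y' : Fin n → Tile) (c c' : Fin n) (star : Prop) : Prop where
  window : Window x y c c' star
  eq_mjt : x c = mjt
  eq_jt : x' c = jt
  left : ∃ b z, b < z ∧ z ≤ c ∧ x b = rt ∧ y z = rt ∧
    (∀ j, b < j → j < c → x j = hor ∨ x j = plus) ∧ (∀ j, z < j → j ≤ c → y j = hor ∨ y j = plus)
  same_top : ∀ j, j ≠ c → x' j = x j
  same_bot : ∀ j, j ≠ c' → y' j = y j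
  mark : (¬ star ∧ y' c' = mjt) ∨ (star ∧ y' c' = y c')

/-- The upper row `x` and the lower row `y` are changed to `x'` and `y'` by an `f`-move (an
`f*`-move if `star` holds) with target in column `c` and right window column `c'`. -/
def RowMove (x y x' y' : Fin n → Tile) (c c' : Fin n) (star : Prop) : Prop :=
  (∃ p, UndroopMove x y x' y' c p c' star) ∨ MarkMove x y x' y' c c' star

theorem RowMove.window {x y x' y' : Fin n → Tile} {c c' : Fin n} {star : Prop}
    (h : RowMove x y x' y' c c' star) : Window x y c c' star := by
  rcases h with ⟨p, h⟩ | h <;> exact h.window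

theorem RowMove.out {x y x' y' : Fin n → Tile} {c c' : Fin n} {star : Prop}
    (h : RowMove x y x' y' c c' star) {j : Fin n} (hj : j < c ∨ c' < j) :
    x' j = x j ∧ y' j = y j := by
  rcases h with ⟨p, h⟩ | h
  · exact h.out j hj
  · have := h.window.lt
    exact ⟨h.same_top j (by grind), h.same_bot j (by grind)⟩

/-- The tiles of an undroop in column `j`. -/
theorem UndroopMove.tiles {x y x' y' : Fin n → Tile} {c p c' : Fin n} {star : Prop}
    (h : UndroopMove x y x' y' c p c' star) (j : Fin n) :
    ((j < c ∨ p < j) ∧ (j = c' → star) ∧ x' j = x j ∧ y' j = y j) ∨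
    (c < j ∧ p < j ∧ j = c' ∧ ¬ star ∧ x' j = plus ∧ x j = plus ∧ y j = jt ∧ y' j = mjt) ∨
    (j = c ∧ ((x j = blank ∧ x' j = rt ∧ (y j = hor ∧ y' j = jt ∨ y j = rt ∧ y' j = ver)) ∨
      (x j = mjt ∧ x' j = plus ∧ y j = hor ∧ y' j = jt))) ∨
    (c < j ∧ j < p ∧ Inner (x j) (y j) (x' j) (y' j)) ∨
    (j = p ∧ ((j = c' ∧ ¬ star ∧ (x j = ver ∧ x' j = jt ∨ x j = rt ∧ x' j = hor) ∧
        y j = jt ∧ y' j = blank) ∨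
      ((j < c' ∨ star) ∧ x j = rt ∧ y j = plus ∧ x' j = hor ∧ y' j = rt))) := by
  have hlt := h.lt
  have hle := h.le
  have hwl := h.window.last
  rcases lt_trichotomy j c with hj | rfl | hj
  · have := h.out j (.inl hj)
    grind
  · have := h.leftEnd
    unfold LeftEnd at this
    grind
  rcases lt_trichotomy j p with hj' | rfl | hj'
  · exact .inr (.inr (.inr (.inl ⟨hj, hj', h.inner j hj hj'⟩)))
  · have := h.rightEnd
    unfold RightEnd at this
    grind
  · rcases lt_or_ge c' j with hc | hc
    · have := h.out j (.inr hc)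
      grind
    · have := h.rightEnd
      unfold RightEnd at this
      grind

/-- The edges after an undroop: in the upper row, a pipe runs through all of `[c, p]`; the lower row
takes over the edges of the upper row. -/
theorem UndroopMove.edges {x y x' y' : Fin n → Tile} {c p c' : Fin n} {star : Prop}
    (h : UndroopMove x y x' y' c p c' star) (j : Fin n) :
    ((x' j).up = (x j).up ∧ (y' j).down = (y j).down ∧
     ((x j).down = (y j).up ↔ (x' j).down = (y' j).up)) ∧
    ((x' j).left = if c < j ∧ j ≤ p then true else (x j).left) ∧
    ((x' j).right = if c ≤ j ∧ j < p then true else (x j).right) ∧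
    ((y' j).left = if c < j ∧ j ≤ p then (x j).left else (y j).left) ∧
    ((y' j).right = if c ≤ j ∧ j < p then (x j).right else (y j).right) ∧
    (c < j ∧ j ≤ p → (y j).left = true) ∧
    (c ≤ j ∧ j < p → (y j).right = true) := by
  have hlt := h.lt
  rcases h.tiles j with ⟨hj, -, h1, h2⟩ | ⟨hj, hj', -, -, h1, h2, h3, h4⟩ |
    ⟨rfl, ⟨h1, h2, ⟨h3, h4⟩ | ⟨h3, h4⟩⟩ | ⟨h1, h2, h3, h4⟩⟩ |
    ⟨hj, hj', ⟨h1, h2, h3, h4⟩ | ⟨h1, h2, h3, h4⟩ | ⟨h1, h2, h3, h4⟩ |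
      ⟨h1, h2, h3, h4⟩ | ⟨h1, h2, h3, h4⟩⟩ |
    ⟨rfl, ⟨-, -, ⟨h1, h2⟩ | ⟨h1, h2⟩, h3, h4⟩ | ⟨-, h1, h2, h3, h4⟩⟩
  · have : ¬ (c < j ∧ j ≤ p) := by grind
    have : ¬ (c ≤ j ∧ j < p) := by grind
    simp [*]
  all_goals simp [h1, h2, h3, h4, Tile.left, Tile.right, Tile.up, Tile.down]
  all_goals grind

/-- The edges after a move that only changes markings are the same. -/
theorem MarkMove.edges {x y x' y' : Fin n → Tile} {c c' : Fin n} {star : Prop}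
    (h : MarkMove x y x' y' c c' star) (j : Fin n) :
    ((x' j).up = (x j).up ∧ (x' j).down = (x j).down ∧ (x' j).left = (x j).left ∧
      (x' j).right = (x j).right) ∧
    ((y' j).up = (y j).up ∧ (y' j).down = (y j).down ∧ (y' j).left = (y j).left ∧
      (y' j).right = (y j).right) := by
  constructor
  · by_cases hj : j = c
    · subst hj; simp [h.eq_jt, h.eq_mjt, Tile.left, Tile.right, Tile.up, Tile.down]
    · simp [h.same_top j hj]
  · by_cases hj : j = c'
    · subst hj
      rcases h.mark with ⟨hs, h1⟩ | ⟨hs, h1⟩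
      · have h2 : y j = jt := by simpa [hs] using h.window.last
        simp [h1, h2, Tile.left, Tile.right, Tile.up, Tile.down]
      · simp [h1]
    · simp [h.same_bot j hj]

/-- In an undroop the lower row inherits the horizontal edges of the upper row, and the upper row
receives the unbroken pipe that the lower row had there; so matching of neighbours transfers both
ways. Marking moves change no edge. -/
theorem RowMove.rowValid_iff {x y x' y' : Fin n → Tile} {c c' : Fin n} {star : Prop}
    (h : RowMove x y x' y' c c' star) :
    RowValid x ∧ RowValid y ↔ RowValid x' ∧ RowValid y' := by
  rcases h with ⟨p, h⟩ | h
  · have e := h.edges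
    have hlt := h.lt
    constructor
    · rintro ⟨h1, h2⟩
      refine ⟨⟨fun j hj => ?_, fun j hj => ?_, fun j k hk => ?_⟩,
        ⟨fun j hj => ?_, fun j hj => ?_, fun j k hk => ?_⟩⟩
      · have := h1.right_border j hj; grind
      · have := h1.left_border j hj; grind
      · have := h1.horizontal j k hk; grind
      · have := h2.right_border j hj; have := h1.right_border j hj; grind
      · have := h2.left_border j hj; have := h1.left_border j hj; grind
      · have := h1.horizontal j k hk; have := h2.horizontal j k hk; grind
    · rintro ⟨h1, h2⟩
      refine ⟨⟨fun j hj => ?_, fun j hj => ?_, fun j k hk => ?_⟩,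
        ⟨fun j hj => ?_, fun j hj => ?_, fun j k hk => ?_⟩⟩
      · have := h1.right_border j hj; have := h2.right_border j hj; grind
      · have := h1.left_border j hj; have := h2.left_border j hj; grind
      · have := h1.horizontal j k hk; have := h2.horizontal j k hk; grind
      · have := h2.right_border j hj; have := h1.right_border j hj; grind
      · have := h2.left_border j hj; have := h1.left_border j hj; grind
      · have := h1.horizontal j k hk; have := h2.horizontal j k hk; grind
  · have e := h.edges
    constructor <;>
    · rintro ⟨h1, h2⟩
      refine ⟨⟨fun j hj => ?_, fun j hj => ?_, fun j k hk => ?_⟩,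
        ⟨fun j hj => ?_, fun j hj => ?_, fun j k hk => ?_⟩⟩
      · have := h1.right_border j hj; grind
      · have := h1.left_border j hj; grind
      · have := h1.horizontal j k hk; grind
      · have := h2.right_border j hj; grind
      · have := h2.left_border j hj; grind
      · have := h2.horizontal j k hk; grind

theorem RowMove.up_down {x y x' y' : Fin n → Tile} {c c' : Fin n} {star : Prop}
    (h : RowMove x y x' y' c c' star) (j : Fin n) :
    (x' j).up = (x j).up ∧ (y' j).down = (y j).down ∧
      ((x j).down = (y j).up ↔ (x' j).down = (y' j).up) := by
  rcases h with ⟨p, h⟩ | h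
  · exact (h.edges j).1
  · have := h.edges j; grind

/-- This controls the weights, and it also locates the target of the reverse move: in the unstarred
case (s, c') becomes the leftmost heavy tile of the lower row. -/
theorem RowMove.heavy {x y x' y' : Fin n → Tile} {c c' : Fin n} {star : Prop}
    (h : RowMove x y x' y' c c' star) (j : Fin n) :
    ((x' j).heavy = true ↔ (x j).heavy = true ∧ j ≠ c) ∧
    ((y' j).heavy = true ↔ (y j).heavy = true ∨ (¬ star ∧ j = c')) := by
  have hle := h.window.lt
  rcases h with ⟨p, h⟩ | h
  · have hlt := h.lt
    have hle := h.le
    rcases h.tiles j with ⟨hj, e1, h1, h2⟩ | ⟨hj, hj', e1, e2, h1, h2, h3, h4⟩ |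
      ⟨rfl, ⟨h1, h2, ⟨h3, h4⟩ | ⟨h3, h4⟩⟩ | ⟨h1, h2, h3, h4⟩⟩ |
      ⟨hj, hj', ⟨h1, h2, h3, h4⟩ | ⟨h1, h2, h3, h4⟩ | ⟨h1, h2, h3, h4⟩ |
        ⟨h1, h2, h3, h4⟩ | ⟨h1, h2, h3, h4⟩⟩ |
      ⟨rfl, ⟨e1, e2, ⟨h1, h2⟩ | ⟨h1, h2⟩, h3, h4⟩ | ⟨e1, h1, h2, h3, h4⟩⟩
    · rw [h1, h2]; grind
    all_goals simp only [h1, h2, h3, h4, Tile.heavy]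
    all_goals grind
  · have := h.same_top j
    have := h.same_bot j
    have := h.mark
    have := h.eq_mjt
    have := h.eq_jt
    have := h.window.last
    constructor
    · by_cases hj : j = c
      · subst hj; simp [*, Tile.heavy]
      · simp [*]
    · by_cases hj : j = c'
      · subst hj
        by_cases hs : star <;> simp_all [Tile.heavy]
      · simp [*]

/-! ### Moves of grids -/

/-- The grid `D` is changed to `D'` by a move in the rows `r` and `s = r + 1`. -/
structure GridMove (D D' : Grid n) (r s c c' : Fin n) (star : Prop) : Prop where
  next_row : (s : ℕ) = r + 1
  out : ∀ i, i ≠ r → i ≠ s → D' i = D i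
  rows : RowMove (D r) (D s) (D' r) (D' s) c c' star

theorem isMBPD_iff {D : Grid n} : IsMBPD D ↔ (∀ i, RowValid (D i)) ∧
    (∀ i j : Fin n, (i : ℕ) + 1 = n → (D i j).down = true) ∧
    (∀ i j : Fin n, (i : ℕ) = 0 → (D i j).up = false) ∧
    (∀ i k j : Fin n, (k : ℕ) = i + 1 → (D i j).down = (D k j).up) :=
  ⟨fun h => ⟨h.rowValid, h.bottom_border, h.top_border, h.vertical⟩, fun ⟨h1, h2, h3, h4⟩ =>
    ⟨fun i => (h1 i).1, fun i => (h1 i).2, h2, h3, fun i => (h1 i).3, h4⟩⟩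

/-- The outer edges of the two rows are unchanged, and their common edges match before exactly if
they match after. Being an equivalence, this permits building either the outcome from the source or
the source from the outcome. -/
theorem GridMove.isMBPD_iff {D D' : Grid n} {r s c c' : Fin n} {star : Prop}
    (h : GridMove D D' r s c c' star) : IsMBPD D ↔ IsMBPD D' := by
  have hs := h.next_row
  have hrs : r ≠ s := by rintro rfl; omega
  have hu := h.rows.up_down
  have ho := h.out
  have hv : (∀ i, RowValid (D i)) ↔ ∀ i, RowValid (D' i) := by
    constructor
    · intro hv i
      have := h.rows.rowValid_iff.1 ⟨hv r, hv s⟩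
      by_cases h1 : i = r
      · exact h1 ▸ this.1
      by_cases h2 : i = s
      · exact h2 ▸ this.2
      · exact h.out i h1 h2 ▸ hv i
    · intro hv i
      have := h.rows.rowValid_iff.2 ⟨hv r, hv s⟩
      by_cases h1 : i = r
      · exact h1 ▸ this.1
      by_cases h2 : i = s
      · exact h2 ▸ this.2
      · exact h.out i h1 h2 ▸ hv i
  have hup : ∀ i j, i ≠ s → (D' i j).up = (D i j).up := fun i j hi => by
    by_cases h1 : i = r
    · exact h1 ▸ (hu j).1
    · rw [ho i h1 hi]
  have hdown : ∀ i j, i ≠ r → (D' i j).down = (D i j).down := fun i j hi => by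
    by_cases h1 : i = s
    · exact h1 ▸ (hu j).2.1
    · rw [ho i hi h1]
  rw [BPD.isMBPD_iff, BPD.isMBPD_iff, hv]
  refine and_congr_right fun _ => and_congr ?_ (and_congr ?_ ?_)
  · refine forall_congr' fun i => forall_congr' fun j => imp_congr_right fun hi => ?_
    rw [hdown i j (by rintro rfl; have := s.2; omega)]
  · refine forall_congr' fun i => forall_congr' fun j => imp_congr_right fun hi => ?_
    rw [hup i j (by rintro rfl; omega)]
  · refine forall_congr' fun i => forall_congr' fun k => forall_congr' fun j =>
      imp_congr_right fun hi => ?_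
    by_cases hir : i = r
    · have : k = s := Fin.ext (by subst hir; omega)
      subst hir this
      exact (hu j).2.2
    · rw [hdown i j hir, hup k j (fun hk => hir (Fin.ext (by subst hk; omega)))]


-- Explicit moves satisfy the definitions of the F- and E-moves

attribute [grind] Tile.left Tile.right Tile.up Tile.down Tile.heavy

theorem isMBPD_congr {D E : Grid n} (hd : ∀ i j, (E i j).down = (D i j).down)
    (hu : ∀ i j, (E i j).up = (D i j).up) (hl : ∀ i j, (E i j).left = (D i j).left)
    (hr : ∀ i j, (E i j).right = (D i j).right) (h : IsMBPD D) : IsMBPD E := by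
  obtain ⟨h1, h2, h3, h4, h5, h6⟩ := h
  constructor <;> simpa only [hd, hu, hl, hr]

theorem IsMBPD.unmarkAt {D : Grid n} (h : IsMBPD D) (r c : Fin n) : IsMBPD (unmarkAt D r c) := by
  refine isMBPD_congr ?_ ?_ ?_ ?_ h <;> intro i j <;> unfold BPD.unmarkAt <;> split_ifs with hc <;>
    first | rfl | simp [hc.2.2, Tile.left, Tile.right, Tile.up, Tile.down]

/-- An F-move and the reverse E-move pass through the same two unmarked intermediate grids, so one
droop serves step (ii) of both. -/
theorem UndroopMove.isDroop {D D' : Grid n} {r s c p c' : Fin n} {star : Prop}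
    (hs : (s : ℕ) = r + 1) (hout : ∀ i, i ≠ r → i ≠ s → D' i = D i)
    (h : UndroopMove (D r) (D s) (D' r) (D' s) c p c' star) (hD : IsMBPD D) (hD' : IsMBPD D') :
    IsDroop (unmarkAt D' s c') (unmarkAt D r c) r s c p := by
  have hrs : r ≠ s := by rintro rfl; omega
  have hlt := h.lt
  have hle := h.le
  have hM1 : ∀ j, unmarkAt D' s c' r j = D' r j := fun j => by simp [unmarkAt, hrs]
  have hM2 : ∀ j, unmarkAt D' s c' s j = if j = c' ∧ D' s j = mjt then jt else D' s j :=
    fun j => by simp [unmarkAt]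
  have hE1 : ∀ j, unmarkAt D r c r j = if j = c ∧ D r j = mjt then jt else D r j :=
    fun j => by simp [unmarkAt]
  have hE2 : ∀ j, unmarkAt D r c s j = D s j := fun j => by simp [unmarkAt, hrs.symm]
  have htop : IsPipeSegment (unmarkAt D' s c') r c p := by
    have e1 := h.edges c
    have e2 := h.edges p
    refine .inr ⟨h.lt, by rw [hM1]; grind, by rw [hM1]; grind, fun j h1 h2 => ?_⟩
    rw [hM1]
    have := h.inner j h1 h2
    unfold Inner at this
    grind
  have hrm := h.window.rightmost
  have hli := h.window.light
  refine ⟨hD'.unmarkAt _ _, hD.unmarkAt _ _, ⟨hs, h.lt, ?_, htop, ⟨?_, ?_, ?_⟩, ?_, ?_⟩, ?_⟩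
  · rintro i j (rfl | rfl) h1 h2
    · rw [hM1]
      left
      rcases h.tiles j with H | H | H | H | H
      · grind
      · grind
      · rcases H with ⟨-, ⟨-, H, -⟩ | ⟨-, H, -⟩⟩ <;> rw [H] <;> rfl
      · rcases H with ⟨-, -, ⟨-, -, H, -⟩ | ⟨-, -, H, -⟩ | ⟨-, -, H, -⟩ | ⟨-, -, H, -⟩ | ⟨-, -, H, -⟩⟩ <;>
          rw [H] <;> rfl
      · rcases H with ⟨-, ⟨-, -, ⟨-, H⟩ | ⟨-, H⟩, -⟩ | ⟨-, -, -, H, -⟩⟩ <;> rw [H] <;> rfl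
    · rw [hM2]
      have := h.rightEnd
      unfold RightEnd at this
      have hv := (RowMove.heavy (.inl ⟨p, h⟩) j).2
      have := hli j
      grind
  · intro j h1 h2
    rw [hM2]
    have hv := (RowMove.heavy (.inl ⟨p, h⟩) j).2
    have := hli j
    grind
  · rw [hM2]
    have := h.leftEnd
    unfold LeftEnd at this
    grind
  · rw [hM2]
    have := h.rightEnd
    unfold RightEnd at this
    grind
  · rw [hM1]
    have := h.leftEnd
    unfold LeftEnd at this
    grind
  · rw [hM1]
    have := h.rightEnd
    unfold RightEnd at this
    grind
  · funext i j
    by_cases h1 : i = r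
    · subst h1
      simp only [droop, if_true, hM1, hM2, hE1]
      have hwl := h.window.last
      rcases h.tiles j with H | H | H | H | H
      · grind
      · grind
      · grind
      · have := H.2.2
        unfold Inner at this
        grind
      · grind
    by_cases h2 : i = s
    · subst h2
      simp only [droop, if_true, hM1, hM2, hE2, if_neg h1]
      have := h.rightEnd
      have := h.leftEnd
      have := h.out
      unfold RightEnd at *
      unfold LeftEnd at *
      have hwl := h.window.last
      rcases h.tiles j with H | H | H | H | H
      · grind
      · grind
      · grind
      · have := H.2.2
        unfold Inner at this
        grind
      · grind
    · simp [unmarkAt, droop, h1, h2, hout i h1 h2]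


theorem unmarkAt_apply {D : Grid n} {r c i j : Fin n} :
    unmarkAt D r c i j = if i = r ∧ j = c ∧ D i j = mjt then jt else D i j := rfl

theorem markAt_apply {D : Grid n} {r c i j : Fin n} :
    markAt D r c i j = if i = r ∧ j = c ∧ D i j = jt then mjt else D i j := rfl

theorem markAt_unmarkAt {D : Grid n} {r c : Fin n} (h : D r c ≠ jt) :
    markAt (unmarkAt D r c) r c = D := by
  funext i j
  simp only [markAt_apply, unmarkAt_apply]
  grind

theorem LeftEnd.undroops {D D' : Grid n} {r s c : Fin n}
    (h : LeftEnd (D r) (D s) (D' r) (D' s) c) : D r c = blank ∨ IsCaseC D r s c := by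
  rcases h with h | ⟨h1, -, h2, -, b, h3, h4, h5, h6⟩
  · exact .inl h.1
  · refine .inr ⟨h1, b, h3, h4, fun j hj hj' => ?_, .inr ⟨h3, ?_, ?_, fun j hj hj' => (h6 j hj hj').2⟩⟩
    · have := h6 j hj hj'
      grind
    · simp [h5, Tile.right]
    · simp [h2, Tile.left]

/-- The R at z, to the right of b, interrupts the lower pipe; this excludes the pipe segment of Case
C. -/
theorem MarkMove.not_undroops {D D' : Grid n} {r s c c' : Fin n} {star : Prop}
    (h : MarkMove (D r) (D s) (D' r) (D' s) c c' star) : ¬ (D r c = blank ∨ IsCaseC D r s c) := by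
  obtain ⟨b, z, h1, h2, h3, h4, h5, h6⟩ := h.left
  have hj := h.eq_mjt
  rintro (h' | ⟨-, b', h1', h2', h3', h4'⟩)
  · grind
  · have : b = b' := by
      rcases lt_trichotomy b b' with h | h | h <;> grind
    subst this
    rcases h4' with h | ⟨-, h7, h8, h9⟩
    · grind
    · rcases lt_or_eq_of_le h2 with h | rfl
      · have := h9 z h1 h
        grind
      · grind

theorem MarkMove.eq_markAt {D D' : Grid n} {r s c c' : Fin n} {star : Prop}
    (hs : (s : ℕ) = r + 1) (hout : ∀ i, i ≠ r → i ≠ s → D' i = D i)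
    (h : MarkMove (D r) (D s) (D' r) (D' s) c c' star) : D' = markAt (unmarkAt D r c) s c' := by
  have hrs : r ≠ s := by rintro rfl; omega
  have h1 := h.eq_mjt
  have h2 := h.eq_jt
  have h3 := h.same_top
  have h4 := h.same_bot
  have h5 := h.mark
  have h6 := h.window.last
  funext i j
  simp only [markAt_apply, unmarkAt_apply]
  by_cases hi : i = r
  · subst hi; grind
  by_cases hi' : i = s
  · subst hi'; grind
  · grind

theorem MarkMove.eq_markAt' {D D' : Grid n} {r s c c' : Fin n} {star : Prop}
    (hs : (s : ℕ) = r + 1) (hout : ∀ i, i ≠ r → i ≠ s → D' i = D i)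
    (h : MarkMove (D r) (D s) (D' r) (D' s) c c' star) : D = markAt (unmarkAt D' s c') r c := by
  have hrs : r ≠ s := by rintro rfl; omega
  have h1 := h.eq_mjt
  have h2 := h.eq_jt
  have h3 := h.same_top
  have h4 := h.same_bot
  have h5 := h.mark
  have h6 := h.window.last
  funext i j
  simp only [markAt_apply, unmarkAt_apply]
  by_cases hi : i = r
  · subst hi; grind
  by_cases hi' : i = s
  · subst hi'; grind
  · grind

theorem UndroopMove.bot_ne_jt {x y x' y' : Fin n → Tile} {c p c' : Fin n} {star : Prop}
    (h : UndroopMove x y x' y' c p c' star) : y' c' ≠ jt := by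
  have := h.rightEnd
  unfold RightEnd at this
  grind

theorem UndroopMove.top_ne_jt {x y x' y' : Fin n → Tile} {c p c' : Fin n} {star : Prop}
    (h : UndroopMove x y x' y' c p c' star) : x c ≠ jt := by
  have := h.leftEnd
  unfold LeftEnd at this
  grind

/-- The right droop column `q` matters only if columns are undrooped, so it is constrained by
undroops alone; a marking move accepts any `q`. -/
theorem GridMove.fSteps {D D' : Grid n} {r s c c' : Fin n} {star : Prop}
    (h : GridMove D D' r s c c' star) (hD : IsMBPD D) (hD' : IsMBPD D') {q : Fin n}
    (hq : ∀ p, UndroopMove (D r) (D s) (D' r) (D' s) c p c' star → q = p) :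
    FSteps D r s c c' q D' := by
  rcases h.rows with ⟨p, hu⟩ | hm
  · obtain rfl := hq p hu
    exact ⟨_, .inl ⟨hu.leftEnd.undroops, hu.isDroop h.next_row h.out hD hD'⟩,
      (markAt_unmarkAt hu.bot_ne_jt).symm⟩
  · exact ⟨_, .inr ⟨hm.not_undroops, rfl⟩, hm.eq_markAt h.next_row h.out⟩

/-- For an undroop, the doublecross clause agrees with the shape of the right end: the second form
of `RightEnd` is a doublecross with left column p, and the first form leaves no room for a
doublecross. -/
theorem GridMove.isfMove {D D' : Grid n} {r s c c' : Fin n}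
    (h : GridMove D D' r s c c' False) (hD : IsMBPD D) (hD' : IsMBPD D') : IsfMove D r c D' := by
  have hw := h.rows.window
  have hlast : D s c' = jt := by simpa using hw.last
  have htar : IsfTarget D r s c c' := ⟨h.next_row, hw.heavy, hw.rightmost, hw.lt, hlast,
    fun j h1 h2 => by have := hw.seg j h1 h2; grind, hw.light⟩
  by_cases hdc : ∃ d, c < d ∧ d < c' ∧ IsDoublecross D r s d c'
  · obtain ⟨d, h1, h2, h3⟩ := hdc
    refine ⟨s, c', d, htar, .inl ⟨h1, h2, h3⟩, h.fSteps hD hD' fun p hu => ?_⟩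
    obtain ⟨-, ht, -, hd, -⟩ := h3
    have := hu.rightEnd
    unfold RightEnd at this
    rcases ht with ht | ⟨-, ht1, ht2, ht3⟩
    · grind
    rcases lt_trichotomy d p with h | h | h
    · have := ht3 p h
      grind
    · exact h
    · grind
  · refine ⟨s, c', c', htar, .inr ⟨hdc, rfl⟩, h.fSteps hD hD' fun p hu => ?_⟩
    rcases hu.rightEnd with h | ⟨-, h1, h2, h3, -, -, h4, h5, -⟩ | h
    · exact h.2.1.symm
    · refine absurd ⟨p, hu.lt, h1, h1, .inr ⟨h1, ?_, ?_, fun j a b => (h4 j a b).1⟩,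
        .inr ⟨h1, ?_, ?_, fun j a b => hw.seg j (hu.lt.trans a) b⟩, h2, hlast⟩ hdc <;> grind
    · exact h.2.1.symm

theorem GridMove.isfStarMove {D D' : Grid n} {r s c c' : Fin n}
    (h : GridMove D D' r s c c' True) (hD : IsMBPD D) (hD' : IsMBPD D') :
    IsfStarMove D r c D' := by
  have hw := h.rows.window
  obtain ⟨h1, h2, h3⟩ : D r c' = rt ∧ D s c' = plus ∧ _ := by simpa using hw.last
  refine ⟨s, c', ⟨h.next_row, hw.heavy, hw.rightmost, fun j hj => ?_, h1, fun j hj => ?_,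
    hw.light⟩, h.fSteps hD hD' fun p hu => ?_⟩
  · have := hw.seg j hj
    have := h3 j
    rcases lt_trichotomy j c' with h | h | h <;> grind
  · have := h3 j hj
    grind
  · have := hu.rightEnd
    unfold RightEnd at this
    grind

theorem UndroopMove.top_seg {x y x' y' : Fin n → Tile} {c p c' : Fin n} {star : Prop}
    (h : UndroopMove x y x' y' c p c' star) :
    (∀ j, c < j → j < c' → x' j = hor ∨ x' j = plus) ∧ (x' c').left = true := by
  have := h.rightEnd
  unfold RightEnd at this
  have hlt := h.lt
  have hle := h.le
  refine ⟨fun j h1 h2 => ?_, by grind⟩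
  rcases lt_trichotomy j p with hj | hj | hj
  · have := h.inner j h1 hj
    unfold Inner at this
    grind
  · grind
  · grind

/-- The left window column of the reverse move is c itself if the undroop creates an R there (Case
S). Otherwise it is the R at b from which the pipe through the marked J comes: Case D for an
undroop, Case L for a marking move. -/
theorem GridMove.eWindow {D D' : Grid n} {r s c c' : Fin n} {star : Prop}
    (h : GridMove D D' r s c c' star) (hD : IsMBPD D) (hD' : IsMBPD D') :
    ∃ b, IsEWindow D' r s c' b ∧ ∀ q,
      (∀ p, UndroopMove (D r) (D s) (D' r) (D' s) c p c' star → q = p) →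
      ESteps D' r s c' b q D := by
  have hw := h.rows.window
  have hcc := hw.lt
  have hheavy := fun j => (h.rows.heavy j).1
  have hrm := hw.rightmost
  have hlight : ∀ j, c ≤ j → (D' r j).heavy = false := fun j hj => by grind
  rcases h.rows with ⟨p, hu⟩ | hm
  · obtain ⟨hseg, hleft⟩ := hu.top_seg
    have hsteps : ∀ q, (∀ p, UndroopMove (D r) (D s) (D' r) (D' s) c p c' star → q = p) →
      ∀ b, IsPipeSegment D' r b c' → IsELeft D' r s c' b c → ESteps D' r s c' b q D := by
      intro q hq b hb hel
      obtain rfl := hq p hu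
      exact ⟨c, _, hel, .inl ⟨hb, hu.isDroop h.next_row h.out hD hD'⟩,
        (markAt_unmarkAt hu.top_ne_jt).symm⟩
    rcases hu.leftEnd with ⟨h1, h2, h3⟩ | ⟨h1, h2, h3, h4, b, h5, h6, h7, h8⟩
    · have hr : (D' s c).right = false := by grind
      have hb : IsPipeSegment D' r c c' := .inr ⟨hcc, by grind, hleft, hseg⟩
      refine ⟨c, ⟨h.next_row, hcc, h2, ?_, ?_, fun j hj => hlight j hj.le⟩, fun q hq =>
        hsteps q hq c hb (.inr (.inr ⟨hb, ?_, rfl⟩))⟩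
      · rintro (⟨h, -⟩ | ⟨-, h, -⟩)
        · exact hcc.ne h
        · simp [hr] at h
      · intro j a b e
        have := hseg j a b
        grind
      · rintro ⟨d, h1, -, h | ⟨-, h, -⟩, -⟩
        · exact h1.ne h.1
        · simp [hr] at h
    · have hseg' : ∀ j, b < j → j < c' → D' r j = hor ∨ D' r j = plus := fun j a b => by
        have := (hu.out j)
        have := h8 j
        have := hseg j
        rcases lt_trichotomy j c with h | h | h <;> grind
      have hbr : D' r b = rt := by rw [(hu.out b (.inl h5)).1, h6]
      have hbs : D' s b = plus := by rw [(hu.out b (.inl h5)).2, h7]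
      have hb : IsPipeSegment D' r b c' := .inr ⟨h5.trans hcc, by grind, hleft, hseg'⟩
      refine ⟨b, ⟨h.next_row, h5.trans hcc, hbr, ?_, ?_, fun j hj => ?_⟩, fun q hq =>
        hsteps q hq b hb (.inr (.inl ⟨hb, ⟨c, h5, ?_, ?_, hbr, h4⟩, h5, h4, ?_⟩))⟩
      · rintro (⟨h, -⟩ | ⟨-, -, -, h⟩)
        · exact (h5.trans hcc).ne h
        · have := h c h5 hcc
          grind
      · intro j a b e
        have := hseg' j a b
        grind
      · rcases lt_or_ge j c' with h | h
        · have := hseg' j hj h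
          grind
        · exact hlight j (hcc.le.trans h)
      · exact .inr ⟨h5, by grind, by grind, fun j a b => hseg' j a (b.trans hcc)⟩
      · refine .inr ⟨h5, by grind, by grind, fun j a b => ?_⟩
        rw [(hu.out j (.inl b)).2]
        exact (h8 j a b).2
      · intro j a b
        have := (hu.out j (.inl b)).2
        have := h8 j a b
        grind
  · obtain ⟨b, z, h1, h2, h3, h4, h5, h6⟩ := hm.left
    have hbc : b < c := h1.trans_le h2
    have hbr : D' r b = rt := by rw [hm.same_top b hbc.ne, h3]
    have hj := hm.eq_jt
    have hnot : ¬ IsPipeSegment D' r b c' := by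
      rintro (⟨h, -⟩ | ⟨-, -, -, h⟩)
      · exact (hbc.trans hcc).ne h
      · have := h c hbc hcc
        grind
    have hst := hm.same_top
    have hsb := hm.same_bot
    have hleft : (D' s c').left = true := by
      have := hm.mark
      have := hw.last
      grind
    refine ⟨b, ⟨h.next_row, hbc.trans hcc, hbr, ?_, ?_, fun j hj => ?_⟩, fun q hq =>
      ⟨c, _, .inl ⟨hnot, hbc, hj, ?_⟩, .inr ⟨hnot, rfl⟩, hm.eq_markAt' h.next_row h.out⟩⟩
    · rintro (⟨h, -⟩ | ⟨-, -, -, h⟩)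
      · exact (hbc.trans hcc).ne h
      · have := h z h1 (h2.trans_lt hcc)
        grind
    · intro j a e hj'
      have hcj : c < j := by
        rcases lt_trichotomy j c with h | h | h
        · have := h5 j a h
          grind
        · grind
        · exact h
      refine .inr ⟨e, ?_, hleft, fun k h1 h2 => ?_⟩
      · have := hw.seg j hcj e
        grind
      · have := hw.seg k (hcj.trans h1) h2
        grind
    · rcases lt_or_ge j c with h | h
      · have := h5 j hj h
        grind
      · exact hlight j h
    · intro j a b
      have := h5 j a b
      grind

theorem GridMove.iseMove {D D' : Grid n} {r s c c' : Fin n}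
    (h : GridMove D D' r s c c' False) (hD : IsMBPD D) (hD' : IsMBPD D') : IseMove D' r D := by
  obtain ⟨b, hb, hst⟩ := h.eWindow hD hD'
  have hw := h.rows.window
  have hli := hw.light
  have hh := fun j => (h.rows.heavy j).2
  have htar : IseTarget D' r s c' b := ⟨hb, by grind, fun j hj => by grind⟩
  by_cases hpl : D' r c' = plus
  · have hex : ∃ q, q < c' ∧ D' s q = rt ∧ (∀ j, q < j → j < c' → D' s j ≠ rt) ∧
        ∀ p, UndroopMove (D r) (D s) (D' r) (D' s) c p c' False → q = p := by
      rcases h.rows with ⟨p, hu⟩ | hm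
      · rcases hu.rightEnd with ⟨-, rfl, h, -⟩ | ⟨-, h1, h2, h3, h4, h5, h6, h7, h8⟩ | ⟨h, -⟩
        · grind
        · refine ⟨p, h1, h5, fun j hj hj' => ?_, fun q hq => ?_⟩
          · have := h6 j hj hj'
            have := hw.seg j (hu.lt.trans hj) hj'
            grind
          · have := hq.rightEnd
            unfold RightEnd at this
            rcases lt_trichotomy p q with h | h | h
            · grind
            · exact h
            · grind
        · exact h.elim
      · obtain ⟨q, h1, h2, h3⟩ := (hD'.rowValid s).exists_rt c' (by
          have := hm.mark
          grind)
        refine ⟨q, h1, h2, fun j a b => ?_, fun p hu => ?_⟩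
        · have := h3 j a b
          grind
        · have := hu.leftEnd
          have := hm.eq_jt
          unfold LeftEnd at *
          grind
    obtain ⟨q, h1, h2, h3, h4⟩ := hex
    exact ⟨s, c', b, q, htar, .inl ⟨hpl, h1, h2, h3⟩, hst q h4⟩
  · refine ⟨s, c', b, c', htar, .inr ⟨hpl, rfl⟩, hst c' fun p hu => ?_⟩
    have := hu.rightEnd
    unfold RightEnd at this
    grind

theorem GridMove.iseStarMove {D D' : Grid n} {r s c c' : Fin n}
    (h : GridMove D D' r s c c' True) (hD : IsMBPD D) (hD' : IsMBPD D') :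
    IseStarMove D' r D := by
  obtain ⟨b, hb, hst⟩ := h.eWindow hD hD'
  have hw := h.rows.window
  have hcc := hw.lt
  obtain ⟨h1, h2, h3⟩ : D r c' = rt ∧ D s c' = plus ∧ _ := by simpa using hw.last
  have hli := hw.light
  have hh := fun j => (h.rows.heavy j).2
  refine ⟨s, c', b, ⟨hb, fun j => ?_, ?_, fun j hj => ?_⟩, hst c' fun p hu => ?_⟩
  · have := h3 j
    rcases lt_trichotomy j c' with h | h | h <;> grind
  · rcases h.rows with ⟨p, hu⟩ | hm
    · have := hu.rightEnd
      unfold RightEnd at this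
      grind
    · have := hm.same_top c'
      grind
  · have := h.rows.out (.inr hj)
    have := h3 j hj
    grind
  · have := hu.rightEnd
    unfold RightEnd at this
    grind


/-! ### Every target of an F- or E-move carries an explicit move -/

theorem Tile.right_of_heavy {t : Tile} (h : t.heavy = true) : t.right = false := by
  cases t <;> simp_all [Tile.heavy, Tile.right]

theorem Tile.down_of_heavy {t : Tile} (h : t.heavy = true) : t.down = false := by
  cases t <;> simp_all [Tile.heavy, Tile.down]

/-- Replace the rows `r` and `s`. -/
def replaceRows (D : Grid n) (r s : Fin n) (x y : Fin n → Tile) : Grid n := fun i =>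
  if i = r then x else if i = s then y else D i

theorem gridMove_replaceRows {D : Grid n} {r s c c' : Fin n} {star : Prop} {x' y' : Fin n → Tile}
    (hs : (s : ℕ) = r + 1) (h : RowMove (D r) (D s) x' y' c c' star) :
    GridMove D (replaceRows D r s x' y') r s c c' star := by
  have hrs : s ≠ r := by rintro rfl; omega
  refine ⟨hs, fun i h1 h2 => by simp [replaceRows, h1, h2], ?_⟩
  simpa [replaceRows, hrs] using h

theorem replaceRows_gridMove {D : Grid n} {r s c c' : Fin n} {star : Prop} {x y : Fin n → Tile}
    (hs : (s : ℕ) = r + 1) (h : RowMove x y (D r) (D s) c c' star) :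
    GridMove (replaceRows D r s x y) D r s c c' star := by
  have hrs : s ≠ r := by rintro rfl; omega
  refine ⟨hs, fun i h1 h2 => by simp [replaceRows, h1, h2], ?_⟩
  simpa [replaceRows, hrs] using h

/-- The tile below a heavy tile is light and has no edge above, so it connects right. Its pipe can
only turn up at a J, and the first candidate is the one at c'. -/
theorem IsfTarget.window {D : Grid n} {r s c c' : Fin n} (h : IsfTarget D r s c c')
    (hD : IsMBPD D) : Window (D r) (D s) c c' False := by
  have h1 := h.f1_heavy
  have h2 := hD.vertical r s c h.next_row
  have h3 := h.f3
  have h4 := h.f2_gt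
  have h5 := h.f2_jt
  have hr : (D s c).right = true := by
    have := h3 c h4
    cases h6 : D s c <;> cases h7 : D r c <;> simp_all [Tile.heavy, Tile.right, Tile.up, Tile.down]
  refine ⟨h4, h1, h.f1_rightmost, h3, hr, ?_, .inl ⟨id, h5⟩⟩
  rcases (hD.rowValid s).right_cases c hr with h | ⟨j, hj, hj', hb⟩
  · exact fun j hj _ => h j hj
  · rcases lt_trichotomy j c' with h' | rfl | h'
    · have := h.f2_min j hj h'
      grind
    · exact hb
    · have := hb c' h4 h'
      grind

theorem IsfStarTarget.window {D : Grid n} {r s c c' : Fin n} (h : IsfStarTarget D r s c c')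
    (hD : IsMBPD D) : Window (D r) (D s) c c' True := by
  have h1 := h.f1_heavy
  have h2 := hD.vertical r s c h.next_row
  have h2' := hD.vertical r s c' h.next_row
  have h3 := h.f3
  have h4 := h.fs2_rt
  obtain ⟨k, hk, hk', hb⟩ := (hD.rowValid r).exists_rt_after c (Tile.right_of_heavy h1)
  have hkc : k = c' := by
    have := h.fs2_max
    have := hb c'
    rcases lt_trichotomy k c' with h | h | h <;> grind
  subst hkc
  have hr : (D s c).right = true := by
    have := h3 c hk
    cases h6 : D s c <;> cases h7 : D r c <;> simp_all [Tile.heavy, Tile.right, Tile.up, Tile.down]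
  have hall : ∀ j, c < j → D s j = hor ∨ D s j = plus := by
    rcases (hD.rowValid s).right_cases c hr with h' | ⟨j, hj, hj', -⟩
    · exact h'
    · have := h.fs2 j hj
      grind
  refine ⟨hk, h1, h.f1_rightmost, h3, hr, fun j hj _ => hall j hj, .inr ⟨trivial, h4, ?_,
    fun j hj => ⟨hb j hj, hall j (hk.trans hj)⟩⟩⟩
  have := hall k hk
  grind

/-- In the unstarred case the tile above the J at c' connects down. If it is a plus, its horizontal
pipe, followed to the left, starts at an R before reaching c, since a heavy tile has no edge to the
right. This R is the left column of a doublecross. -/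
theorem Window.exists_rightEnd {x y : Fin n → Tile} {c c' : Fin n} {star : Prop}
    (h : Window x y c c' star) (hx : RowValid x) (hv : ∀ j, (x j).down = (y j).up) :
    ∃ p, c < p ∧ p ≤ c' ∧ ((¬ star ∧ p = c' ∧ (x p = ver ∨ x p = rt)) ∨
      (¬ star ∧ p < c' ∧ x p = rt ∧ y p = plus ∧ (∀ j, p < j → j < c' → x j = hor ∨ x j = plus) ∧
        x c' = plus) ∨ (star ∧ p = c')) := by
  rcases h.last with ⟨hs, h1⟩ | ⟨hs, -⟩
  · have h2 := h.rightmost c' h.lt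
    have h3 := hv c'
    by_cases hp : x c' = plus
    · have := h.heavy
      obtain ⟨p, h4, h5, h6, h7⟩ := hx.exists_rt_between (z := c) h.lt (Tile.right_of_heavy this)
        (by simp [hp, Tile.left])
      refine ⟨p, h4, h5.le, .inr (.inl ⟨hs, h5, h6, ?_, h7, hp⟩)⟩
      have := hv p
      have := h.seg p h4 h5
      grind
    · refine ⟨c', h.lt, le_rfl, .inl ⟨hs, rfl, ?_⟩⟩
      cases h4 : x c' <;> simp_all [Tile.heavy, Tile.up, Tile.down]
  · exact ⟨c', h.lt, le_rfl, .inr (.inr ⟨hs, rfl⟩)⟩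

theorem Window.exists_undroopMove {x y : Fin n → Tile} {c c' : Fin n} {star : Prop}
    (h : Window x y c c' star) (hx : RowValid x) (hv : ∀ j, (x j).down = (y j).up)
    (hc : (x c = blank ∧ (y c = hor ∨ y c = rt)) ∨ (x c = mjt ∧ y c = hor ∧
      ∃ b < c, x b = rt ∧ y b = plus ∧
        ∀ j, b < j → j < c → (x j = hor ∨ x j = plus) ∧ (y j = hor ∨ y j = plus))) :
    ∃ p x' y', UndroopMove x y x' y' c p c' star := by
  obtain ⟨p, h1, h2, h3⟩ := h.exists_rightEnd hx hv
  have hlast := h.last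
  -- Strictly inside the window the old upper row slides down and a straight pipe replaces it, with
  -- a plus exactly where a pipe comes from above.
  refine ⟨p, fun j => if j = c then (if x c = blank then rt else plus) else
    if c < j ∧ j < p then (if (x j).up = true then plus else hor) else
    if j = p then (if x p = ver then jt else hor) else x j,
    fun j => if j = c then (if y c = hor then jt else ver) else
    if c < j ∧ j < p then x j else if j = p then (if y p = jt then blank else rt) else
    if j = c' then mjt else y j, h, h1, h2, ?_, ?_, ?_, ?_⟩
  · intro j hj
    grind
  · intro j a b
    have h4 := h.rightmost j a
    have h5 := hv j
    have h6 := h.seg j a (b.trans_le h2)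
    simp only [a.ne', a, b, if_false, and_self, if_true]
    unfold Inner
    cases h7 : x j <;> cases h8 : y j <;> simp_all [Tile.heavy, Tile.up, Tile.down]
  · unfold LeftEnd
    simp only [if_true]
    grind
  · unfold RightEnd
    grind

/-- For a marked J at c, compare the R's in columns b and z where the pipes of the upper and the
lower row through column c begin. If b < z, only markings move; if z < b, both rows are straight
from b to c, which is Case C. Equality is impossible, as an R below an R does not match. -/
theorem Window.exists_rowMove {x y : Fin n → Tile} {c c' : Fin n} {star : Prop}
    (h : Window x y c c' star) (hx : RowValid x) (hy : RowValid y)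
    (hv : ∀ j, (x j).down = (y j).up) : ∃ x' y', RowMove x y x' y' c c' star := by
  have h1 := h.heavy
  have hr := h.right
  have hyc : y c = hor ∨ y c = rt := by
    have := h.light c h.lt
    have := hv c
    cases h6 : y c <;> cases h7 : x c <;> simp_all [Tile.heavy, Tile.right, Tile.up, Tile.down]
  have hxc : x c = blank ∨ x c = mjt := by
    cases h6 : x c <;> simp_all [Tile.heavy]
  rcases hxc with hxc | hxc
  · obtain ⟨p, x', y', h'⟩ := h.exists_undroopMove hx hv (.inl ⟨hxc, hyc⟩)
    exact ⟨x', y', .inl ⟨p, h'⟩⟩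
  obtain ⟨b, hb, hb', hbs⟩ := hx.exists_rt c (by simp [hxc, Tile.left])
  by_cases hz : ∃ z, b < z ∧ z ≤ c ∧ y z = rt ∧ ∀ j, z < j → j ≤ c → y j = hor ∨ y j = plus
  · obtain ⟨z, h2, h3, h4, h5⟩ := hz
    classical
    refine ⟨Function.update x c jt, if star then y else Function.update y c' mjt, .inr
      ⟨h, hxc, by simp, ⟨b, z, h2, h3, hb', h4, hbs, h5⟩, fun j hj => by simp [hj], fun j hj => ?_,
        ?_⟩⟩
    · split_ifs <;> simp [hj]
    · by_cases hs : star <;> simp [hs]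
  · have hyh : y c = hor := by
      rcases hyc with h' | h'
      · exact h'
      · exact absurd ⟨c, hb, le_rfl, h', fun j h1 h2 => absurd h1 (not_lt.2 h2)⟩ hz
    obtain ⟨z, h2, h3, h4⟩ := hy.exists_rt c (by simp [hyh, Tile.left])
    have hzb : z ≤ b := by
      by_contra hzb
      refine hz ⟨z, not_le.1 hzb, h2.le, h3, fun j h5 h6 => ?_⟩
      rcases lt_or_eq_of_le h6 with h6 | rfl
      · exact h4 j h5 h6
      · exact .inl hyh
    have hvb := hv b
    have hzb : z < b := lt_of_le_of_ne hzb (by rintro rfl; grind)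
    obtain ⟨p, x', y', h'⟩ := h.exists_undroopMove hx hv (.inr ⟨hxc, hyh, b, hb, hb', by
      have := h4 b hzb hb
      grind, fun j h5 h6 => ⟨hbs j h5 h6, h4 j (hzb.trans h5) h6⟩⟩)
    exact ⟨x', y', .inl ⟨p, h'⟩⟩

theorem Window.exists_gridMove {D : Grid n} {r s c c' : Fin n} {star : Prop}
    (h : Window (D r) (D s) c c' star) (hs : (s : ℕ) = r + 1) (hD : IsMBPD D) :
    ∃ D', IsMBPD D' ∧ GridMove D D' r s c c' star := by
  obtain ⟨x', y', h'⟩ := h.exists_rowMove (hD.rowValid r) (hD.rowValid s)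
    fun j => hD.vertical r s j hs
  have := gridMove_replaceRows hs h'
  exact ⟨_, this.isMBPD_iff.1 hD, this⟩

/-- The hypotheses of an `e`-move (an `e*`-move if `star` holds) with target `(s, c')` and left window
column `b`. -/
structure ETarget (D : Grid n) (r s c' b : Fin n) (star : Prop) : Prop extends
    IsEWindow D r s c' b where
  light : ∀ j, j < c' → (D s j).heavy = false
  kind : (¬ star ∧ (D s c').heavy = true) ∨ (star ∧ (D s c').heavy = false ∧
    (D r c' = rt ∨ D s c' = rt) ∧ ∀ j, c' < j → D r j ≠ rt ∧ D s j ≠ rt)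

theorem RowValid.no_jt_after {x : Fin n → Tile} (hx : RowValid x) {z : Fin n}
    (hr : (x z).right = true) (hc : ∀ k, z < k → x k ≠ rt) :
    ∀ k, z < k → x k = hor ∨ x k = plus := by
  rcases hx.right_cases z hr with h | ⟨j, hj, hj', -⟩
  · exact h
  · obtain ⟨k, hk, hk', -⟩ := hx.exists_rt_after j (by grind)
    exact absurd hk' (hc k (hj.trans hk))

/-- In the lower row, a pipe that leaves `(s, b)` to the right turns up before the target. -/
theorem ETarget.exists_jt {D : Grid n} {r s c' b : Fin n} {star : Prop}
    (h : ETarget D r s c' b star) (hD : IsMBPD D) {i : Fin n} (hr : (D i b).right = true)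
    (hn : ¬ IsPipeSegment D i b c') (hli : ∀ j, b < j → j < c' → (D i j).heavy = false) :
    ∃ j, b < j ∧ j < c' ∧ D i j = jt ∧ ∀ k, b < k → k < j → D i k = hor ∨ D i k = plus := by
  have hlt := h.e2_lt
  rcases (hD.rowValid i).right_cases b hr with h1 | ⟨j, hj, hj', hb⟩
  · refine absurd (.inr ⟨hlt, hr, ?_, fun j a _ => h1 j a⟩) hn
    have := h1 c' hlt
    grind
  · have hjc : j < c' := by
      by_contra hc
      refine hn (.inr ⟨hlt, hr, ?_, fun k a d => hb k a (d.trans_le (not_lt.1 hc))⟩)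
      rcases lt_or_eq_of_le (not_lt.1 hc) with hc | hc
      · have := hb c' hlt hc
        grind
      · grind
    have := hli j hj hjc
    exact ⟨j, hj, hjc, by grind, hb⟩


theorem Tile.hor_or_jt {t : Tile} (h1 : t.heavy = false) (h2 : t.down = false) :
    t = hor ∨ t = jt := by
  cases t <;> simp_all [Tile.heavy, Tile.down]

theorem Tile.hor_or_rt {t : Tile} (h1 : t.heavy = false) (h2 : t.up = false) :
    t = hor ∨ t = rt := by
  cases t <;> simp_all [Tile.heavy, Tile.up]

/-- The right end of the droop window of an `e`-move. -/
theorem ETarget.exists_rightEnd {D : Grid n} {r s c' b c : Fin n} {star : Prop}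
    (h : ETarget D r s c' b star) (hD : IsMBPD D) (hc : c < c')
    (hseg : ∀ j, c < j → j < c' → D r j = hor ∨ D r j = plus) (hleft : (D r c').left = true)
    (hr : (D s c).right = false) :
    ∃ p, c < p ∧ p ≤ c' ∧
      ((¬ star ∧ p = c' ∧ (D r p = hor ∨ D r p = jt) ∧ D s p = blank) ∨
      (¬ star ∧ p < c' ∧ D r p = hor ∧ D s p = rt ∧ D r c' = plus ∧ D s c' = mjt ∧
        ∀ j, p < j → j < c' → D s j = hor ∨ D s j = plus) ∨
      (star ∧ p = c' ∧ D r p = hor ∧ D s p = rt ∧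
        ∀ j, p < j → (D r j = hor ∨ D r j = plus) ∧ (D s j = hor ∨ D s j = plus))) := by
  have hv := fun j => hD.vertical r s j h.next_row
  have hl := h.e3 c' h.e2_lt
  rcases h.kind with ⟨hs, hk⟩ | ⟨hs, hk, hk', hmax⟩
  · have hk' : D s c' = blank ∨ D s c' = mjt := by
      cases h6 : D s c' <;> simp_all [Tile.heavy]
    rcases hk' with hk' | hk'
    · refine ⟨c', hc, le_rfl, .inl ⟨hs, rfl, Tile.hor_or_jt hl ?_, hk'⟩⟩
      rw [hv c', hk']; rfl
    · have hpl : D r c' = plus := by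
        have := hv c'
        cases h6 : D r c' <;> simp_all [Tile.heavy, Tile.left, Tile.down, Tile.up]
      obtain ⟨p, h1, h2, h3, h4⟩ := (hD.rowValid s).exists_rt_between hc hr (by simp [hk', Tile.left])
      refine ⟨p, h1, h2.le, .inr (.inl ⟨hs, h2, ?_, h3, hpl, hk', h4⟩)⟩
      have := hv p
      have := hseg p h1 h2
      grind
  · have hrt : D s c' = rt := by grind
    have hvc := hv c'
    have hhj := Tile.hor_or_jt hl (by grind)
    have hh : D r c' = hor := by
      rcases hhj with h' | h'
      · exact h'
      · obtain ⟨k, hk, hk', -⟩ := (hD.rowValid r).exists_rt_after c' (by simp [h', Tile.right])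
        exact absurd hk' (hmax k hk).1
    have h1 := (hD.rowValid r).no_jt_after (z := c') (by simp [hh, Tile.right])
      fun k hk => (hmax k hk).1
    have h2 := (hD.rowValid s).no_jt_after (z := c') (by simp [hrt, Tile.right])
      fun k hk => (hmax k hk).2
    exact ⟨c', hc, le_rfl, .inr (.inr ⟨hs, rfl, hh, hrt, fun j hj => ⟨h1 j hj, h2 j hj⟩⟩)⟩

theorem ETarget.exists_undroopMove {D : Grid n} {r s c' b c : Fin n} {star : Prop}
    (h : ETarget D r s c' b star) (hD : IsMBPD D) (hc : c < c') (hbc : b ≤ c)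
    (hseg : ∀ j, c < j → j < c' → D r j = hor ∨ D r j = plus) (hleft : (D r c').left = true)
    (hend : (b = c ∧ (D s c = jt ∨ D s c = ver)) ∨ (b < c ∧ D r c = plus ∧ D s c = jt ∧
      D s b = plus ∧ ∀ j, b < j → j < c → (D r j = hor ∨ D r j = plus) ∧
        (D s j = hor ∨ D s j = plus))) :
    ∃ x y p, UndroopMove x y (D r) (D s) c p c' star := by
  have hv := fun j => hD.vertical r s j h.next_row
  obtain ⟨p, h1, h2, h3⟩ := h.exists_rightEnd hD hc hseg hleft (by grind)
  have hrt := h.e2_rt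
  refine ⟨fun j => if j = c then (if b = c then blank else mjt) else
    if c < j ∧ j < p then D s j else
    if j = p then (if D r j = jt then ver else rt) else D r j,
    fun j => if j = c then (if b = c ∧ D s c = ver then rt else hor) else
    if c < j ∧ j < p then (if (D s j).down = true then plus else hor) else
    if j = p then (if D s p = blank then jt else plus) else
    if j = c' then jt else D s j, p, ⟨hc, ?_, ?_, ?_, ?_, ?_, ?_⟩, h1, h2, ?_, ?_, ?_, ?_⟩
  · grind
  · intro j hj
    have := h.e3 j (hbc.trans_lt hj)
    have := h.light j
    grind
  · intro j hj
    have := h.light j hj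
    grind
  · grind
  · intro j a d
    grind
  · grind
  · intro j hj
    grind
  · intro j a d
    have h5 := hv j
    have h6 := h.light j (d.trans_le h2)
    have h7 := hseg j a (d.trans_le h2)
    simp only [a.ne', a, d, if_false, and_self, if_true]
    unfold Inner
    cases h7 : D r j <;> cases h8 : D s j <;> simp_all [Tile.heavy, Tile.up, Tile.down]
  · unfold LeftEnd
    rcases hend with ⟨rfl, hend⟩ | ⟨e1, e2, e3, e4, e5⟩
    · grind
    · refine .inr ?_
      simp only [if_true, e1.ne, if_false, false_and]
      refine ⟨trivial, e2, trivial, e3, b, e1, ?_, ?_, fun j a d => ?_⟩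
      · grind
      · grind
      · have := e5 j a d
        grind
  · unfold RightEnd
    grind

theorem ETarget.exists_markMove {D : Grid n} {r s c' b c : Fin n} {star : Prop}
    (h : ETarget D r s c' b star) (hD : IsMBPD D) (hbc : b < c) (hc : c < c') (hj : D r c = jt)
    (hseg : ∀ j, b < j → j < c → D r j = hor ∨ D r j = plus) :
    ∃ x y, MarkMove x y (D r) (D s) c c' star := by
  have hv := fun j => hD.vertical r s j h.next_row
  have hrt := h.e2_rt
  have hx := hD.rowValid r
  have hy := hD.rowValid s
  have hvc := hv c
  have hyc : D s c = hor ∨ D s c = rt := Tile.hor_or_rt (h.light c hc) (by grind)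
  have hyr : (D s c).right = true := by grind
  -- An R of the lower row at z forces an R of the upper row at some k between c and z. By
  -- maximality of b, the lower row would be a pipe segment from k to c', which the R at z rules
  -- out.
  have hno : ∀ z, c < z → z ≤ c' → D s z ≠ rt := by
    intro z h1 h2 h3
    have hvz := hv z
    have := Tile.hor_or_jt (h.e3 z (hbc.trans h1)) (by grind)
    obtain ⟨k, h4, h5, h6, -⟩ := hx.exists_rt_between h1 (by simp [hj, Tile.right])
      (show (D r z).left = true by grind)
    rcases h.e2_max k (hbc.trans h4) (h5.trans_le h2) h6 with h7 | ⟨-, -, h7, h8⟩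
    · grind
    · rcases lt_or_eq_of_le h2 with h2 | rfl
      · have := h8 z h5 h2
        grind
      · grind
  -- A blank target is excluded in the same way: it would yield a pipe segment ending in a blank.
  have key : (D s c').left = true ∧ ((¬ star ∧ D s c' = mjt) ∨ (star ∧ D r c' = rt ∧ D s c' = plus ∧
      ∀ j, c' < j → (D r j = hor ∨ D r j = plus) ∧ (D s j = hor ∨ D s j = plus))) := by
    rcases h.kind with ⟨hs, hk⟩ | ⟨hs, hk, hk', hmax⟩
    · have hk' : D s c' = blank ∨ D s c' = mjt := by
        cases h6 : D s c' <;> simp_all [Tile.heavy]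
      rcases hk' with hk' | hk'
      · have hvc' := hv c'
        have := Tile.hor_or_jt (h.e3 c' h.e2_lt) (by grind)
        obtain ⟨k, h4, h5, h6, -⟩ := hx.exists_rt_between hc (by simp [hj, Tile.right])
          (show (D r c').left = true by grind)
        rcases h.e2_max k (hbc.trans h4) h5 h6 with h7 | ⟨-, -, h7, -⟩
        · grind
        · grind
      · exact ⟨by simp [hk', Tile.left], .inl ⟨hs, hk'⟩⟩
    · have hrtc : D r c' = rt := by
        have := hno c' hc le_rfl
        grind
      have h1 := hx.no_jt_after (z := c') (by simp [hrtc, Tile.right]) fun k hk => (hmax k hk).1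
      have h2 := hy.no_jt_after (z := c) hyr fun k hk => by
        rcases le_or_gt k c' with h | h
        · exact hno k hk h
        · exact (hmax k h).2
      have h3 := h2 c' hc
      have hvc' := hv c'
      exact ⟨by grind, .inr ⟨hs, hrtc, by grind, fun j hj => ⟨h1 j hj, h2 j (hc.trans hj)⟩⟩⟩
  obtain ⟨hl, key⟩ := key
  obtain ⟨z, h1, h2, h3⟩ := hy.exists_rt c' hl
  have hzc : z ≤ c := not_lt.1 fun hzc => hno z hzc h1.le h2
  have hbz : b < z := by
    by_contra hbz
    refine h.e2_not (.inr ⟨h.e2_lt, ?_, hl, fun j a d => h3 j ((not_lt.1 hbz).trans_lt a) d⟩)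
    rcases lt_or_eq_of_le (not_lt.1 hbz) with h' | rfl
    · have := h3 b h' h.e2_lt
      grind
    · grind
  classical
  refine ⟨Function.update (D r) c mjt, if star then D s else Function.update (D s) c' jt,
    ⟨hc, by simp [Tile.heavy], fun j hj => ?_, fun j hj => ?_, ?_, fun j a d => ?_, ?_⟩, by simp, hj,
    ⟨b, z, hbz, hzc, by simp [hbc.ne, hrt], ?_, fun j a d => ?_, fun j a d => ?_⟩, fun j hj => ?_,
    fun j hj => ?_, ?_⟩
  · rw [Function.update_of_ne hj.ne']
    exact h.e3 j (hbc.trans hj)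
  · have := h.light j hj
    split_ifs <;> simp [hj.ne, this]
  · split_ifs <;> simp [hc.ne, hyr]
  · have := h3 j (hzc.trans_lt a) d
    split_ifs <;> simp [d.ne, this]
  · rcases key with ⟨hs, -⟩ | ⟨hs, e1, e2, e3⟩
    · simp [hs]
    · simp only [hs, not_true, false_and, false_or, if_true, true_and]
      refine ⟨by simp [hc.ne', e1], e2, fun j hj => ?_⟩
      rw [Function.update_of_ne (hc.trans hj).ne']
      exact e3 j hj
  · split_ifs <;> simp [h1.ne, h2]
  · rw [Function.update_of_ne d.ne]
    exact hseg j a d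
  · have := h3 j a (d.trans_lt hc)
    split_ifs <;> simp [(d.trans_lt hc).ne, this]
  · simp [hj]
  · split_ifs <;> simp [hj]
  · rcases key with ⟨hs, h'⟩ | ⟨hs, -⟩
    · exact .inl ⟨hs, h'⟩
    · simp [hs]

/-- The column c of the source is the J where the upper pipe from the R at b turns up (Case L), or
the J where the lower pipe through a plus below that R turns up (Case D), or b itself (Case S). -/
theorem ETarget.exists_gridMove {D : Grid n} {r s c' b : Fin n} {star : Prop}
    (h : ETarget D r s c' b star) (hD : IsMBPD D) :
    ∃ D₀ c, IsMBPD D₀ ∧ GridMove D₀ D r s c c' star := by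
  have hv := fun j => hD.vertical r s j h.next_row
  have hrt := h.e2_rt
  suffices hs : ∃ x y c, RowMove x y (D r) (D s) c c' star by
    obtain ⟨x, y, c, hs⟩ := hs
    have := replaceRows_gridMove h.next_row hs
    exact ⟨_, c, this.isMBPD_iff.2 hD, this⟩
  by_cases hp : IsPipeSegment D r b c'
  · rcases hp with hp | ⟨-, -, hp1, hp2⟩
    · exact absurd hp.1 h.e2_lt.ne
    have hb := h.light b h.e2_lt
    have hvb := hv b
    by_cases hpl : D s b = plus
    · obtain ⟨c, h1, h2, h3, h4⟩ := h.exists_jt hD (i := s) (by simp [hpl, Tile.right]) h.e2_not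
        fun j _ hj => h.light j hj
      have hvc := hv c
      obtain ⟨x, y, p, hm⟩ := h.exists_undroopMove hD h2 h1.le
        (fun j a d => hp2 j (h1.trans a) d) hp1
        (.inr ⟨h1, by have := hp2 c h1 h2; grind, h3, hpl,
          fun j a d => ⟨hp2 j a (d.trans h2), h4 j a d⟩⟩)
      exact ⟨x, y, c, .inl ⟨p, hm⟩⟩
    · obtain ⟨x, y, p, hm⟩ := h.exists_undroopMove hD h.e2_lt le_rfl hp2 hp1 (.inl ⟨rfl, by
        cases h6 : D s b <;> simp_all [Tile.heavy, Tile.up, Tile.down]⟩)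
      exact ⟨x, y, b, .inl ⟨p, hm⟩⟩
  · obtain ⟨c, h1, h2, h3, h4⟩ := h.exists_jt hD (i := r) (by simp [hrt, Tile.right]) hp
      fun j hj _ => h.e3 j hj
    obtain ⟨x, y, hm⟩ := h.exists_markMove hD h1 h2 h3 h4
    exact ⟨x, y, c, .inr hm⟩


/-! ### Moves are deterministic -/

theorem IsDroop.source_unique {M M' E : Grid n} {r s b d : Fin n} (h : IsDroop M E r s b d)
    (h' : IsDroop M' E r s b d) : M = M' := by
  -- A droop can be undone tile by tile, so its source is a function of its outcome.
  have key : ∀ {M : Grid n}, IsDroop M E r s b d → M =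
      replaceRows E r s (fun j => if j = b then (if E r b = jt then plus else rt) else
        if j = d then (if E r d = rt then hor else jt) else
        if b < j ∧ j < d then (if (E r j).up = true then plus else hor) else E r j)
        (fun j => if j = b then (if E s b = hor then jt else ver) else
        if j = d then (if E s d = plus then rt else blank) else
        if b < j ∧ j < d then E r j else E s j) := by
    rintro M ⟨h1, -, h2, h3⟩
    have hs := h2.next_row
    have hrs : r ≠ s := by rintro rfl; omega
    have hlt := h2.lt
    have hv := fun j => h1.vertical r s j hs
    have htop : (M r b).right = true ∧ (M r d).left = true ∧
        ∀ j, b < j → j < d → M r j = hor ∨ M r j = plus := by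
      rcases h2.top with h | h
      · exact absurd h.1 hlt.ne
      · exact h.2
    obtain ⟨e1, e2, e3⟩ := htop
    obtain ⟨f1, f2, f3⟩ := h2.bottom
    have hE1 : ∀ j, E r j = if j = b then (if M r b = plus then jt else blank)
        else if j = d then (if M r d = hor then rt else ver)
        else if b < j ∧ j < d then M s j else M r j := fun j => by simp [h3, droop]
    have hE2 : ∀ j, E s j = if j = b then (if M s b = jt then hor else rt)
        else if j = d then (if M s d = rt then plus else jt)
        else if b < j ∧ j < d then (if (M s j).down = true then plus else hor) else M s j :=
      fun j => by simp [h3, droop, hrs.symm]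
    have l1 := h2.light r b (.inl rfl) le_rfl hlt.le
    have l2 := h2.light s b (.inr rfl) le_rfl hlt.le
    have l3 := h2.light r d (.inl rfl) hlt.le le_rfl
    have l4 := h2.light s d (.inr rfl) hlt.le le_rfl
    have c1 := h2.left_corner
    have c2 := h2.right_corner
    have v1 := hv b
    have v2 := hv d
    have t1 : M r b = rt ∨ M r b = plus := by
      cases h : M r b <;> simp_all [Tile.right]
    have t2 : M s b = jt ∨ M s b = ver := by
      cases h : M s b <;> simp_all [Tile.right, Tile.up, Tile.heavy]
    have t3 : M r d = hor ∨ M r d = jt := by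
      cases h : M r d <;> simp_all [Tile.left, Tile.heavy]
    have t4 : M s d = blank ∨ M s d = rt := by
      cases h : M s d <;> simp_all [Tile.left, Tile.up, Tile.heavy]; grind
    funext i j
    unfold replaceRows
    by_cases hi : i = r
    · subst hi
      have := hv j
      have := e3 j
      simp only [if_true, hE1]
      split_ifs <;> grind
    by_cases hi' : i = s
    · subst hi'
      simp only [if_true, hE1, hE2, if_neg hi]
      split_ifs <;> grind
    · simp [hi, hi', h3, droop]
  rw [key h, key h']

theorem IsDoublecross.left_unique {D : Grid n} {r s d d' c' : Fin n} (h : IsDoublecross D r s d c')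
    (h' : IsDoublecross D r s d' c') : d = d' := by
  obtain ⟨h1, ⟨h2, -⟩ | ⟨-, -, -, h2⟩, -, h3, -⟩ := h
  · grind
  obtain ⟨h1', ⟨h2', -⟩ | ⟨-, -, -, h2'⟩, -, h3', -⟩ := h'
  · grind
  rcases lt_trichotomy d d' with h | h | h
  · have := h2 _ h h1'
    grind
  · exact h
  · have := h2' _ h h1
    grind

theorem FSteps.unique {D D₁ D₂ : Grid n} {r s c c' q : Fin n} (h₁ : FSteps D r s c c' q D₁)
    (h₂ : FSteps D r s c c' q D₂) : D₁ = D₂ := by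
  obtain ⟨M₁, h₁, rfl⟩ := h₁
  obtain ⟨M₂, h₂, rfl⟩ := h₂
  suffices h : M₁ = M₂ by rw [h]
  rcases h₁ with ⟨h₁, h₁'⟩ | ⟨h₁, h₁'⟩ <;> rcases h₂ with ⟨h₂, h₂'⟩ | ⟨h₂, h₂'⟩
  · exact h₁'.source_unique h₂'
  · exact absurd h₁ h₂
  · exact absurd h₂ h₁
  · rw [h₁', h₂']

theorem next_row_unique {r s s' : Fin n} (h : (s : ℕ) = r + 1) (h' : (s' : ℕ) = r + 1) : s = s' :=
  Fin.ext (h.trans h'.symm)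

theorem IsfMove.unique {D D₁ D₂ : Grid n} {r c : Fin n} (h₁ : IsfMove D r c D₁)
    (h₂ : IsfMove D r c D₂) : D₁ = D₂ := by
  obtain ⟨s, c', q, h1, h2, h3⟩ := h₁
  obtain ⟨s₂, c₂', q₂, h1', h2', h3'⟩ := h₂
  obtain rfl := next_row_unique h1.next_row h1'.next_row
  have hc : c' = c₂' := by
    have e1 := h1.f2_min c₂' h1'.f2_gt
    have e2 := h1'.f2_min c' h1.f2_gt
    have e3 := h1.f2_jt
    have e4 := h1'.f2_jt
    rcases lt_trichotomy c' c₂' with h | h | h <;> grind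
  subst hc
  have hq : q = q₂ := by
    rcases h2 with ⟨a1, a2, a3⟩ | ⟨a1, a2⟩ <;> rcases h2' with ⟨b1, b2, b3⟩ | ⟨b1, b2⟩
    · exact a3.left_unique b3
    · exact absurd ⟨q, a1, a2, a3⟩ b1
    · exact absurd ⟨q₂, b1, b2, b3⟩ a1
    · rw [a2, b2]
  subst hq
  exact h3.unique h3'

theorem IsfStarMove.unique {D D₁ D₂ : Grid n} {r c : Fin n} (h₁ : IsfStarMove D r c D₁)
    (h₂ : IsfStarMove D r c D₂) : D₁ = D₂ := by
  obtain ⟨s, c', h1, h3⟩ := h₁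
  obtain ⟨s₂, c₂', h1', h3'⟩ := h₂
  obtain rfl := next_row_unique h1.next_row h1'.next_row
  have hc : c' = c₂' := by
    have e1 := h1.fs2_max c₂'
    have e2 := h1'.fs2_max c'
    have e3 := h1.fs2_rt
    have e4 := h1'.fs2_rt
    rcases lt_trichotomy c' c₂' with h | h | h <;> grind
  subst hc
  exact h3.unique h3'

theorem IsFirstJ.unique {D : Grid n} {i c d d' : Fin n} (h : IsFirstJ D i c d)
    (h' : IsFirstJ D i c d') : d = d' := by
  obtain ⟨h1, h2, h3⟩ := h
  obtain ⟨h1', h2', h3'⟩ := h'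
  have := h3 d' h1'
  have := h3' d h1
  rcases lt_trichotomy d d' with h | h | h <;> grind

theorem IsELeft.unique {D : Grid n} {r s c c' d d' : Fin n} (h : IsELeft D r s c c' d)
    (h' : IsELeft D r s c c' d') : d = d' := by
  rcases h with ⟨h1, h2⟩ | ⟨h1, h2, h3⟩ | ⟨h1, h2, h3⟩ <;>
    rcases h' with ⟨h1', h2'⟩ | ⟨h1', h2', h3'⟩ | ⟨h1', h2', h3'⟩
  · exact h2.unique h2'
  · exact absurd h1' h1
  · exact absurd h1' h1
  · exact absurd h1 h1'
  · exact h3.unique h3'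
  · exact absurd h2 h2'
  · exact absurd h1 h1'
  · exact absurd h2' h2
  · rw [h3, h3']

theorem ESteps.unique {D D₁ D₂ : Grid n} {r s c c' q : Fin n} (h₁ : ESteps D r s c c' q D₁)
    (h₂ : ESteps D r s c c' q D₂) : D₁ = D₂ := by
  obtain ⟨l, M₁, hl, h₁, rfl⟩ := h₁
  obtain ⟨l', M₂, hl', h₂, rfl⟩ := h₂
  obtain rfl := hl.unique hl'
  suffices h : M₁ = M₂ by rw [h]
  rcases h₁ with ⟨h₁, h₁'⟩ | ⟨h₁, h₁'⟩ <;> rcases h₂ with ⟨h₂, h₂'⟩ | ⟨h₂, h₂'⟩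
  · rw [h₁'.2.2.2, h₂'.2.2.2]
  · exact absurd h₁ h₂
  · exact absurd h₂ h₁
  · rw [h₁', h₂']

theorem IsEWindow.unique {D : Grid n} {r s c b b' : Fin n} (h : IsEWindow D r s c b)
    (h' : IsEWindow D r s c b') : b = b' := by
  rcases lt_trichotomy b b' with hb | hb | hb
  · exact absurd (h.e2_max b' hb h'.e2_lt h'.e2_rt) h'.e2_not
  · exact hb
  · exact absurd (h'.e2_max b hb h.e2_lt h.e2_rt) h.e2_not

theorem IseMove.unique {D D₁ D₂ : Grid n} {r : Fin n} (h₁ : IseMove D r D₁)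
    (h₂ : IseMove D r D₂) : D₁ = D₂ := by
  obtain ⟨s, c, c', q, h1, h2, h3⟩ := h₁
  obtain ⟨s₂, c₂, c₂', q₂, h1', h2', h3'⟩ := h₂
  obtain rfl := next_row_unique h1.next_row h1'.next_row
  have hc : c = c₂ := by
    have e1 := h1.e1_leftmost c₂
    have e2 := h1'.e1_leftmost c
    have e3 := h1.e1_heavy
    have e4 := h1'.e1_heavy
    rcases lt_trichotomy c c₂ with h | h | h <;> grind
  subst hc
  obtain rfl := h1.toIsEWindow.unique h1'.toIsEWindow
  have hq : q = q₂ := by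
    rcases h2 with ⟨a1, a2, a3, a4⟩ | ⟨a1, a2⟩ <;> rcases h2' with ⟨b1, b2, b3, b4⟩ | ⟨b1, b2⟩
    · have := a4 q₂
      have := b4 q
      rcases lt_trichotomy q q₂ with h | h | h <;> grind
    · exact absurd a1 b1
    · exact absurd b1 a1
    · rw [a2, b2]
  subst hq
  exact h3.unique h3'

theorem IseStarMove.unique {D D₁ D₂ : Grid n} {r : Fin n} (h₁ : IseStarMove D r D₁)
    (h₂ : IseStarMove D r D₂) : D₁ = D₂ := by
  obtain ⟨s, c, c', h1, h3⟩ := h₁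
  obtain ⟨s₂, c₂, c₂', h1', h3'⟩ := h₂
  obtain rfl := next_row_unique h1.next_row h1'.next_row
  have hc : c = c₂ := by
    have e1 := h1.es1_max c₂
    have e2 := h1'.es1_max c
    have e3 := h1.es1_rt
    have e4 := h1'.es1_rt
    rcases lt_trichotomy c c₂ with h | h | h <;> grind
  subst hc
  obtain rfl := h1.toIsEWindow.unique h1'.toIsEWindow
  exact h3.unique h3'

/-- The target carries some explicit move, an explicit move is an f-move, and f-moves are
deterministic; so any f-move is the explicit one. The next three equivalences follow the same
pattern. -/
theorem isfMove_iff {D D' : Grid n} (hD : IsMBPD D) (hD' : IsMBPD D') {r c : Fin n} :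
    IsfMove D r c D' ↔ ∃ s c', GridMove D D' r s c c' False := by
  constructor
  · intro h
    obtain ⟨s, c', q, ht, -⟩ := id h
    obtain ⟨D'', h1, h2⟩ := (ht.window hD).exists_gridMove ht.next_row hD
    obtain rfl := h.unique (h2.isfMove hD h1)
    exact ⟨s, c', h2⟩
  · rintro ⟨s, c', h⟩
    exact h.isfMove hD hD'

theorem isfStarMove_iff {D D' : Grid n} (hD : IsMBPD D) (hD' : IsMBPD D') {r c : Fin n} :
    IsfStarMove D r c D' ↔ ∃ s c', GridMove D D' r s c c' True := by
  constructor
  · intro h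
    obtain ⟨s, c', ht, -⟩ := id h
    obtain ⟨D'', h1, h2⟩ := (ht.window hD).exists_gridMove ht.next_row hD
    obtain rfl := h.unique (h2.isfStarMove hD h1)
    exact ⟨s, c', h2⟩
  · rintro ⟨s, c', h⟩
    exact h.isfStarMove hD hD'

theorem iseMove_iff {D D' : Grid n} (hD : IsMBPD D) (hD' : IsMBPD D') {r : Fin n} :
    IseMove D' r D ↔ ∃ s c c', GridMove D D' r s c c' False := by
  constructor
  · intro h
    obtain ⟨s, c', b, q, ht, -⟩ := id h
    obtain ⟨D'', c, h1, h2⟩ := ETarget.exists_gridMove (star := False)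
      ⟨ht.toIsEWindow, ht.e1_leftmost, .inl ⟨id, ht.e1_heavy⟩⟩ hD'
    obtain rfl := h.unique (h2.iseMove h1 hD')
    exact ⟨s, c, c', h2⟩
  · rintro ⟨s, c, c', h⟩
    exact h.iseMove hD hD'

theorem iseStarMove_iff {D D' : Grid n} (hD : IsMBPD D) (hD' : IsMBPD D') {r : Fin n} :
    IseStarMove D' r D ↔ ∃ s c c', GridMove D D' r s c c' True := by
  constructor
  · intro h
    obtain ⟨s, c', b, ht, -⟩ := id h
    obtain ⟨D'', c, h1, h2⟩ := ETarget.exists_gridMove (star := True)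
      ⟨ht.toIsEWindow, fun j _ => ht.es1_light j, .inr ⟨trivial, ht.es1_light _, ht.es1_rt,
        ht.es1_max⟩⟩ hD'
    obtain rfl := h.unique (h2.iseStarMove h1 hD')
    exact ⟨s, c, c', h2⟩
  · rintro ⟨s, c, c', h⟩
    exact h.iseStarMove hD hD'

/-- The target of a move is determined by the two rows before the move. -/
theorem GridMove.unique {D D₁ D₂ : Grid n} {r s s₂ c c' c₂ c₂' : Fin n} {star : Prop}
    (hD : IsMBPD D) (h₁ : GridMove D D₁ r s c c' star) (h₂ : GridMove D D₂ r s₂ c₂ c₂' star) :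
    D₁ = D₂ := by
  have hc : c = c₂ := by
    have a := h₁.rows.window
    have b := h₂.rows.window
    have := a.rightmost c₂
    have := b.rightmost c
    have := a.heavy
    have := b.heavy
    rcases lt_trichotomy c c₂ with h | h | h <;> grind
  subst hc
  by_cases hs : star
  · have e : star = True := eq_true hs
    subst e
    exact (h₁.isfStarMove hD (h₁.isMBPD_iff.1 hD)).unique (h₂.isfStarMove hD (h₂.isMBPD_iff.1 hD))
  · have e : star = False := eq_false hs
    subst e
    exact (h₁.isfMove hD (h₁.isMBPD_iff.1 hD)).unique (h₂.isfMove hD (h₂.isMBPD_iff.1 hD))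

theorem GridMove.source_unique {D₁ D₂ D : Grid n} {r s s₂ c c' c₂ c₂' : Fin n} {star : Prop}
    (hD : IsMBPD D) (h₁ : GridMove D₁ D r s c c' star) (h₂ : GridMove D₂ D r s₂ c₂ c₂' star) :
    D₁ = D₂ := by
  by_cases hs : star
  · have e : star = True := eq_true hs
    subst e
    exact (h₁.iseStarMove (h₁.isMBPD_iff.2 hD) hD).unique (h₂.iseStarMove (h₂.isMBPD_iff.2 hD) hD)
  · have e : star = False := eq_false hs
    subst e
    exact (h₁.iseMove (h₁.isMBPD_iff.2 hD) hD).unique (h₂.iseMove (h₂.isMBPD_iff.2 hD) hD)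


/-! ### Commuting moves -/

/-- An unstarred move neither reads nor changes the lower row beyond c'. -/
theorem RowMove.congr_bot {x y x' y' y₂ y₂' : Fin n → Tile} {c c' : Fin n}
    (h : RowMove x y x' y' c c' False) (hy : ∀ j ≤ c', y₂ j = y j) (hy' : ∀ j ≤ c', y₂' j = y' j)
    (ho : ∀ j, c' < j → y₂' j = y₂ j) : RowMove x y₂ x' y₂' c c' False := by
  have hlt := h.window.lt
  have hw : Window x y₂ c c' False := by
    obtain ⟨h1, h2, h3, h4, h5, h6, h7⟩ := h.window
    refine ⟨h1, h2, h3, fun j hj => ?_, ?_, fun j a b => ?_, ?_⟩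
    · rw [hy j hj.le]; exact h4 j hj
    · rw [hy c h1.le]; exact h5
    · rw [hy j b.le]; exact h6 j a b
    · rw [hy c' le_rfl]
      simpa using h7
  rcases h with ⟨p, h⟩ | h
  · have hle := h.le
    refine .inl ⟨p, hw, h.lt, h.le, fun j hj => ?_, fun j a b => ?_, ?_, ?_⟩
    · have := h.out j hj
      have := hy j
      have := hy' j
      have := ho j
      grind
    · have := h.inner j a b
      rwa [hy j (by grind), hy' j (by grind)]
    · have := h.leftEnd
      unfold LeftEnd at *
      rw [hy c hlt.le, hy' c hlt.le]
      refine this.imp_right fun ⟨e1, e2, e3, e4, b, e5, e6, e7, e8⟩ =>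
        ⟨e1, e2, e3, e4, b, e5, e6, ?_, fun j a b => ?_⟩
      · rw [hy b (by grind), e7]
      · rw [hy j (by grind)]
        exact e8 j a b
    · have := h.rightEnd
      unfold RightEnd at *
      rw [hy p hle, hy' p hle, hy' c' le_rfl]
      refine this.imp_right (Or.imp_left fun ⟨e1, e2, e3, e4, e5, e6, e7, e8⟩ =>
        ⟨e1, e2, e3, e4, e5, e6, fun j a b => ?_, e8⟩)
      rw [hy j b.le, hy' j b.le]
      exact e7 j a b
  · obtain ⟨b, z, e1, e2, e3, e4, e5, e6⟩ := h.left
    have hm := h.mark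
    refine .inr ⟨hw, h.eq_mjt, h.eq_jt, ⟨b, z, e1, e2, e3, ?_, e5, fun j a d => ?_⟩, h.same_top,
      fun j hj => ?_, ?_⟩
    · rw [hy z (by grind), e4]
    · rw [hy j (by grind)]
      exact e6 j a d
    · have := h.same_bot j hj
      have := hy j
      have := hy' j
      have := ho j
      grind
    · rw [hy' c' le_rfl]
      simpa using hm

/-- To the left of its target, a move reads the upper row at most back to the R where the pipe
through column c begins. A column q < c without an edge to the right lies left of that R. -/
theorem RowMove.congr_top {x y x' y' x₂ x₂' : Fin n → Tile} {c c' q : Fin n} {star : Prop}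
    (h : RowMove x y x' y' c c' star) (hq : q < c) (hr : (x q).right = false)
    (hx : ∀ j, q < j → x₂ j = x j) (hx' : ∀ j, q < j → x₂' j = x' j)
    (ho : ∀ j ≤ q, x₂' j = x₂ j) : RowMove x₂ y x₂' y' c c' star := by
  have hlt := h.window.lt
  have hw : Window x₂ y c c' star := by
    obtain ⟨h1, h2, h3, h4, h5, h6, h7⟩ := h.window
    refine ⟨h1, ?_, fun j hj => ?_, h4, h5, h6, ?_⟩
    · rw [hx c hq]; exact h2
    · rw [hx j (hq.trans hj)]; exact h3 j hj
    · refine h7.imp_right fun ⟨e1, e2, e3, e4⟩ => ⟨e1, ?_, e3, fun j hj => ?_⟩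
      · rw [hx c' (hq.trans h1), e2]
      · rw [hx j (hq.trans (h1.trans hj))]; exact e4 j hj
  have hqb : ∀ b, b < c → x b = rt → (∀ j, b < j → j < c → x j = hor ∨ x j = plus) → q < b := by
    intro b e1 e2 e3
    rcases lt_trichotomy q b with h | rfl | h
    · exact h
    · simp [e2, Tile.right] at hr
    · have := e3 q h hq
      grind
  rcases h with ⟨p, h⟩ | h
  · have hp := h.lt
    have hle := h.le
    refine .inl ⟨p, hw, h.lt, h.le, fun j hj => ?_, fun j a b => ?_, ?_, ?_⟩
    · have := h.out j hj
      have := hx j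
      have := hx' j
      have := ho j
      grind
    · have := h.inner j a b
      rwa [hx j (by grind), hx' j (by grind)]
    · have := h.leftEnd
      unfold LeftEnd at *
      rw [hx c hq, hx' c hq]
      refine this.imp_right fun ⟨e1, e2, e3, e4, b, e5, e6, e7, e8⟩ =>
        ⟨e1, e2, e3, e4, b, e5, ?_, e7, fun j a b => ?_⟩
      · rw [hx b (hqb b e5 e6 fun j a d => (e8 j a d).1), e6]
      · rw [hx j ((hqb _ e5 e6 fun j a d => (e8 j a d).1).trans a)]
        exact e8 j a b
    · have := h.rightEnd
      unfold RightEnd at *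
      rw [hx p (by grind), hx' p (by grind), hx' c' (by grind), hx c' (by grind)]
      refine this.imp_right (Or.imp_left fun ⟨e1, e2, e3, e4, e5, e6, e7, e8⟩ =>
        ⟨e1, e2, e3, e4, e5, e6, fun j a b => ?_, e8⟩)
      rw [hx j (by grind), hx' j (by grind)]
      exact e7 j a b
  · obtain ⟨b, z, e1, e2, e3, e4, e5, e6⟩ := h.left
    have hb := hqb b (e1.trans_le e2) e3 e5
    refine .inr ⟨hw, ?_, ?_, ⟨b, z, e1, e2, ?_, e4, fun j a d => ?_, e6⟩, fun j hj => ?_,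
      h.same_bot, h.mark⟩
    · rw [hx c hq, h.eq_mjt]
    · rw [hx' c hq, h.eq_jt]
    · rw [hx b hb, e3]
    · rw [hx j (hb.trans a)]
      exact e5 j a d
    · have := h.same_top j hj
      have := hx j
      have := hx' j
      have := ho j
      grind

/-- Both moves involve row s, but on different sides of c': the first up to the J in column c', the
second beyond it, because that J has no edge to the right. -/
theorem GridMove.square {D E D' : Grid n} {r s t c c' d d' : Fin n} {star : Prop}
    (h : GridMove D E r s c c' False) (h' : GridMove D D' s t d d' star) (hcd : c' < d) :
    ∃ E', GridMove D' E' r s c c' False ∧ GridMove E E' s t d d' star := by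
  have e1 := h.next_row
  have e2 := h'.next_row
  have hrs : r ≠ s := by rintro rfl; omega
  have hrt : r ≠ t := by rintro rfl; omega
  have hst : s ≠ t := by rintro rfl; omega
  have hjt : D s c' = jt := by simpa using h.rows.window.last
  set E' : Grid n := fun i j => if i = r then E r j else
    if i = s then (if j ≤ c' then E s j else D' s j) else if i = t then D' t j else D i j with hE'
  have er : E' r = E r := by simp [hE']
  have es : ∀ j, E' s j = if j ≤ c' then E s j else D' s j := by simp [hE', hrs.symm]
  have et : E' t = D' t := by simp [hE', hrt.symm, hst.symm]
  have eo : ∀ i, i ≠ r → i ≠ s → i ≠ t → E' i = D i := fun i a b c => by simp [hE', a, b, c]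
  refine ⟨E', ⟨e1, fun i a b => ?_, ?_⟩, ⟨e2, fun i a b => ?_, ?_⟩⟩
  · by_cases hi : i = t
    · rw [hi, et]
    · rw [eo i a b hi, h'.out i b hi]
  · rw [er, h'.out r hrs hrt]
    refine h.rows.congr_bot (fun j hj => ?_) (fun j hj => ?_) (fun j hj => ?_)
    · exact (h'.rows.out (.inl (hj.trans_lt hcd))).1
    · rw [es, if_pos hj]
    · rw [es, if_neg (not_le.2 hj)]
  · by_cases hi : i = r
    · rw [hi, er]
    · rw [eo i hi a b, h.out i hi a]
  · rw [et, h.out t hrt.symm hst.symm]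
    refine h'.rows.congr_top hcd (by simp [hjt, Tile.right]) (fun j hj => ?_) (fun j hj => ?_)
      (fun j hj => ?_)
    · exact (h.rows.out (.inr hj)).2
    · rw [es, if_neg (not_le.2 hj)]
    · rw [es, if_pos hj]

/-- The separation comes for free: the heavy tile at (s, c') is still there after the move in rows s
and t, so it was heavy before and was not the target; as the target is the rightmost heavy tile, c'
< d. -/
theorem GridMove.square_reverse {E D' E' : Grid n} {r s t c c' d d' : Fin n} {star : Prop}
    (h : GridMove D' E' r s c c' False) (h' : GridMove E E' s t d d' star) :
    ∃ D, GridMove D E r s c c' False ∧ GridMove D D' s t d d' star := by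
  have e1 := h.next_row
  have e2 := h'.next_row
  have hrs : r ≠ s := by rintro rfl; omega
  have hrt : r ≠ t := by rintro rfl; omega
  have hst : s ≠ t := by rintro rfl; omega
  have hh : (E' s c').heavy = true := (h.rows.heavy c').2.2 (.inr ⟨id, rfl⟩)
  have hh' := (h'.rows.heavy c').1.1 hh
  have hcd : c' < d := by
    rcases lt_trichotomy c' d with h | h | h
    · exact h
    · exact absurd h hh'.2
    · have := h'.rows.window.rightmost c' h
      simp [hh'.1] at this
  set D : Grid n := fun i j => if i = r then D' r j else
    if i = s then (if j ≤ c' then D' s j else E s j) else if i = t then E t j else E' i j with hD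
  have er : D r = D' r := by simp [hD]
  have es : ∀ j, D s j = if j ≤ c' then D' s j else E s j := by simp [hD, hrs.symm]
  have et : D t = E t := by simp [hD, hrt.symm, hst.symm]
  have eo : ∀ i, i ≠ r → i ≠ s → i ≠ t → D i = E' i := fun i a b c => by simp [hD, a, b, c]
  refine ⟨D, ⟨e1, fun i a b => ?_, ?_⟩, ⟨e2, fun i a b => ?_, ?_⟩⟩
  · by_cases hi : i = t
    · rw [hi, et]
    · rw [eo i a b hi, h'.out i b hi]
  · rw [er, ← h'.out r hrs hrt]
    refine h.rows.congr_bot (fun j hj => ?_) (fun j hj => ?_) (fun j hj => ?_)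
    · rw [es, if_pos hj]
    · exact (h'.rows.out (.inl (hj.trans_lt hcd))).1.symm
    · rw [es, if_neg (not_le.2 hj)]
  · by_cases hi : i = r
    · rw [hi, er]
    · rw [eo i hi a b, h.out i hi a]
  · rw [et, ← h.out t hrt.symm hst.symm]
    refine h'.rows.congr_top hcd (Tile.right_of_heavy hh'.1) (fun j hj => ?_) (fun j hj => ?_)
      (fun j hj => ?_)
    · rw [es, if_neg (not_le.2 hj)]
    · exact (h.rows.out (.inr hj)).2.symm
    · rw [es, if_pos hj]

theorem GridMove.square_disjoint {D E D' : Grid n} {r s u t c c' d d' : Fin n} {star star' : Prop}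
    (h : GridMove D E r s c c' star) (h' : GridMove D D' u t d d' star') (hsu : s < u) :
    ∃ E', GridMove D' E' r s c c' star ∧ GridMove E E' u t d d' star' := by
  have e1 := h.next_row
  have e2 := h'.next_row
  have e3 := Fin.lt_def.1 hsu
  have hru : r ≠ u := by rintro rfl; omega
  have hrt : r ≠ t := by rintro rfl; omega
  have hsu : s ≠ u := by rintro rfl; omega
  have hst : s ≠ t := by rintro rfl; omega
  refine ⟨fun i => if i = r ∨ i = s then E i else D' i, ⟨e1, fun i a b => by simp [a, b], ?_⟩,
    ⟨e2, fun i a b => ?_, ?_⟩⟩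
  · simpa [h'.out r hru hrt, h'.out s hsu hst] using h.rows
  · by_cases hi : i = r ∨ i = s
    · simp [hi]
    · rw [not_or] at hi
      simp [hi, h'.out i a b, h.out i hi.1 hi.2]
  · simpa [h.out u hru.symm hsu.symm, h.out t hrt.symm hst.symm, hru.symm, hsu.symm, hrt.symm,
      hst.symm] using h'.rows

theorem GridMove.square_disjoint_reverse {E D' E' : Grid n} {r s u t c c' d d' : Fin n}
    {star star' : Prop} (h : GridMove D' E' r s c c' star) (h' : GridMove E E' u t d d' star')
    (hsu : s < u) : ∃ D, GridMove D E r s c c' star ∧ GridMove D D' u t d d' star' := by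
  have e1 := h.next_row
  have e2 := h'.next_row
  have e3 := Fin.lt_def.1 hsu
  have hru : r ≠ u := by rintro rfl; omega
  have hrt : r ≠ t := by rintro rfl; omega
  have hsu : s ≠ u := by rintro rfl; omega
  have hst : s ≠ t := by rintro rfl; omega
  refine ⟨fun i => if i = r ∨ i = s then D' i else E i, ⟨e1, fun i a b => by simp [a, b], ?_⟩,
    ⟨e2, fun i a b => ?_, ?_⟩⟩
  · simpa [← h'.out r hru hrt, ← h'.out s hsu hst] using h.rows
  · by_cases hi : i = r ∨ i = s
    · simp [hi]
    · rw [not_or] at hi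
      simp [hi, ← h'.out i a b, h.out i hi.1 hi.2]
  · simpa [← h.out u hru.symm hsu.symm, ← h.out t hrt.symm hst.symm, hru.symm, hsu.symm, hrt.symm,
      hst.symm] using h'.rows

/-! ### Removing a heavy tile by a chain of moves -/

/-- `Peel D i a D'`: the grid `D'` arises from `D` by `f`-moves in rows `i, …, a - 1`, followed by an
`f*`-move in row `a`. -/
inductive Peel : Grid n → Fin n → Fin n → Grid n → Prop
  | star {D D' : Grid n} {i s c c' : Fin n} : GridMove D D' i s c c' True → Peel D i i D'
  | step {D D₁ D' : Grid n} {i s a c c' : Fin n} :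
      GridMove D D₁ i s c c' False → Peel D₁ s a D' → Peel D i a D'

theorem Peel.le {D D' : Grid n} {i a : Fin n} (h : Peel D i a D') : i ≤ a := by
  induction h with
  | star => exact le_rfl
  | step h _ ih =>
    have := h.next_row
    simp only [Fin.le_def] at *
    omega

theorem Peel.succ_lt {D D' : Grid n} {i a : Fin n} (h : Peel D i a D') : (a : ℕ) + 1 < n := by
  induction h with
  | star h => rw [← h.next_row]; exact Fin.is_lt _
  | step _ _ ih => exact ih

theorem Peel.isMBPD_iff {D D' : Grid n} {i a : Fin n} (h : Peel D i a D') :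
    IsMBPD D ↔ IsMBPD D' := by
  induction h with
  | star h => exact h.isMBPD_iff
  | step h _ ih => exact h.isMBPD_iff.trans ih

theorem Peel.row_eq {D D' : Grid n} {i a : Fin n} (h : Peel D i a D') {j : Fin n} (hj : j < i) :
    D' j = D j := by
  induction h with
  | star h =>
    have := h.next_row
    simp only [Fin.lt_def] at hj
    exact h.out j (by rintro rfl; omega) (by rintro rfl; omega)
  | step h _ ih =>
    have := h.next_row
    simp only [Fin.lt_def] at hj ih
    rw [ih (by omega)]
    exact h.out j (by rintro rfl; omega) (by rintro rfl; omega)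

theorem Peel.square_disjoint {D E D' : Grid n} {r s u a c c' : Fin n} (h' : Peel D u a D')
    (h : GridMove D E r s c c' False) (hsu : s < u) :
    ∃ E', GridMove D' E' r s c c' False ∧ Peel E u a E' := by
  induction h' generalizing E with
  | star h' =>
    obtain ⟨E', h1, h2⟩ := h.square_disjoint h' hsu
    exact ⟨E', h1, .star h2⟩
  | step h' _ ih =>
    obtain ⟨E₁, h1, h2⟩ := h.square_disjoint h' hsu
    have := h'.next_row
    obtain ⟨E', h3, h4⟩ := ih h1 (by simp only [Fin.lt_def] at *; omega)
    exact ⟨E', h3, .step h2 h4⟩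

theorem Peel.square_disjoint_reverse {E D' E' : Grid n} {r s u a c c' : Fin n} (h' : Peel E u a E')
    (h : GridMove D' E' r s c c' False) (hsu : s < u) :
    ∃ D, GridMove D E r s c c' False ∧ Peel D u a D' := by
  induction h' with
  | star h' =>
    obtain ⟨D, h1, h2⟩ := h.square_disjoint_reverse h' hsu
    exact ⟨D, h1, .star h2⟩
  | step h' _ ih =>
    have := h'.next_row
    obtain ⟨D₁, h3, h4⟩ := ih h (by simp only [Fin.lt_def] at *; omega)
    obtain ⟨D, h1, h2⟩ := h3.square_disjoint_reverse h' hsu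
    exact ⟨D, h1, .step h2 h4⟩

/-- The heavy tile at k forces the peel to start right of c'; the later moves of the peel only touch
rows below s. -/
theorem Peel.square {D E D' : Grid n} {r s a c c' k : Fin n} (h' : Peel D s a D')
    (h : GridMove D E r s c c' False) (hk : c' < k) (hk' : (D s k).heavy = true) :
    ∃ E', GridMove D' E' r s c c' False ∧ Peel E s a E' := by
  have key : ∀ {D' : Grid n} {t d d' : Fin n} {star : Prop}, GridMove D D' s t d d' star →
      c' < d := by
    intro D' t d d' star h'
    refine hk.trans_le (not_lt.1 fun hd => ?_)
    have := h'.rows.window.rightmost k hd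
    simp [hk'] at this
  cases h' with
  | star h' =>
    obtain ⟨E', h1, h2⟩ := h.square h' (key h')
    exact ⟨E', h1, .star h2⟩
  | step h' h'' =>
    obtain ⟨E₁, h1, h2⟩ := h.square h' (key h')
    have := h'.next_row
    obtain ⟨E', h3, h4⟩ := h''.square_disjoint h1 (by simp only [Fin.lt_def]; omega)
    exact ⟨E', h3, .step h2 h4⟩

theorem Peel.square_reverse {E D' E' : Grid n} {r s a c c' : Fin n} (h' : Peel E s a E')
    (h : GridMove D' E' r s c c' False) :
    ∃ D, GridMove D E r s c c' False ∧ Peel D s a D' := by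
  cases h' with
  | star h' =>
    obtain ⟨D, h1, h2⟩ := h.square_reverse h'
    exact ⟨D, h1, .star h2⟩
  | step h' h'' =>
    have := h'.next_row
    obtain ⟨D₁, h3, h4⟩ := h''.square_disjoint_reverse h (by simp only [Fin.lt_def]; omega)
    obtain ⟨D, h1, h2⟩ := h3.square_reverse h'
    exact ⟨D, h1, .step h2 h4⟩

/-! ### Weights -/

theorem gridWeight_eq_zero {D : Grid n} {i : Fin n} :
    gridWeight D i = 0 ↔ ∀ j, (D i j).heavy = false := by
  simp [gridWeight, Finset.filter_eq_empty_iff]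

theorem card_filter_add_one {α : Type*} [Fintype α] [DecidableEq α] (p q : α → Prop)
    [DecidablePred p] [DecidablePred q] (a : α) (h : ∀ x, q x ↔ p x ∨ x = a) (ha : ¬ p a) :
    (Finset.univ.filter q).card = (Finset.univ.filter p).card + 1 := by
  have : Finset.univ.filter q = insert a (Finset.univ.filter p) := by
    ext x; simp [h x, or_comm]
  rw [this, Finset.card_insert_of_notMem (by simpa using ha)]

theorem GridMove.weight_top {D D' : Grid n} {r s c c' : Fin n} {star : Prop}
    (h : GridMove D D' r s c c' star) : gridWeight D r = gridWeight D' r + 1 := by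
  refine card_filter_add_one _ _ c (fun j => ?_) ?_
  · have := (h.rows.heavy j).1
    have := h.rows.window.heavy
    grind
  · have := (h.rows.heavy c).1
    grind

theorem GridMove.weight_bot {D D' : Grid n} {r s c c' : Fin n}
    (h : GridMove D D' r s c c' False) : gridWeight D' s = gridWeight D s + 1 := by
  refine card_filter_add_one _ _ c' (fun j => ?_) ?_
  · simpa using (h.rows.heavy j).2
  · have : D s c' = jt := by simpa using h.rows.window.last
    grind

theorem GridMove.weight_bot_star {D D' : Grid n} {r s c c' : Fin n}
    (h : GridMove D D' r s c c' True) : gridWeight D' s = gridWeight D s := by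
  unfold gridWeight
  congr 1
  ext j
  simpa using (h.rows.heavy j).2

theorem GridMove.weight_out {D D' : Grid n} {r s c c' : Fin n} {star : Prop}
    (h : GridMove D D' r s c c' star) {i : Fin n} (h1 : i ≠ r) (h2 : i ≠ s) :
    gridWeight D' i = gridWeight D i := by
  unfold gridWeight
  rw [h.out i h1 h2]

theorem Peel.weight {D D' : Grid n} {i a : Fin n} (h : Peel D i a D') (k : Fin n) :
    gridWeight D k = gridWeight D' k + if k = i then 1 else 0 := by
  induction h with
  | @star D D' i s c c' h =>
    have hs := h.next_row
    by_cases h1 : k = i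
    · subst h1; simp [h.weight_top]
    by_cases h2 : k = s
    · subst h2; simp [h.weight_bot_star, h1]
    · simp [h.weight_out h1 h2, h1]
  | @step D D₁ D' i s a c c' h _ ih =>
    have hs := h.next_row
    have hne : i ≠ s := by rintro rfl; omega
    by_cases h1 : k = i
    · subst h1; simp [h.weight_top, ih, hne]
    by_cases h2 : k = s
    · subst h2
      have := h.weight_bot
      simp only [if_true] at ih
      simp [h1]; omega
    · rw [← h.weight_out h1 h2, ih]; simp [h1, h2]


/-! ### Consecutive removals -/

/-- After a move, the lower row has a J between any remaining heavy tile of the upper row and the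
window column. -/
theorem GridMove.exists_jt {D D' : Grid n} {r s c c' k : Fin n} {star : Prop}
    (h : GridMove D D' r s c c' star) (hD' : IsMBPD D') (hk : (D' r k).heavy = true) :
    ∃ j, k < j ∧ j < c' ∧ D' s j = jt := by
  have hw := h.rows.window
  have hcc := hw.lt
  have hkh := (h.rows.heavy k).1.1 hk
  have hkc : k < c := by
    have := hw.rightmost k
    rcases lt_trichotomy k c with h | h | h <;> grind
  have hli : ∀ j, j < c' → (D' s j).heavy = false := fun j hj => by
    have := (h.rows.heavy j).2
    have := hw.light j hj
    grind
  have hv := hD'.vertical r s k h.next_row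
  have hkr : (D' s k).right = true := by
    rw [Tile.down_of_heavy hk] at hv
    have := Tile.hor_or_rt (hli k (hkc.trans hcc)) hv.symm
    grind
  have hbetween : ∀ z, k < z → z ≤ c → (D' s z).left = false → ∃ j, k < j ∧ j < c' ∧ D' s j = jt := by
    intro z h1 h2 h3
    obtain ⟨j, h4, h5, h6⟩ := (hD'.rowValid s).exists_jt_between h1 hkr h3
    have := hli j (h5.trans (h2.trans_lt hcc))
    exact ⟨j, h4, h5.trans (h2.trans_lt hcc), by grind⟩
  rcases h.rows with ⟨p, hu⟩ | hm
  · have hle := hu.leftEnd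
    unfold LeftEnd at hle
    have : D' s c = jt ∨ D' s c = ver := by grind
    rcases this with hj | hj
    · exact ⟨c, hkc, hcc, hj⟩
    · exact hbetween c hkc le_rfl (by simp [hj, Tile.left])
  · obtain ⟨b, z, e1, e2, e3, e4, e5, e6⟩ := hm.left
    have hkb : k < b := by
      have := e5 k
      rcases lt_trichotomy k b with h | h | h <;> grind
    refine hbetween z (hkb.trans e1) e2 ?_
    rw [hm.same_bot z (e2.trans_lt hcc).ne, e4]
    rfl

theorem exists_max_heavy {x : Fin n → Tile} {k : Fin n} (hk : (x k).heavy = true) :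
    ∃ c, k ≤ c ∧ (x c).heavy = true ∧ ∀ j, c < j → (x j).heavy = false := by
  obtain ⟨c, hc, hm⟩ := (Finset.univ.filter fun j => (x j).heavy = true).exists_max_image id
    ⟨k, by simpa using hk⟩
  refine ⟨c, hm k (by simpa using hk), by simpa using hc, fun j hj => ?_⟩
  by_contra h
  exact absurd (hm j (by simpa using h)) (not_le.2 hj)

theorem exists_fMove {D : Grid n} {r s c k : Fin n} (hD : IsMBPD D) (hs : (s : ℕ) = r + 1)
    (hc : (D r c).heavy = true) (hmax : ∀ j, c < j → (D r j).heavy = false) (hck : c < k)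
    (hk : D s k = jt) (hli : ∀ j, j < k → (D s j).heavy = false) :
    ∃ D' c', IsMBPD D' ∧ c' ≤ k ∧ GridMove D D' r s c c' False := by
  classical
  obtain ⟨c', hc', hm⟩ := (Finset.univ.filter fun j => c < j ∧ D s j = jt).exists_min_image id
    ⟨k, by simp [hck, hk]⟩
  simp only [Finset.mem_filter, Finset.mem_univ, true_and, id] at hc' hm
  have hle := hm k ⟨hck, hk⟩
  have ht : IsfTarget D r s c c' := ⟨hs, hc, hmax, hc'.1, hc'.2, fun j h1 h2 h3 =>
    absurd (hm j ⟨h1, h3⟩) (not_le.2 h2), fun j hj => hli j (hj.trans_le hle)⟩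
  obtain ⟨D', h1, h2⟩ := (ht.window hD).exists_gridMove hs hD
  exact ⟨D', c', h1, hle, h2⟩

theorem exists_fStarMove {D : Grid n} {r s c : Fin n} (hD : IsMBPD D) (hs : (s : ℕ) = r + 1)
    (hc : (D r c).heavy = true) (hmax : ∀ j, c < j → (D r j).heavy = false)
    (hj : ∀ k, c < k → D s k ≠ jt) (hli : ∀ j, (D s j).heavy = false) :
    ∃ D' c', IsMBPD D' ∧ GridMove D D' r s c c' True := by
  obtain ⟨c', h1, h2, h3⟩ := (hD.rowValid r).exists_rt_after c (Tile.right_of_heavy hc)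
  have ht : IsfStarTarget D r s c c' := ⟨hs, hc, hmax, fun j h => ⟨hj j h, fun h' => by
    have := hli j; simp [h', Tile.heavy] at this⟩, h2, fun j h h' => by
      have := h3 j h; grind, fun j _ => hli j⟩
  obtain ⟨D', h4, h5⟩ := (ht.window hD).exists_gridMove hs hD
  exact ⟨D', c', h4, h5⟩

/-- All tiles below row `i` are light. -/
def LightBelow (D : Grid n) (i : Fin n) : Prop := ∀ j, i < j → gridWeight D j = 0

theorem LightBelow.mono {D : Grid n} {i j : Fin n} (h : LightBelow D i) (hij : i ≤ j) :
    LightBelow D j := fun k hk => h k (hij.trans_lt hk)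

theorem GridMove.lightBelow_iff {D D' : Grid n} {r s c c' : Fin n} {star : Prop}
    (h : GridMove D D' r s c c' star) : LightBelow D s ↔ LightBelow D' s := by
  have := h.next_row
  refine forall_congr' fun j => imp_congr_right fun hj => ?_
  simp only [Fin.lt_def] at hj
  rw [h.weight_out (by rintro rfl; omega) (by rintro rfl; omega)]

theorem Peel.lightBelow_iff {D D' : Grid n} {i a : Fin n} (h : Peel D i a D') :
    LightBelow D i ↔ LightBelow D' i :=
  forall_congr' fun j => imp_congr_right fun hj => by rw [h.weight j, if_neg hj.ne', add_zero]

/-- Induction on a - i. If the first peel stops at once, `GridMove.exists_jt` provides a J to the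
right of any remaining heavy tile, so the second peel cannot stop at once. Otherwise the first move
of the second peel may be made directly after the first move of the first peel and commutes with the
rest of that peel; both peels then continue from row i + 1 in the same order. -/
theorem Peel.lt_of_peel {D D' D'' : Grid n} {i a a' : Fin n} (h : Peel D i a D') (hD : IsMBPD D)
    (hl : LightBelow D i) (h' : Peel D' i a' D'') : a < a' := by
  have hwt := h'.weight i
  obtain ⟨k, hk⟩ : ∃ k, (D' i k).heavy = true := by
    by_contra hk
    have := gridWeight_eq_zero.2 fun j => by simpa using fun h => hk ⟨j, h⟩
    simp only [if_true] at hwt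
    omega
  clear hwt
  obtain ⟨m, hm⟩ : ∃ m, m = (a : ℕ) - i := ⟨_, rfl⟩
  induction m using Nat.strong_induction_on generalizing D D' D'' i a a' k with | _ m ih
  cases h with
  | @star _ _ _ s c c' h =>
    have hD' := h.isMBPD_iff.1 hD
    have hs := h.next_row
    cases h' with
    | @star _ _ _ _ _ d' h' =>
      exfalso
      have hw := h'.rows.window
      obtain rfl := next_row_unique hs h'.next_row
      obtain ⟨j, h1, -, h2⟩ := h.exists_jt hD' hw.heavy
      obtain ⟨-, e1, e2⟩ := by simpa using hw.last
      have := hw.seg j h1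
      have := e2 j
      rcases lt_trichotomy j d' with h | h | h <;> grind
    | step h' h'' =>
      have := h''.le
      have := h'.next_row
      simp only [Fin.lt_def, Fin.le_def] at *
      omega
  | @step _ D₁ _ _ s _ c c' h h₁ =>
    have hD₁ := h.isMBPD_iff.1 hD
    have hs := h.next_row
    have his : i < s := by simp only [Fin.lt_def]; omega
    have hw := h.rows.window
    rw [h₁.row_eq his] at hk
    obtain ⟨k₂, -, hk₂, hm⟩ := exists_max_heavy hk
    obtain ⟨j, h2, h3, h4⟩ := h.exists_jt hD₁ hk₂
    -- The J at j bounds the landing column: c₂ ≤ j < c'. So the new heavy tile lands to the left of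
    -- the one at (s, c'), which is what commutation needs.
    obtain ⟨E, c₂, hE, hc₂, hmove⟩ := exists_fMove hD₁ hs hk₂ hm h2 h4 fun l hl => by
      have := (h.rows.heavy l).2
      have := hw.light l (hl.trans h3)
      grind
    obtain ⟨E', h5, h6⟩ := h₁.square hmove (hc₂.trans_lt h3)
      ((h.rows.heavy c').2.2 (.inr ⟨id, rfl⟩))
    have hD' := h₁.isMBPD_iff.1 hD₁
    have hmaxD' : ∀ j, k₂ < j → (D' i j).heavy = false := by
      rw [h₁.row_eq his]; exact hm
    cases h' with
    | @star _ _ _ _ e e' h' =>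
      exfalso
      have hw' := h'.rows.window
      obtain rfl := next_row_unique hs h'.next_row
      have hw5 := h5.rows.window
      have hek : e = k₂ := by
        have := hw'.rightmost k₂
        have := hw'.heavy
        have := hmaxD' e
        have := hw5.heavy
        rcases lt_trichotomy e k₂ with h | h | h <;> grind
      subst hek
      obtain ⟨-, e1, e2⟩ := by simpa using hw'.last
      have hjt : D' s c₂ = jt := by simpa using hw5.last
      have := hw'.seg c₂ hw5.lt
      have := e2 c₂
      rcases lt_trichotomy c₂ e' with h | h | h <;> grind
    | step h' h'' =>
      obtain rfl := next_row_unique hs h'.next_row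
      obtain rfl := h'.unique hD' h5
      have := h₁.le
      simp only [Fin.le_def, Fin.lt_def] at this his
      exact ih (a - s) (by omega) h6 hE
        (hmove.lightBelow_iff.1 (h.lightBelow_iff.1 (hl.mono (Fin.le_def.2 his.le)))) h'' c₂
        ((h5.rows.heavy c₂).2.2 (.inr ⟨id, rfl⟩)) rfl


/-! ### Existence of `e`-moves -/

/-- An `e`-move is possible as soon as the part `P` of row `r` to the right of some column is light
and contains a column above an R of row `s` or above a target with nothing coming from the left. -/
theorem exists_eTarget {D : Grid n} {r s c' : Fin n} {star : Prop} (hD : IsMBPD D)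
    (hs : (s : ℕ) = r + 1) (P : Fin n → Prop) (hP : ∀ i j, P i → i < j → P j)
    (hl : ∀ j, P j → (D r j).heavy = false)
    (hrt : ∀ j, P j → (D r j).left = true → ∃ z < j, P z ∧ D r z = rt)
    (hx : ∃ x, P x ∧ (D s x).up = false ∧ ((x < c' ∧ D s x = rt) ∨ (x = c' ∧ (D s x).left = false)))
    (hlight : ∀ j, j < c' → (D s j).heavy = false)
    (hkind : (¬ star ∧ (D s c').heavy = true) ∨ (star ∧ (D s c').heavy = false ∧
      (D r c' = rt ∨ D s c' = rt) ∧ ∀ j, c' < j → D r j ≠ rt ∧ D s j ≠ rt)) :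
    ∃ b, ETarget D r s c' b star := by
  classical
  obtain ⟨x, hPx, hup, hx⟩ := hx
  have hv := hD.vertical r s x hs
  have hxl := Tile.hor_or_jt (hl x hPx) (by rw [hv, hup])
  obtain ⟨b₀, h1, h2, h3⟩ := hrt x hPx (by grind)
  have hxc : x ≤ c' := by grind
  have hn : ¬ IsPipeSegment D s b₀ c' := by
    rintro (⟨h, -⟩ | ⟨-, -, h, h'⟩)
    · exact (h1.trans_le hxc).ne h
    · rcases hx with ⟨e1, e2⟩ | ⟨e1, e2⟩
      · have := h' x h1 e1
        grind
      · subst e1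
        grind
  obtain ⟨b, hb, hm⟩ := (Finset.univ.filter fun b => b < c' ∧ D r b = rt ∧
    ¬ IsPipeSegment D s b c').exists_max_image id ⟨b₀, by simp [h1.trans_le hxc, h3, hn]⟩
  simp only [Finset.mem_filter, Finset.mem_univ, true_and, id] at hb hm
  have hbb := hm b₀ ⟨h1.trans_le hxc, h3, hn⟩
  exact ⟨b, ⟨hs, hb.1, hb.2.1, hb.2.2, fun j e1 e2 e3 => by_contra fun e4 =>
    absurd (hm j ⟨e2, e3, e4⟩) (not_le.2 e1), fun j hj => hl j (hP b₀ j h2 (hbb.trans_lt hj))⟩,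
    hlight, hkind⟩

theorem exists_min_heavy {x : Fin n → Tile} {k : Fin n} (hk : (x k).heavy = true) :
    ∃ c, c ≤ k ∧ (x c).heavy = true ∧ ∀ j, j < c → (x j).heavy = false := by
  obtain ⟨c, hc, hm⟩ := (Finset.univ.filter fun j => (x j).heavy = true).exists_min_image id
    ⟨k, by simpa using hk⟩
  refine ⟨c, hm k (by simpa using hk), by simpa using hc, fun j hj => ?_⟩
  by_contra h
  exact absurd (hm j (by simpa using h)) (not_le.2 hj)

theorem exists_eMove_of_region {D : Grid n} {r s k : Fin n} (hD : IsMBPD D)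
    (hs : (s : ℕ) = r + 1) (P : Fin n → Prop) (hP : ∀ i j, P i → i < j → P j)
    (hl : ∀ j, P j → (D r j).heavy = false)
    (hrt : ∀ j, P j → (D r j).left = true → ∃ z < j, P z ∧ D r z = rt)
    (hrt' : ∀ j, P j → (D s j).heavy = true → (D s j).left = true → ∃ z < j, P z ∧ D s z = rt)
    (hPk : ∀ j, (D s j).heavy = true → P j) (hk : (D s k).heavy = true) :
    ∃ D₀ c c', IsMBPD D₀ ∧ GridMove D₀ D r s c c' False := by
  obtain ⟨c', -, h1, h2⟩ := exists_min_heavy hk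
  have hx : ∃ x, P x ∧ (D s x).up = false ∧
      ((x < c' ∧ D s x = rt) ∨ (x = c' ∧ (D s x).left = false)) := by
    by_cases hleft : (D s c').left = true
    · obtain ⟨z, e1, e2, e3⟩ := hrt' c' (hPk c' h1) h1 hleft
      exact ⟨z, e2, by simp [e3, Tile.up], .inl ⟨e1, e3⟩⟩
    · refine ⟨c', hPk c' h1, ?_, .inr ⟨rfl, by simpa using hleft⟩⟩
      cases h : D s c' <;> simp_all [Tile.heavy, Tile.left, Tile.up]
  obtain ⟨b, hb⟩ := exists_eTarget (star := False) hD hs P hP hl hrt hx h2 (.inl ⟨id, h1⟩)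
  obtain ⟨D₀, c, h3, h4⟩ := hb.exists_gridMove hD
  exact ⟨D₀, c, c', h3, h4⟩

theorem exists_eStarMove_of_region {D : Grid n} {r s k : Fin n} (hD : IsMBPD D)
    (hs : (s : ℕ) = r + 1) (P : Fin n → Prop) (hP : ∀ i j, P i → i < j → P j)
    (hl : ∀ j, P j → (D r j).heavy = false)
    (hrt : ∀ j, P j → (D r j).left = true → ∃ z < j, P z ∧ D r z = rt)
    (hlight : ∀ j, (D s j).heavy = false) (hPk : P k) (hk : D s k = rt) :
    ∃ D₀ c c', IsMBPD D₀ ∧ GridMove D₀ D r s c c' True := by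
  classical
  obtain ⟨c', h1, h2⟩ := (Finset.univ.filter fun j => D r j = rt ∨ D s j = rt).exists_max_image id
    ⟨k, by simp [hk]⟩
  simp only [Finset.mem_filter, Finset.mem_univ, true_and, id] at h1 h2
  have hx : (k < c' ∧ D s k = rt) ∨ (k = c' ∧ (D s k).left = false) := by
    rcases lt_or_eq_of_le (h2 k (.inr hk)) with h | h
    · exact .inl ⟨h, hk⟩
    · exact .inr ⟨h, by simp [hk, Tile.left]⟩
  obtain ⟨b, hb⟩ := exists_eTarget (star := True) (c' := c') hD hs P hP hl hrt
    ⟨k, hPk, by simp [hk, Tile.up], hx⟩ (fun j _ => hlight j)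
    (.inr ⟨trivial, hlight c', h1, fun j hj => ⟨fun h => absurd (h2 j (.inl h)) (not_le.2 hj),
      fun h => absurd (h2 j (.inr h)) (not_le.2 hj)⟩⟩)
  obtain ⟨D₀, c, h3, h4⟩ := hb.exists_gridMove hD
  exact ⟨D₀, c, c', h3, h4⟩

theorem exists_eMove_of_light {D : Grid n} {r s k : Fin n} (hD : IsMBPD D)
    (hs : (s : ℕ) = r + 1) (hl : ∀ j, (D r j).heavy = false) (hk : (D s k).heavy = true) :
    ∃ D₀ c c', IsMBPD D₀ ∧ GridMove D₀ D r s c c' False := by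
  refine exists_eMove_of_region hD hs (fun _ => True) (fun _ _ _ _ => trivial) (fun j _ => hl j)
    (fun j _ h => ?_) (fun j _ _ h => ?_) (fun _ _ => trivial) hk
  · obtain ⟨z, h1, h2, -⟩ := (hD.rowValid r).exists_rt j h
    exact ⟨z, h1, trivial, h2⟩
  · obtain ⟨z, h1, h2, -⟩ := (hD.rowValid s).exists_rt j h
    exact ⟨z, h1, trivial, h2⟩

theorem exists_eStarMove_of_light {D : Grid n} {r s : Fin n} (hD : IsMBPD D)
    (hs : (s : ℕ) = r + 1) (hl : ∀ j, (D r j).heavy = false) (hl' : ∀ j, (D s j).heavy = false) :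
    ∃ D₀ c c', IsMBPD D₀ ∧ GridMove D₀ D r s c c' True := by
  have hrt : ∃ k, D s k = rt := by
    set e : Fin n := ⟨n - 1, by have := s.2; omega⟩ with he
    have her : (D s e).right = true := hD.right_border s e (by have := s.2; simp [he]; omega)
    by_cases hel : (D s e).left = true
    · obtain ⟨z, -, h, -⟩ := (hD.rowValid s).exists_rt e hel
      exact ⟨z, h⟩
    · refine ⟨e, ?_⟩
      cases h : D s e <;> simp_all [Tile.left, Tile.right]
  obtain ⟨k, hk⟩ := hrt
  refine exists_eStarMove_of_region hD hs (fun _ => True) (fun _ _ _ _ => trivial) (fun j _ => hl j)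
    (fun j _ h => ?_) hl' trivial hk
  obtain ⟨z, h1, h2, -⟩ := (hD.rowValid r).exists_rt j h
  exact ⟨z, h1, trivial, h2⟩

/-- An `e`-move can be followed by another one in the same rows if there is another heavy tile. -/
theorem GridMove.exists_eMove {D D' : Grid n} {r s c c' k : Fin n} (h : GridMove D D' r s c c' False)
    (hD : IsMBPD D) (hk : (D s k).heavy = true) :
    ∃ D₀ d d', IsMBPD D₀ ∧ GridMove D₀ D r s d d' False := by
  have hw := h.rows.window
  have hj : D s c' = jt := by simpa using hw.last
  have hcr : (D r c).right = false := Tile.right_of_heavy hw.heavy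
  have hgt : ∀ j, (D s j).heavy = true → c' < j := fun j hj' => by
    have := hw.light j
    rcases lt_trichotomy c' j with h | h | h <;> grind
  refine exists_eMove_of_region hD h.next_row (fun j => c < j) (fun _ _ => lt_trans) hw.rightmost
    (fun j hj h => ?_) (fun j _ hj h => ?_) (fun j hj => hw.lt.trans (hgt j hj)) hk
  · obtain ⟨z, h1, h2, h3, -⟩ := (hD.rowValid r).exists_rt_between hj hcr h
    exact ⟨z, h2, h1, h3⟩
  · obtain ⟨z, h1, h2, h3, -⟩ := (hD.rowValid s).exists_rt_between (hgt j hj)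
      (by simp [*, Tile.right]) h
    exact ⟨z, h2, hw.lt.trans h1, h3⟩

/-- The region is the part to the right of the target c of the known f-move: the heavy tile there
lets no pipe of row r in from the left, and row s has an R beyond its J at c'. -/
theorem GridMove.exists_eStarMove {D D' : Grid n} {r s c c' : Fin n}
    (h : GridMove D D' r s c c' False) (hD : IsMBPD D) (hl : ∀ j, (D s j).heavy = false) :
    ∃ D₀ d d', IsMBPD D₀ ∧ GridMove D₀ D r s d d' True := by
  have hw := h.rows.window
  have hj : D s c' = jt := by simpa using hw.last
  have hcr : (D r c).right = false := Tile.right_of_heavy hw.heavy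
  obtain ⟨k, h1, h2, -⟩ := (hD.rowValid s).exists_rt_after c' (by simp [hj, Tile.right])
  refine exists_eStarMove_of_region hD h.next_row (fun j => c < j) (fun _ _ => lt_trans)
    hw.rightmost (fun j hj h => ?_) hl (hw.lt.trans h1) h2
  obtain ⟨z, h1, h2, h3, -⟩ := (hD.rowValid r).exists_rt_between hj hcr h
  exact ⟨z, h2, h1, h3⟩

theorem exists_heavy_of_weight {D : Grid n} {i : Fin n} (h : gridWeight D i ≠ 0) :
    ∃ j, (D i j).heavy = true := by
  by_contra hk
  exact h (gridWeight_eq_zero.2 fun j => by simpa using fun h => hk ⟨j, h⟩)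

/-- Converse of `Peel.lt_of_peel`, by the same induction run backwards: first build the peel from
row i + 1, then pull its heavy tile up to row i by an e-move. -/
theorem exists_peel {D' : Grid n} {i a : Fin n} (hD' : IsMBPD D') (hia : i ≤ a)
    (ha : (a : ℕ) + 1 < n) (hl : LightBelow D' i)
    (h : gridWeight D' i = 0 ∨ ∃ a' D'', Peel D' i a' D'' ∧ a < a') :
    ∃ D, IsMBPD D ∧ Peel D i a D' := by
  obtain ⟨m, hm⟩ : ∃ m, m = (a : ℕ) - i := ⟨_, rfl⟩
  have hia' := Fin.le_def.1 hia
  induction m using Nat.strong_induction_on generalizing D' i with | _ m ih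
  set s : Fin n := ⟨i + 1, by omega⟩ with hs
  have hs : (s : ℕ) = i + 1 := rfl
  have his : i < s := by simp only [Fin.lt_def]; omega
  have hls := gridWeight_eq_zero.1 (hl s his)
  rcases eq_or_lt_of_le hia with rfl | hlt
  · rcases h with h | ⟨a', D'', h, h'⟩
    · obtain ⟨D, c, c', h1, h2⟩ := exists_eStarMove_of_light hD' hs (gridWeight_eq_zero.1 h) hls
      exact ⟨D, h1, .star h2⟩
    · cases h with
      | star => exact absurd h' (lt_irrefl _)
      | step h _ =>
        obtain rfl := next_row_unique hs h.next_row
        obtain ⟨D, c, c', h1, h2⟩ := h.exists_eStarMove hD' hls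
        exact ⟨D, h1, .star h2⟩
  · have hsa : s ≤ a := by simp only [Fin.le_def, Fin.lt_def] at *; omega
    have hsa' := Fin.le_def.1 hsa
    rcases h with h | ⟨a', D'', h, h'⟩
    · obtain ⟨Y, hY, hp⟩ := ih (a - s) (by omega) hD' hsa (hl.mono his.le) (.inl (hl s his)) rfl hsa'
      have hw := hp.weight s
      obtain ⟨k, hk⟩ := exists_heavy_of_weight (D := Y) (i := s) (by simp only [if_true] at hw; omega)
      obtain ⟨D, c, c', h1, h2⟩ := exists_eMove_of_light hY hs (by
        rw [← hp.row_eq his]; exact gridWeight_eq_zero.1 h) hk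
      exact ⟨D, h1, .step h2 hp⟩
    · cases h with
      | star => exact absurd (h'.trans hlt) (lt_irrefl _)
      | @step _ X _ _ s' _ c c' h hX =>
        obtain rfl := next_row_unique hs h.next_row
        obtain ⟨Y, hY, hp⟩ := ih (a - s) (by omega) (h.isMBPD_iff.1 hD') hsa
          (h.lightBelow_iff.1 (hl.mono his.le)) (.inr ⟨a', D'', hX, h'⟩) rfl hsa'
        -- The old first move is placed in front of the new peel from row s. Then Z has a heavy tile
        -- in row s and already admits a move in rows i and s, so a further e-move in these rows
        -- exists.
        obtain ⟨Z, h1, h2⟩ := hp.square_reverse h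
        have hw := h2.weight s
        obtain ⟨k, hk⟩ := exists_heavy_of_weight (D := Z) (i := s)
          (by simp only [if_true] at hw; omega)
        obtain ⟨D, d, d', h3, h4⟩ := h1.exists_eMove (h1.isMBPD_iff.2 hY) hk
        exact ⟨D, h3, .step h4 h2⟩


/-! ### The 0-Hecke action on sequences -/

/-- Sort the entries at positions `a` and `a + 1` decreasingly. -/
def sortAt (a : ℕ) : Function.End (ℕ → ℕ) := fun v p =>
  if p = a then max (v a) (v (a + 1)) else if p = a + 1 then min (v a) (v (a + 1)) else v p

theorem sortAt_mul_self (a : ℕ) : sortAt a * sortAt a = sortAt a := by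
  funext v p
  simp only [Function.End.mul_def, Function.comp, sortAt]
  grind

theorem sortAt_comm {a b : ℕ} (h : a + 1 < b) : Commute (sortAt a) (sortAt b) := by
  funext v p
  simp only [Function.End.mul_def, Function.comp, sortAt]
  grind

/-- Both sides sort the three entries at a, a + 1, a + 2 decreasingly. This completes the 0-Hecke
relations. -/
theorem sortAt_braid (a : ℕ) :
    sortAt a * sortAt (a + 1) * sortAt a = sortAt (a + 1) * sortAt a * sortAt (a + 1) := by
  funext v p
  change sortAt a (sortAt (a + 1) (sortAt a v)) p =
    sortAt (a + 1) (sortAt a (sortAt (a + 1) v)) p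
  simp only [sortAt]
  grind

/-- The product of the `sortAt k` for `a ≤ k < b`, in ascending order. -/
def asc (a b : ℕ) : Function.End (ℕ → ℕ) := ((List.Ico a b).map sortAt).prod

theorem asc_self (a : ℕ) : asc a a = 1 := by simp [asc]

theorem asc_mul_asc {a b c : ℕ} (h1 : a ≤ b) (h2 : b ≤ c) : asc a b * asc b c = asc a c := by
  rw [asc, asc, asc, ← List.prod_append, ← List.map_append, List.Ico.append_consecutive h1 h2]

theorem asc_succ (a : ℕ) : asc a (a + 1) = sortAt a := by simp [asc]

theorem asc_succ_right {a b : ℕ} (h : a ≤ b) : asc a (b + 1) = asc a b * sortAt b := by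
  rw [← asc_succ b, asc_mul_asc h (Nat.le_succ b)]

theorem asc_succ_left {a b : ℕ} (h : a < b) : asc a b = sortAt a * asc (a + 1) b := by
  rw [← asc_succ a, asc_mul_asc (Nat.le_succ a) h]

/-- `x` is a product of generators `sortAt k` with `a ≤ k < b`. -/
def Supported (a b : ℕ) (x : Function.End (ℕ → ℕ)) : Prop :=
  x ∈ Submonoid.closure (sortAt '' Set.Ico a b)

theorem Supported.one {a b : ℕ} : Supported a b 1 := one_mem _

theorem Supported.mul {a b : ℕ} {x y : Function.End (ℕ → ℕ)} (hx : Supported a b x)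
    (hy : Supported a b y) : Supported a b (x * y) := mul_mem hx hy

theorem Supported.sortAt {a b k : ℕ} (h1 : a ≤ k) (h2 : k < b) : Supported a b (sortAt k) :=
  Submonoid.subset_closure ⟨k, ⟨h1, h2⟩, rfl⟩

theorem Supported.mono {a b a' b' : ℕ} {x : Function.End (ℕ → ℕ)} (h : Supported a b x)
    (ha : a' ≤ a) (hb : b ≤ b') : Supported a' b' x :=
  Submonoid.closure_mono (Set.image_mono (Set.Ico_subset_Ico ha hb)) h

theorem Supported.prod {a b : ℕ} {l : List (Function.End (ℕ → ℕ))} (h : ∀ x ∈ l, Supported a b x) :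
    Supported a b l.prod := Submonoid.list_prod_mem _ h

theorem Supported.asc (a b : ℕ) : Supported a b (asc a b) := by
  refine .prod fun x hx => ?_
  obtain ⟨k, hk, rfl⟩ := List.mem_map.1 hx
  rw [List.Ico.mem] at hk
  exact .sortAt hk.1 hk.2

/-- The alternatives b = 0 and d = 0 mean empty support; they cover truncated bounds such as `β - 1`
for β = 0. -/
theorem Supported.commute {a b c d : ℕ} {x y : Function.End (ℕ → ℕ)} (hx : Supported a b x)
    (hy : Supported c d y) (h : b < c ∨ b = 0 ∨ d = 0) : Commute x y := by
  induction hx using Submonoid.closure_induction with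
  | one => exact Commute.one_left _
  | mul _ _ _ _ h1 h2 => exact h1.mul_left h2
  | mem x hx =>
    obtain ⟨k, ⟨h1, h2⟩, rfl⟩ := hx
    induction hy using Submonoid.closure_induction with
    | one => exact Commute.one_right _
    | mul _ _ _ _ h1 h2 => exact h1.mul_right h2
    | mem y hy =>
      obtain ⟨l, ⟨h3, h4⟩, rfl⟩ := hy
      exact sortAt_comm (by omega)

/-- Only the factors k and k + 1 interact with the generator after it has passed the larger ones; a
braid relation raises its index by one, and it then passes the smaller factors. -/
theorem asc_mul_sortAt {a b k : ℕ} (h1 : a ≤ k) (h2 : k + 1 < b) :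
    asc a b * sortAt k = sortAt (k + 1) * asc a b := by
  have e1 : asc a b = asc a k * (sortAt k * sortAt (k + 1)) * asc (k + 2) b := by
    rw [← asc_succ k, ← asc_succ (k + 1), asc_mul_asc (by omega) (by omega),
      asc_mul_asc (by omega) (by omega), asc_mul_asc (by omega) (by omega)]
  have c1 : Commute (asc (k + 2) b) (sortAt k) :=
    ((Supported.sortAt le_rfl (Nat.lt_succ_self k)).commute (.asc _ _) (.inl (by omega))).symm
  have c2 : Commute (sortAt (k + 1)) (asc a k) :=
    ((Supported.asc a k).commute (.sortAt le_rfl (Nat.lt_succ_self _)) (.inl (by omega))).symm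
  calc asc a b * sortAt k
      = asc a k * (sortAt k * sortAt (k + 1)) * (asc (k + 2) b * sortAt k) := by
        rw [e1, mul_assoc]
    _ = asc a k * (sortAt k * sortAt (k + 1) * sortAt k) * asc (k + 2) b := by
        rw [c1.eq]; simp only [mul_assoc]
    _ = (asc a k * sortAt (k + 1)) * (sortAt k * sortAt (k + 1)) * asc (k + 2) b := by
        rw [sortAt_braid]; simp only [mul_assoc]
    _ = sortAt (k + 1) * asc a b := by rw [← c2.eq, e1]; simp only [mul_assoc]

theorem asc_mul_asc_shift {a b k l : ℕ} (h1 : a ≤ k) (h2 : l < b) :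
    asc a b * asc k l = asc (k + 1) (l + 1) * asc a b := by
  rcases le_or_gt k l with h | h
  · induction l, h using Nat.le_induction with
    | base => simp [asc_self]
    | succ l hl ih =>
      rw [asc_succ_right hl, asc_succ_right (by omega : k + 1 ≤ l + 1), ← mul_assoc, ih (by omega),
        mul_assoc, asc_mul_sortAt (by omega) (by omega), mul_assoc]
  · simp [asc, List.Ico.eq_nil_of_le h.le, List.Ico.eq_nil_of_le (Nat.succ_le_succ h.le)]

theorem sortAt_mul_asc {a b : ℕ} (h : a < b) : sortAt a * asc a b = asc a b := by
  rw [asc_succ_left h, ← mul_assoc, sortAt_mul_self]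

theorem asc_mul_sortAt_last {a b : ℕ} (h : a ≤ b) : asc a (b + 1) * sortAt b = asc a (b + 1) := by
  rw [asc_succ_right h, mul_assoc, sortAt_mul_self]

/-- Shifting all but the last factor of the second product across the first leaves a doubled last
factor, absorbed by idempotence. This is the algebra of a doublecross. -/
theorem asc_mul_asc_self {a b : ℕ} (h : a < b) :
    asc a b * asc a b = asc (a + 1) b * asc a b := by
  obtain ⟨b, rfl⟩ : ∃ m, b = m + 1 := ⟨b - 1, by omega⟩
  nth_rewrite 2 [asc_succ_right (by omega)]
  rw [← mul_assoc, asc_mul_asc_shift le_rfl (by omega), mul_assoc, asc_mul_sortAt_last (by omega)]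

/-! ### The word of a row -/

/-- The number of tiles in columns `< j` that connect up. -/
def upCount (x : ℕ → Tile) : ℕ → ℕ
  | 0 => 0
  | j + 1 => upCount x j + if (x j).up = true then 1 else 0

/-- The generator of a column: it acts where two pipes cross. -/
def crossing (x : ℕ → Tile) (j : ℕ) : Function.End (ℕ → ℕ) :=
  if x j = plus then sortAt (upCount x j) else 1

/-- The product of the generators of the columns `lo, …, hi - 1`. -/
def segProd (x : ℕ → Tile) (lo hi : ℕ) : Function.End (ℕ → ℕ) :=
  ((List.Ico lo hi).map (crossing x)).prod

theorem segProd_self (x : ℕ → Tile) (a : ℕ) : segProd x a a = 1 := by simp [segProd]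

theorem segProd_mul {x : ℕ → Tile} {a b c : ℕ} (h1 : a ≤ b) (h2 : b ≤ c) :
    segProd x a b * segProd x b c = segProd x a c := by
  rw [segProd, segProd, segProd, ← List.prod_append, ← List.map_append,
    List.Ico.append_consecutive h1 h2]

theorem segProd_succ (x : ℕ → Tile) (a : ℕ) : segProd x a (a + 1) = crossing x a := by
  simp [segProd]

theorem segProd_succ_right {x : ℕ → Tile} {a b : ℕ} (h : a ≤ b) :
    segProd x a (b + 1) = segProd x a b * crossing x b := by
  rw [← segProd_succ x b, segProd_mul h (Nat.le_succ b)]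

theorem segProd_succ_left {x : ℕ → Tile} {a b : ℕ} (h : a < b) :
    segProd x a b = crossing x a * segProd x (a + 1) b := by
  rw [← segProd_succ x a, segProd_mul (Nat.le_succ a) h]

theorem segProd_congr {x y : ℕ → Tile} {a b : ℕ}
    (h : ∀ j, a ≤ j → j < b → (x j = plus ↔ y j = plus) ∧ (x j = plus → upCount x j = upCount y j)) :
    segProd x a b = segProd y a b := by
  unfold segProd
  congr 1
  refine List.map_congr_left fun j hj => ?_
  rw [List.Ico.mem] at hj
  have := h j hj.1 hj.2
  unfold crossing
  grind

theorem upCount_mono (x : ℕ → Tile) : Monotone (upCount x) :=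
  monotone_nat_of_le_succ fun j => by simp [upCount]

/-- If every vertical pipe met on a stretch is crossed, the indices of the generators are
consecutive: this is the word of a pipe running straight. -/
theorem segProd_eq_asc {x : ℕ → Tile} {a b : ℕ} (hab : a ≤ b)
    (h : ∀ j, a ≤ j → j < b → (x j).up = true → x j = plus) :
    segProd x a b = asc (upCount x a) (upCount x b) := by
  induction b, hab using Nat.le_induction with
  | base => simp [segProd_self, asc_self]
  | succ b hb ih =>
    rw [segProd_succ_right hb, ih fun j h1 h2 => h j h1 (by omega)]
    by_cases hp : x b = plus
    · simp [crossing, hp, upCount, Tile.up, asc_succ_right (upCount_mono x hb)]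
    · have hu : ¬ (x b).up = true := fun hu => hp (h b hb (by omega) hu)
      simp [crossing, hp, upCount, hu]

theorem supported_segProd {x : ℕ → Tile} {a b l u : ℕ}
    (h : ∀ j, a ≤ j → j < b → x j = plus → l ≤ upCount x j ∧ upCount x j < u) :
    Supported l u (segProd x a b) := by
  refine .prod fun y hy => ?_
  obtain ⟨j, hj, rfl⟩ := List.mem_map.1 hy
  rw [List.Ico.mem] at hj
  unfold crossing
  split_ifs with hp
  · have := h j hj.1 hj.2 hp
    exact .sortAt this.1 this.2
  · exact .one

/-- Kinks that slide to the lower row have their positions raised by one, because the straight pipe,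
now above them, has come down to their left. Passing `asc l u` has the same effect on generators. -/
theorem asc_mul_segProd {x y : ℕ → Tile} {a b l u : ℕ} (hab : a ≤ b)
    (h : ∀ j, a ≤ j → j < b → (x j = plus ↔ y j = plus) ∧
      (x j = plus → upCount y j = upCount x j + 1 ∧ l ≤ upCount x j ∧ upCount x j + 1 < u)) :
    asc l u * segProd x a b = segProd y a b * asc l u := by
  induction b, hab using Nat.le_induction with
  | base => simp [segProd_self]
  | succ b hb ih =>
    rw [segProd_succ_right hb, segProd_succ_right hb, ← mul_assoc,
      ih fun j h1 h2 => h j h1 (by omega), mul_assoc, mul_assoc]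
    congr 1
    obtain ⟨h1, h2⟩ := h b hb (by omega)
    unfold crossing
    by_cases hp : x b = plus
    · obtain ⟨h3, h4, h5⟩ := h2 hp
      rw [if_pos hp, if_pos (h1.1 hp), h3, asc_mul_sortAt h4 h5]
    · rw [if_neg hp, if_neg (fun h => hp (h1.2 h))]
      simp

/-- Adjacent tiles of an infinite row fit together and nothing leaves to the left. -/
structure NatRow (x : ℕ → Tile) : Prop where
  left_border : (x 0).left = false
  horizontal : ∀ j, (x j).right = (x (j + 1)).left

/-- The horizontal pipe at j either reaches column k or turns up in between, and in the latter case
it contributes one more upward edge. -/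
theorem NatRow.upCount_lt {x : ℕ → Tile} (hx : NatRow x) {j k : ℕ} (hjk : j < k) (hj : x j = plus) :
    upCount x j + 1 + (if (x k).left = true then 0 else 1) ≤ upCount x k := by
  induction k, hjk using Nat.le_induction with
  | base => simp [← hx.horizontal, hj, Tile.right, upCount, Tile.up]
  | succ k hk ih =>
    rw [← hx.horizontal k]
    cases h : x k <;> simp_all [Tile.left, Tile.right, Tile.up, upCount] <;> omega

/-- Pipes are conserved in the columns before k: those entering from above or through the right edge
all leave at the bottom, none through the left border. -/
theorem NatRow.upCount_next {x y : ℕ → Tile} (hx : NatRow x) (hv : ∀ j, (x j).down = (y j).up)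
    (k : ℕ) : upCount y k = upCount x k + (if (x k).left = true then 1 else 0) := by
  induction k with
  | zero => simp [upCount, hx.left_border]
  | succ k ih =>
    rw [upCount, upCount, ih, ← hx.horizontal k, ← hv k]
    cases h : x k <;> simp_all [Tile.left, Tile.right, Tile.up, Tile.down]


/-! ### Moves and words -/

/-- The algebra behind an undroop: `Q` and `Q'` are the parts of the rows that are exchanged. -/
structure UndroopWord (d β : ℕ) (Q Q' : Function.End (ℕ → ℕ)) : Prop where
  supp : Supported d (β - 1) Q
  supp' : Supported d β Q'
  comm : asc d β * Q = Q' * asc d β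

/-- Before the undroop the upper row is `X₀ * (Q * X₁)` and the lower row `Y₀ * (asc d β * F)`.
Parts acting on distant positions commute, so the straight pipe can be brought next to Q and
exchanged with it; `hFG` settles the right end. -/
theorem UndroopWord.rows_eq {d β u : ℕ} {Q Q' X₀ Y₀ F G X₁ E : Function.End (ℕ → ℕ)}
    (h : UndroopWord d β Q Q') (hd : d ≤ β) (hX : Supported 0 (d - 1) X₀) (hF : Supported β u F)
    (hG : Supported (β + 1) u G) (hFG : F * X₁ = G * X₁ * E) :
    Y₀ * (asc d β * F) * (X₀ * (Q * X₁)) = Y₀ * (Q' * G) * (X₀ * (asc d β * X₁)) * E := by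
  have c1 : Commute F (X₀ * Q) :=
    (hX.commute hF (by omega)).symm.mul_right (h.supp.commute hF (by omega)).symm
  have c2 : Commute (asc d β) X₀ := (hX.commute (.asc _ _) (by omega)).symm
  have c3 : Commute G (X₀ * asc d β) :=
    (hX.commute hG (by omega)).symm.mul_right ((Supported.asc d β).commute hG (by omega)).symm
  have c4 : Commute Q' X₀ := (hX.commute h.supp' (by omega)).symm
  calc Y₀ * (asc d β * F) * (X₀ * (Q * X₁))
      = Y₀ * (asc d β * (F * (X₀ * Q)) * X₁) := by simp only [mul_assoc]
    _ = Y₀ * ((asc d β * X₀) * Q * F * X₁) := by rw [c1.eq]; simp only [mul_assoc]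
    _ = Y₀ * (X₀ * (asc d β * Q) * (F * X₁)) := by rw [c2.eq]; simp only [mul_assoc]
    _ = Y₀ * ((X₀ * Q') * asc d β * (G * X₁ * E)) := by rw [h.comm, hFG]; simp only [mul_assoc]
    _ = Y₀ * (Q' * ((X₀ * asc d β) * G) * X₁ * E) := by rw [← c4.eq]; simp only [mul_assoc]
    _ = _ := by rw [← c3.eq]; simp only [mul_assoc]

/-- A row of tiles, continued to the right by horizontal tiles. -/
def natRow (x : Fin n → Tile) (j : ℕ) : Tile := if h : j < n then x ⟨j, h⟩ else hor

@[simp] theorem natRow_val (x : Fin n → Tile) (j : Fin n) : natRow x j = x j := by simp [natRow]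

theorem natRow_of_le (x : Fin n → Tile) {j : ℕ} (h : n ≤ j) : natRow x j = hor := by
  simp [natRow, not_lt.2 h]

theorem RowValid.natRow {x : Fin n → Tile} (hx : RowValid x) (hn : 0 < n) :
    NatRow (natRow x) := by
  refine ⟨?_, fun j => ?_⟩
  · simpa [BPD.natRow, hn] using hx.left_border ⟨0, hn⟩ rfl
  · rcases lt_trichotomy (j + 1) n with h | h | h
    · simpa [BPD.natRow, h, (by omega : j < n)] using hx.horizontal ⟨j, by omega⟩ ⟨j + 1, h⟩ rfl
    · rw [natRow_of_le x h.ge]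
      simpa [BPD.natRow, (by omega : j < n), Tile.left] using hx.right_border ⟨j, by omega⟩ h
    · rw [natRow_of_le x h.le, natRow_of_le x (by omega)]
      rfl

theorem UndroopMove.natTiles {x y x' y' : Fin n → Tile} {c p c' : Fin n} {star : Prop}
    (h : UndroopMove x y x' y' c p c' star) (j : ℕ) :
    ((j < c ∨ p < j) ∧ natRow x' j = natRow x j ∧ (natRow y' j = plus ↔ natRow y j = plus)) ∨
    (j = c ∧ natRow x j ≠ plus ∧ (natRow x' j).up = (natRow x j).up ∧
      ((natRow x' j).up = true → natRow x' j = plus) ∧ (natRow y j).up = false ∧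
      natRow y' j ≠ plus) ∨
    (c < j ∧ j < p ∧ Inner (natRow x j) (natRow y j) (natRow x' j) (natRow y' j)) ∨
    (j = p ∧ natRow x j ≠ plus ∧ natRow x' j ≠ plus ∧ (natRow x j).left = false ∧
      (natRow x j).up = (natRow x' j).up ∧ natRow y' j ≠ plus ∧ (natRow y j).up = true ∧
      (natRow y' j).left = false) := by
  have hp := p.2
  by_cases hj : j < n
  · lift j to Fin n using hj
    simp only [natRow_val]
    have := h.tiles j
    simp only [← Fin.lt_def, ← Fin.ext_iff]
    rcases this with H | H | H | H | H
    · exact .inl (by grind)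
    · exact .inl (by grind)
    · refine .inr (.inl ?_)
      rcases H with ⟨e, ⟨e1, e2, e3⟩ | ⟨e1, e2, e3⟩⟩
      · refine ⟨e, ?_⟩
        rcases e3 with e3 | e3 <;> simp [e1, e2, e3, Tile.up]
      · refine ⟨e, ?_⟩
        simp [e1, e2, e3, Tile.up]
    · exact .inr (.inr (.inl H))
    · obtain ⟨rfl, H⟩ := H
      refine .inr (.inr (.inr ⟨rfl, ?_⟩))
      rcases H with ⟨-, -, ⟨e1, e2⟩ | ⟨e1, e2⟩, e3, e4⟩ | ⟨-, e1, e2, e3, e4⟩ <;>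
        simp [e1, e2, e3, e4, Tile.up, Tile.left]
  · left
    simp [natRow_of_le _ (not_lt.1 hj)]
    omega


/-- Both rows are cut at the right end p and at the column b where the exchanged part begins.
Between them the straight pipe and the kinks trade places without changing the product, and the
factor E arises solely from the right end. -/
theorem UndroopMove.word {x y x' y' : Fin n → Tile} {c p c' : Fin n} {star : Prop}
    (h : UndroopMove x y x' y' c p c' star) (hx : RowValid x) (hy : RowValid y)
    (hv : ∀ j, (x j).down = (y j).up) :
    ∃ E, (¬ star ∧ E = 1 ∨ star ∧ E = sortAt (upCount (natRow x) n)) ∧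
    segProd (natRow y) 0 n * segProd (natRow x) 0 n =
      segProd (natRow y') 0 n * segProd (natRow x') 0 n * E := by
  have hn : 0 < n := c.pos
  have hcp : (c : ℕ) < p := h.lt
  have hpn := p.2
  obtain ⟨hx', hy'⟩ := (RowMove.rowValid_iff (.inl ⟨p, h⟩)).1 ⟨hx, hy⟩
  have hud := RowMove.up_down (.inl ⟨p, h⟩)
  have he := h.edges
  have t := h.natTiles
  have hX := hx.natRow hn
  have hX' := hx'.natRow hn
  have hv1 : ∀ j, (natRow x j).down = (natRow y j).up := fun j => by
    by_cases hj : j < n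
    · simpa [natRow, hj] using hv ⟨j, hj⟩
    · simp [natRow, hj, Tile.up, Tile.down]
  have hv2 : ∀ j, (natRow x' j).down = (natRow y' j).up := fun j => by
    by_cases hj : j < n
    · simpa [natRow, hj] using (hud ⟨j, hj⟩).2.2.1 (hv ⟨j, hj⟩)
    · simp [natRow, hj, Tile.up, Tile.down]
  have hup : upCount (natRow x') = upCount (natRow x) := by
    funext k
    induction k with
    | zero => rfl
    | succ k ih =>
      rw [upCount, upCount, ih]
      by_cases hk : k < n
      · have := (hud ⟨k, hk⟩).1
        simp [natRow, hk, this]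
      · simp [natRow, hk]
  have hleft : ∀ j, (natRow x' j).left = if (c : ℕ) < j ∧ j ≤ p then true else (natRow x j).left := by
    intro j
    by_cases hk : j < n
    · have := (he ⟨j, hk⟩).2.1
      simpa [natRow, hk, Fin.lt_def, Fin.le_def] using this
    · simp [natRow, hk, Tile.left]
  have hcy : ∀ j, upCount (natRow y) j = upCount (natRow x) j +
      (if (natRow x j).left = true then 1 else 0) := hX.upCount_next hv1
  have hcy' : ∀ j, upCount (natRow y') j = upCount (natRow x) j +
      (if (c : ℕ) < j ∧ j ≤ p then 1 else if (natRow x j).left = true then 1 else 0) := fun j => by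
    rw [hX'.upCount_next hv2, hup, hleft]; split_ifs <;> simp_all
  generalize hXe : natRow x = X at *
  generalize hYe : natRow y = Y at *
  generalize hXe' : natRow x' = X' at *
  generalize hYe' : natRow y' = Y' at *
  have vX : ∀ j : Fin n, X j = x j := fun j => by rw [← hXe, natRow_val]
  have vY : ∀ j : Fin n, Y j = y j := fun j => by rw [← hYe, natRow_val]
  have hXn : (X n).left = true := by rw [← hXe, natRow_of_le x le_rfl]; rfl
  have hpl : (X p).left = false := by have := t p; grind
  have hpl' : (Y' p).left = false := by have := t p; grind
  have hm := upCount_mono X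
  have hYp : upCount Y p = upCount X p := by rw [hcy, if_neg (by simp [hpl]), add_zero]
  have hinner : ∀ j : ℕ, (c : ℕ) + 1 ≤ j → j < p →
      (X j = plus ↔ Y' j = plus) ∧ ((X' j).up = true → X' j = plus) ∧
        ((Y j).up = true → Y j = plus) := fun j h1 h2 => by
    rcases t j with H | H | ⟨-, -, H⟩ | H
    · omega
    · omega
    · rcases H with H | H | H | H | H <;> simp [H, Tile.up]
    · omega
  have hV : ∀ l, (∀ j, (c : ℕ) + 1 ≤ j → l ≤ upCount X j) →
      asc l (upCount X p) * segProd X (c + 1) p = segProd Y' (c + 1) p * asc l (upCount X p) := by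
    intro l hl
    refine asc_mul_segProd hcp fun j h1 h2 => ⟨(hinner j h1 h2).1, fun h3 => ⟨?_, hl j h1, ?_⟩⟩
    · rw [hcy', if_pos (by omega)]
    · have := hX.upCount_lt h2 h3
      simpa [hpl] using this
  have hVc : ∀ b ≤ (c : ℕ), segProd X b p = segProd X b c * segProd X (c + 1) p ∧
      segProd Y' b p = segProd Y' b c * segProd Y' (c + 1) p := by
    intro b hb
    have h1 : X c ≠ plus := by have := t c; grind
    have h2 : Y' c ≠ plus := by have := t c; grind
    rw [← segProd_mul hb hcp.le, ← segProd_mul hb hcp.le, segProd_succ_left hcp,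
      segProd_succ_left hcp, crossing, crossing, if_neg h1, if_neg h2, one_mul, one_mul]
    exact ⟨rfl, rfl⟩
  -- the part of the rows that is exchanged
  obtain ⟨b, hbc, hbl, hcomm, hx0, hy0⟩ : ∃ b : ℕ, b ≤ c ∧ (X b).left = false ∧
      asc (upCount X b) (upCount X p) * segProd X b p =
        segProd Y' b p * asc (upCount X b) (upCount X p) ∧
      (∀ j, b ≤ j → j < p → (X' j).up = true → X' j = plus) ∧
      (∀ j, b ≤ j → j < p → (Y j).up = true → Y j = plus) := by
    rcases h.leftEnd with ⟨h1, -⟩ | ⟨h1, -, -, -, b, h2, h3, h4, h5⟩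
    · refine ⟨c, le_rfl, by simp [vX, h1, Tile.left], ?_, fun j h2 h3 => ?_, fun j h2 h3 => ?_⟩
      · rw [(hVc c le_rfl).1, (hVc c le_rfl).2, segProd_self, segProd_self, one_mul, one_mul]
        exact hV _ fun j hj => hm (by omega)
      · rcases eq_or_lt_of_le h2 with rfl | h2
        · have := t c; grind
        · exact (hinner j h2 h3).2.1
      · rcases eq_or_lt_of_le h2 with rfl | h2
        · have := t c; grind
        · exact (hinner j h2 h3).2.2
    · have hbc : (b : ℕ) < c := h2
      have hxb : ∀ j, (b : ℕ) ≤ j → j < c → (X j).up = true → X j = plus := by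
        intro j e1 e2
        lift j to Fin n using by omega
        rw [vX]
        rcases eq_or_lt_of_le e1 with e1 | e1
        · rw [← Fin.ext e1, h3]; simp [Tile.up]
        · rcases (h5 j e1 e2).1 with e | e <;> simp [e, Tile.up]
      have hyb : ∀ j, (b : ℕ) ≤ j → j < c → (Y j).up = true → Y j = plus := by
        intro j e1 e2
        lift j to Fin n using by omega
        rw [vY]
        rcases eq_or_lt_of_le e1 with e1 | e1
        · rw [← Fin.ext e1, h4]; simp
        · rcases (h5 j e1 e2).2 with e | e <;> simp [e, Tile.up]
      have hbl : (X b).left = false := by simp [vX, h3, Tile.left]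
      have hcl : (X c).left = true := by simp [vX, h1, Tile.left]
      have hcu : upCount X (c + 1) = upCount X c + 1 := by simp [upCount, vX, h1, Tile.up]
      have hcp' : upCount X c + 1 ≤ upCount X p := hcu ▸ hm hcp
      have hbc' : upCount X b ≤ upCount X c := hm hbc.le
      have s1 : segProd X b c = asc (upCount X b) (upCount X c) := segProd_eq_asc hbc.le hxb
      have s2 : segProd Y' b c = asc (upCount X b) (upCount X c + 1) := by
        have e : segProd Y' b c = segProd Y b c := segProd_congr fun j e1 e2 => by
          have := t j
          rw [hcy, hcy', if_neg (by omega)]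
          grind
        rw [e, segProd_eq_asc hbc.le hyb, hcy, hcy]
        simp [hbl, hcl]
      refine ⟨b, hbc.le, hbl, ?_, fun j e2 e3 => ?_, fun j e2 e3 => ?_⟩
      · have e : asc (upCount X b) (upCount X p) * segProd X b p =
            asc (upCount X b + 1) (upCount X c + 1) *
              (segProd Y' (c + 1) p * asc (upCount X b) (upCount X p)) := by
          rw [(hVc b hbc.le).1, s1, ← mul_assoc, asc_mul_asc_shift le_rfl (by omega), mul_assoc,
            hV _ fun j hj => hm (by omega)]
        rw [(hVc b hbc.le).2, s2,
          asc_succ_left (a := upCount X b) (b := upCount X c + 1) (by omega), mul_assoc, mul_assoc, ← e, ← mul_assoc,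
          sortAt_mul_asc (by omega)]
      · rcases lt_trichotomy j c with h | rfl | h
        · have := t j
          have := hxb j e2 h
          grind
        · have := t c; grind
        · exact (hinner j h e3).2.1
      · rcases lt_trichotomy j c with h | rfl | h
        · exact hyb j e2 h
        · have := t c; grind
        · exact (hinner j h e3).2.2
  have hbp : b < p := by omega
  have hYb : upCount Y b = upCount X b := by rw [hcy, if_neg (by simp [hbl]), add_zero]
  have hword : UndroopWord (upCount X b) (upCount X p) (segProd X b p) (segProd Y' b p) := by
    refine ⟨supported_segProd fun j h1 h2 h3 => ⟨hm h1, ?_⟩,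
      supported_segProd fun j h1 h2 h3 => ⟨?_, ?_⟩, hcomm⟩
    · have := hX.upCount_lt h2 h3
      simp only [hpl, Bool.false_eq_true, if_false] at this
      omega
    · rw [hcy']
      have := hm h1
      omega
    · have := (hy'.natRow hn).upCount_lt (j := j) (k := p) h2 (by rw [hYe', h3])
      rw [hYe', hcy' p, hpl'] at this
      simp only [hcp, le_refl, and_self, if_true, Bool.false_eq_true, if_false] at this
      omega
  have hX0 : segProd X' 0 b = segProd X 0 b := segProd_congr fun j _ h2 => by
    have := t j
    rw [hup]
    grind
  have hY0 : segProd Y' 0 b = segProd Y 0 b := segProd_congr fun j _ h2 => by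
    have := t j
    rw [hcy, hcy', if_neg (by omega)]
    grind
  have hX1 : segProd X' p n = segProd X p n := segProd_congr fun j h1 _ => by
    have := t j
    rw [hup]
    grind
  have hY1 : segProd Y' p n = segProd Y (p + 1) n := by
    have : Y' p ≠ plus := by have := t p; grind
    rw [segProd_succ_left hpn, crossing, if_neg this, one_mul]
    refine segProd_congr fun j h1 _ => ?_
    have := t j
    rw [hcy, hcy', if_neg (by omega)]
    grind
  have eX : segProd X 0 n = segProd X 0 b * (segProd X b p * segProd X p n) := by
    rw [segProd_mul hbp.le hpn.le, segProd_mul (Nat.zero_le _) (by omega)]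
  have eX' : segProd X' 0 n =
      segProd X 0 b * (asc (upCount X b) (upCount X p) * segProd X p n) := by
    rw [← hX0, ← hX1, ← hup, ← segProd_eq_asc hbp.le hx0, segProd_mul hbp.le hpn.le,
      segProd_mul (Nat.zero_le _) (by omega)]
  have eY : segProd Y 0 n = segProd Y 0 b * (asc (upCount X b) (upCount X p) * segProd Y p n) := by
    rw [← hYb, ← hYp, ← segProd_eq_asc hbp.le hy0, segProd_mul hbp.le hpn.le,
      segProd_mul (Nat.zero_le _) (by omega)]
  have eY' : segProd Y' 0 n = segProd Y 0 b * (segProd Y' b p * segProd Y (p + 1) n) := by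
    rw [← hY0, ← hY1, segProd_mul hbp.le hpn.le, segProd_mul (Nat.zero_le _) (by omega)]
  have hmY := upCount_mono Y
  have hYp1 : upCount Y (p + 1) = upCount X p + 1 := by
    have : (Y p).up = true := by have := t p; grind
    simp [upCount, this, hYp]
  have hlt : ∀ j, j < n → upCount Y j < upCount Y n + 1 := fun j hj => Nat.lt_succ_of_le (hmY hj.le)
  -- Only the part from column p on remains. After the move the lower row has no crossing in column
  -- p, hence p + 1 on the right-hand side.
  suffices hE : ∃ E, (¬ star ∧ E = 1 ∨ star ∧ E = sortAt (upCount X n)) ∧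
      segProd Y p n * segProd X p n = segProd Y (p + 1) n * segProd X p n * E by
    obtain ⟨E, hE, hFG⟩ := hE
    refine ⟨E, hE, ?_⟩
    rw [eX, eX', eY, eY']
    refine hword.rows_eq (hm hbp.le) (supported_segProd fun j _ h2 h3 => ⟨Nat.zero_le _, ?_⟩)
      (supported_segProd fun j h1 h2 h3 => ⟨hYp ▸ hmY h1, hlt j h2⟩)
      (supported_segProd fun j h1 h2 h3 => ⟨hYp1 ▸ hmY h1, hlt j h2⟩) hFG
    have := hX.upCount_lt h2 h3
    simp only [hbl, Bool.false_eq_true, if_false] at this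
    omega
  have hup1 : ∀ k : ℕ, p < k → k ≤ n → (∀ j : Fin n, p < j → j < k → y j = hor ∨ y j = plus) →
      (Y p = plus) → segProd Y p k = asc (upCount X p) (upCount Y k) ∧
        segProd Y (p + 1) k = asc (upCount X p + 1) (upCount Y k) := by
    intro k h1 h2 h3 h4
    have h5 : ∀ j, (p : ℕ) ≤ j → j < k → (Y j).up = true → Y j = plus := by
      intro j e1 e2
      lift j to Fin n using by omega
      rcases eq_or_lt_of_le e1 with e1 | e1
      · rw [← e1, h4]; simp
      · rw [vY]
        rcases h3 j e1 e2 with e | e <;> simp [e, Tile.up]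
    rw [segProd_eq_asc h1.le h5, segProd_eq_asc h1 fun j e1 => h5 j (by omega), hYp, hYp1]
    exact ⟨rfl, rfl⟩
  have hXup : ∀ k : ℕ, p < k → x p = rt → (∀ j : Fin n, p < j → j < k → x j = hor ∨ x j = plus) →
      k ≤ n → segProd X p k = asc (upCount X p) (upCount X k) := by
    intro k h1 h2 h3 h4
    refine segProd_eq_asc h1.le fun j e1 e2 => ?_
    lift j to Fin n using by omega
    rw [vX]
    rcases eq_or_lt_of_le e1 with e1 | e1
    · rw [← Fin.ext e1, h2]; simp [Tile.up]
    · rcases h3 j e1 e2 with e | e <;> simp [e, Tile.up]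
  rcases h.rightEnd with ⟨hs, rfl, h1, -⟩ | ⟨hs, h1, h2, h3, -, -, h4, h5, -, h6⟩ | ⟨hs, rfl, -, -⟩
  · refine ⟨1, .inl ⟨hs, rfl⟩, ?_⟩
    have hj : y p = jt := by simpa [hs] using h.window.last
    rw [segProd_succ_left hpn, crossing, vY, hj, if_neg (by simp), one_mul, mul_one]
  · have hlast : y c' = jt := by simpa [hs] using h.window.last
    have hpc : (p : ℕ) < c' := h1
    have hcn := c'.2
    have hseg : ∀ j, p < j → j < c' → y j = hor ∨ y j = plus := fun j e1 e2 =>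
      h.window.seg j (h.lt.trans e1) e2
    obtain ⟨f1, f2⟩ := hup1 c' hpc hcn.le hseg (by rw [vY, h3])
    have f3 := hXup c' hpc h2 (fun j e1 e2 => (h4 j e1 e2).1) hcn.le
    have f4 : upCount Y c' = upCount X c' + 1 := by
      rw [hcy, vX, h5]; simp [Tile.left]
    have hc : segProd X p (c' + 1) = asc (upCount X p) (upCount Y c') := by
      rw [segProd_succ_right hpc.le, f3, crossing, vX, h5, if_pos rfl,
        ← asc_succ_right (hm hpc.le), f4]
    have hY2 : segProd Y c' n = segProd Y (c' + 1) n := by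
      rw [segProd_succ_left hcn, crossing, vY, hlast, if_neg (by simp), one_mul]
    have hYc1 : upCount Y (c' + 1) = upCount Y c' + 1 := by
      simp [upCount, vY, hlast, Tile.up]
    have hcm : Commute (segProd Y (c' + 1) n) (asc (upCount X p) (upCount Y c')) :=
      ((Supported.asc _ _).commute (supported_segProd fun j e1 e2 _ => ⟨hYc1.symm.le.trans (hmY e1), hlt j e2⟩)
        (.inl (Nat.lt_succ_self _))).symm
    have hlt' : upCount X p < upCount Y c' := by
      have := hm hpc.le
      omega
    refine ⟨1, .inl ⟨hs, rfl⟩, ?_⟩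
    rw [mul_one, ← segProd_mul hpc.le hcn.le (x := Y), ← segProd_mul (x := Y) hpc hcn.le,
      ← segProd_mul (x := X) (Nat.le_succ_of_le hpc.le) hcn, hc, f1, f2, hY2]
    -- Doublecross: both rows contribute the same ascending product, so the first factor of the left
    -- copy, the crossing in column p, is redundant.
    calc asc (upCount X p) (upCount Y c') * segProd Y (c' + 1) n *
          (asc (upCount X p) (upCount Y c') * segProd X (c' + 1) n)
        = asc (upCount X p) (upCount Y c') *
            (segProd Y (c' + 1) n * asc (upCount X p) (upCount Y c')) * segProd X (c' + 1) n := by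
          simp only [mul_assoc]
      _ = asc (upCount X p) (upCount Y c') * asc (upCount X p) (upCount Y c') *
            segProd Y (c' + 1) n * segProd X (c' + 1) n := by
          rw [hcm.eq]; simp only [mul_assoc]
      _ = asc (upCount X p + 1) (upCount Y c') *
            (asc (upCount X p) (upCount Y c') * segProd Y (c' + 1) n) * segProd X (c' + 1) n := by
          rw [asc_mul_asc_self hlt']; simp only [mul_assoc]
      _ = _ := by
          rw [← hcm.eq]; simp only [mul_assoc]
  · obtain ⟨-, h1, h2, h3⟩ : star ∧ x p = rt ∧ y p = plus ∧
        ∀ j, p < j → (x j = hor ∨ x j = plus) ∧ (y j = hor ∨ y j = plus) := by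
      simpa [hs] using h.window.last
    obtain ⟨f1, f2⟩ := hup1 n hpn le_rfl (fun j e1 _ => (h3 j e1).2) (by rw [vY, h2])
    have f3 := hXup n hpn h1 (fun j e1 _ => (h3 j e1).1) le_rfl
    have f4 : upCount Y n = upCount X n + 1 := by rw [hcy, if_pos hXn]
    refine ⟨_, .inr ⟨hs, rfl⟩, ?_⟩
    -- Starred case: both pipes run to the right border. Shifting the shorter ascending product past
    -- the longer one exposes the last generator of the latter, which becomes E.
    rw [f1, f2, f3, f4, mul_assoc, ← asc_succ_right (hm hpn.le),
      ← asc_mul_asc_shift le_rfl (Nat.lt_succ_self _), asc_succ_right (hm hpn.le)]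


theorem upCount_congr {x y : ℕ → Tile} (h : ∀ j, (x j).up = (y j).up) : upCount x = upCount y := by
  funext k
  induction k with
  | zero => rfl
  | succ k ih => rw [upCount, upCount, ih, h]

theorem segProd_natRow_congr {x x' : Fin n → Tile} (h : ∀ j, (x j).up = (x' j).up)
    (h' : ∀ j, x j = plus ↔ x' j = plus) (a b : ℕ) :
    segProd (natRow x) a b = segProd (natRow x') a b := by
  refine segProd_congr fun j _ _ => ⟨?_, fun _ => congrFun (upCount_congr fun k => ?_) j⟩
  · by_cases hj : j < n <;> simp [natRow, hj, h']
  · by_cases hk : k < n <;> simp [natRow, hk, h]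

theorem natRow_down_eq_up {x y : Fin n → Tile} (hv : ∀ j, (x j).down = (y j).up) (j : ℕ) :
    (natRow x j).down = (natRow y j).up := by
  by_cases hj : j < n
  · simpa [natRow, hj] using hv ⟨j, hj⟩
  · simp [natRow, hj, Tile.up, Tile.down]

/-- A starred marking move leaves the words unchanged and yet must split off a generator. Since the
upper R at c' lies over a plus and both pipes run straight to the right border, the product already
ends in that generator, and idempotence applies. -/
theorem Window.word_absorbs {x y : Fin n → Tile} {c c' : Fin n} {star : Prop}
    (h : Window x y c c' star) (hs : star) (hx : RowValid x) (hv : ∀ j, (x j).down = (y j).up) :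
    segProd (natRow y) 0 n * segProd (natRow x) 0 n * sortAt (upCount (natRow x) n) =
      segProd (natRow y) 0 n * segProd (natRow x) 0 n := by
  obtain ⟨-, h1, h2, h3⟩ : star ∧ x c' = rt ∧ y c' = plus ∧
      ∀ j, c' < j → (x j = hor ∨ x j = plus) ∧ (y j = hor ∨ y j = plus) := by
    simpa [hs] using h.last
  have hX := hx.natRow c.pos
  have hcn := c'.2
  have hm := upCount_mono (natRow x)
  have hcy := hX.upCount_next (natRow_down_eq_up hv)
  have hl : (natRow x c').left = false := by simp [h1, Tile.left]
  have e1 : upCount (natRow y) c' = upCount (natRow x) c' := by rw [hcy, hl]; simp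
  have e2 : upCount (natRow y) n = upCount (natRow x) n + 1 := by
    rw [hcy, natRow_of_le x le_rfl]; simp [Tile.left]
  have f1 : segProd (natRow x) c' n = asc (upCount (natRow x) c') (upCount (natRow x) n) := by
    refine segProd_eq_asc hcn.le fun j a1 a2 => ?_
    lift j to Fin n using a2
    rw [natRow_val]
    rcases eq_or_lt_of_le a1 with a1 | a1
    · rw [← Fin.ext a1, h1]; simp [Tile.up]
    · rcases (h3 j a1).1 with e | e <;> simp [e, Tile.up]
  have f2 : segProd (natRow y) c' n = asc (upCount (natRow x) c') (upCount (natRow x) n + 1) := by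
    rw [← e1, ← e2]
    refine segProd_eq_asc hcn.le fun j a1 a2 => ?_
    lift j to Fin n using a2
    rw [natRow_val]
    rcases eq_or_lt_of_le a1 with a1 | a1
    · rw [← Fin.ext a1, h2]; simp
    · rcases (h3 j a1).2 with e | e <;> simp [e, Tile.up]
  have hc : Commute (segProd (natRow x) 0 c')
      (asc (upCount (natRow x) c') (upCount (natRow x) n + 1)) := by
    refine (supported_segProd (l := 0) (u := upCount (natRow x) c' - 1)
      fun j _ a2 a3 => ⟨Nat.zero_le _, ?_⟩).commute (.asc _ _) (by omega)
    have := hX.upCount_lt a2 a3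
    simp only [hl, Bool.false_eq_true, if_false] at this
    omega
  rw [← segProd_mul (Nat.zero_le _) hcn.le (x := natRow y),
    ← segProd_mul (Nat.zero_le _) hcn.le (x := natRow x), f1, f2]
  generalize segProd (natRow y) 0 c' = Y₀
  generalize segProd (natRow x) 0 c' = X₀ at *
  have hle := hm hcn.le
  generalize upCount (natRow x) c' = β at *
  generalize upCount (natRow x) n = r at *
  have key : Y₀ * asc β (r + 1) * (X₀ * asc β r) =
      Y₀ * X₀ * asc (β + 1) (r + 1) * asc β (r + 1) := by
    calc Y₀ * asc β (r + 1) * (X₀ * asc β r)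
        = Y₀ * (asc β (r + 1) * X₀) * asc β r := by simp only [mul_assoc]
      _ = Y₀ * X₀ * (asc β (r + 1) * asc β r) := by rw [← hc.eq]; simp only [mul_assoc]
      _ = _ := by rw [asc_mul_asc_shift le_rfl (Nat.lt_succ_self r)]; simp only [mul_assoc]
  rw [key, mul_assoc _ _ (sortAt r), asc_mul_sortAt_last hle]

theorem RowMove.word {x y x' y' : Fin n → Tile} {c c' : Fin n} {star : Prop}
    (h : RowMove x y x' y' c c' star) (hx : RowValid x) (hy : RowValid y)
    (hv : ∀ j, (x j).down = (y j).up) :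
    ∃ E, (¬ star ∧ E = 1 ∨ star ∧ E = sortAt (upCount (natRow x) n)) ∧
    segProd (natRow y) 0 n * segProd (natRow x) 0 n =
      segProd (natRow y') 0 n * segProd (natRow x') 0 n * E := by
  rcases h with ⟨p, h⟩ | h
  · exact h.word hx hy hv
  have e1 : segProd (natRow x') 0 n = segProd (natRow x) 0 n := by
    refine segProd_natRow_congr (fun j => (h.edges j).1.1) (fun j => ?_) _ _
    have := h.same_top j
    have := h.eq_jt
    have := h.eq_mjt
    grind
  have e2 : segProd (natRow y') 0 n = segProd (natRow y) 0 n := by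
    refine segProd_natRow_congr (fun j => (h.edges j).2.1) (fun j => ?_) _ _
    have := h.same_bot j
    have := h.mark
    have := h.window.last
    grind
  rw [e1, e2]
  by_cases hs : star
  · exact ⟨_, .inr ⟨hs, rfl⟩, (h.window.word_absorbs hs hx hv).symm⟩
  · exact ⟨1, .inl ⟨hs, rfl⟩, by rw [mul_one]⟩

/-! ### The word of a grid -/

/-- The product of the words of the first `m` rows, later rows to the left. -/
def gridWord (D : Grid n) : ℕ → Function.End (ℕ → ℕ)
  | 0 => 1
  | m + 1 => (if h : m < n then segProd (natRow (D ⟨m, h⟩)) 0 n else 1) * gridWord D m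

theorem gridWord_succ (D : Grid n) (i : Fin n) :
    gridWord D (i + 1) = segProd (natRow (D i)) 0 n * gridWord D i := by
  simp [gridWord]

/-- Each row adds exactly the one pipe entering at its right border. -/
theorem IsMBPD.upCount_eq {D : Grid n} (hD : IsMBPD D) (i : Fin n) :
    upCount (natRow (D i)) n = i := by
  obtain ⟨m, hm⟩ := i
  induction m with
  | zero =>
    have : ∀ k, k ≤ n → upCount (natRow (D ⟨0, hm⟩)) k = 0 := fun k hk => by
      induction k with
      | zero => rfl
      | succ k ih =>
        have := hD.top_border ⟨0, hm⟩ ⟨k, hk⟩ rfl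
        rw [upCount, ih (by omega)]
        simp [natRow, (by omega : k < n), this]
    exact this n le_rfl
  | succ m ih =>
    have := ((hD.rowValid ⟨m, by omega⟩).natRow (by omega)).upCount_next
      (natRow_down_eq_up fun j => hD.vertical ⟨m, by omega⟩ ⟨m + 1, hm⟩ j rfl) n
    rw [this, ih, natRow_of_le _ le_rfl]
    simp [Tile.left]

theorem IsMBPD.supported_gridWord {D : Grid n} (hD : IsMBPD D) {m : ℕ} (hm : m ≤ n) :
    Supported 0 (m - 1) (gridWord D m) := by
  induction m with
  | zero => exact .one
  | succ m ih =>
    rw [gridWord_succ D ⟨m, hm⟩]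
    refine (supported_segProd fun j _ h1 h2 => ⟨Nat.zero_le _, ?_⟩).mul
      ((ih (by omega)).mono le_rfl (by omega))
    have := ((hD.rowValid ⟨m, hm⟩).natRow (by omega)).upCount_lt h1 h2
    rw [hD.upCount_eq] at this
    simp only at this
    omega

theorem GridMove.gridWord {D D' : Grid n} {r s c c' : Fin n} {star : Prop}
    (h : GridMove D D' r s c c' star) (hD : IsMBPD D) :
    ∃ E, (¬ star ∧ E = 1 ∨ star ∧ E = sortAt r) ∧ gridWord D n = gridWord D' n * E := by
  have hs := h.next_row
  have hsn := s.2
  obtain ⟨E, hE, hW⟩ := h.rows.word (hD.rowValid r) (hD.rowValid s) (fun j => hD.vertical r s j hs)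
  rw [hD.upCount_eq] at hE
  refine ⟨E, hE, ?_⟩
  have h1 : ∀ m : ℕ, m ≤ r → BPD.gridWord D' m = BPD.gridWord D m := by
    intro m hm
    induction m with
    | zero => rfl
    | succ m ih =>
      have := h.out ⟨m, by omega⟩ (by rw [ne_eq, Fin.ext_iff]; simp; omega)
        (by rw [ne_eq, Fin.ext_iff]; simp; omega)
      rw [gridWord_succ D ⟨m, by omega⟩, gridWord_succ D' ⟨m, by omega⟩, ih (by omega), this]
  -- The rows above r only use indices below r - 1, so `sortAt r` passes them and ends up rightmost.
  have hcm : Commute E (BPD.gridWord D r) := by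
    rcases hE with ⟨-, rfl⟩ | ⟨-, rfl⟩
    · exact Commute.one_left _
    · exact ((hD.supported_gridWord r.2.le).commute
        (.sortAt le_rfl (Nat.lt_succ_self _)) (by omega)).symm
  have h2 : BPD.gridWord D (s + 1) = BPD.gridWord D' (s + 1) * E := by
    rw [gridWord_succ, gridWord_succ, hs, gridWord_succ, gridWord_succ, h1 r le_rfl, ← mul_assoc, hW,
      mul_assoc _ E, hcm.eq]
    simp only [mul_assoc]
  have h3 : ∀ m : ℕ, (s : ℕ) + 1 ≤ m → m ≤ n → BPD.gridWord D m = BPD.gridWord D' m * E := by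
    intro m hm
    induction m, hm using Nat.le_induction with
    | base => exact fun _ => h2
    | succ m hm ih =>
      intro hmn
      have := h.out ⟨m, by omega⟩ (by rw [ne_eq, Fin.ext_iff]; simp; omega)
        (by rw [ne_eq, Fin.ext_iff]; simp; omega)
      rw [gridWord_succ D ⟨m, by omega⟩, gridWord_succ D' ⟨m, by omega⟩, this]
      simp only
      rw [ih (by omega), mul_assoc]
  exact h3 n hsn le_rfl

/-- Rightmost factors act first, so the biletter peeled off first acts first, as in the definition
of the Demazure product of a sequence of biletters. -/
theorem Peel.gridWord {D D' : Grid n} {i a : Fin n} (h : Peel D i a D') (hD : IsMBPD D) :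
    gridWord D n = gridWord D' n * sortAt a := by
  induction h with
  | star h =>
    obtain ⟨E, hE, h1⟩ := h.gridWord hD
    simp only [not_true_eq_false, false_and, true_and, false_or] at hE
    rw [h1, hE]
  | step h _ ih =>
    obtain ⟨E, hE, h1⟩ := h.gridWord hD
    simp only [not_false_eq_true, false_and, true_and, or_false] at hE
    rw [h1, hE, mul_one, ih (h.isMBPD_iff.1 hD)]

theorem gridWord_of_ne_plus {D : Grid n} (h : ∀ i j, D i j ≠ plus) {m : ℕ} (hm : m ≤ n) :
    gridWord D m = 1 := by
  induction m with
  | zero => rfl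
  | succ m ih =>
    rw [gridWord_succ D ⟨m, hm⟩, ih (by omega), mul_one, segProd]
    refine List.prod_eq_one fun x hx => ?_
    obtain ⟨j, hj, rfl⟩ := List.mem_map.1 hx
    rw [List.Ico.mem] at hj
    rw [crossing, if_neg]
    simpa [natRow, hj.2] using h _ _


/-! ### Inversions -/

/-- The number of inversions among the first `n` entries. -/
def invCount (n : ℕ) (v : ℕ → ℕ) : ℕ :=
  (Finset.univ.filter fun p : Fin n × Fin n => p.1 < p.2 ∧ v p.2 < v p.1).card

theorem sortAt_of_le {a : ℕ} {v : ℕ → ℕ} (h : v (a + 1) ≤ v a) : sortAt a v = v := by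
  funext p
  simp only [sortAt]
  grind

theorem sortAt_of_lt {a : ℕ} {v : ℕ → ℕ} (h : v a < v (a + 1)) :
    sortAt a v = v ∘ Equiv.swap a (a + 1) := by
  funext p
  simp only [sortAt, Function.comp, Equiv.swap_apply_def]
  grind

theorem sortAt_injective {a : ℕ} {v : ℕ → ℕ} (h : v.Injective) : (sortAt a v).Injective := by
  rcases lt_or_ge (v a) (v (a + 1)) with h' | h'
  · rw [sortAt_of_lt h']
    exact h.comp (Equiv.injective _)
  · rwa [sortAt_of_le h']

theorem invCount_sortAt {a : ℕ} {v : ℕ → ℕ} (h : v a < v (a + 1)) (ha : a + 1 < n) :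
    invCount n (sortAt a v) = invCount n v + 1 := by
  classical
  set i : Fin n := ⟨a, by omega⟩
  set j : Fin n := ⟨a + 1, ha⟩
  have hσ : ∀ p : Fin n, (Equiv.swap i j p : ℕ) = Equiv.swap a (a + 1) (p : ℕ) := fun p => by
    simp only [Equiv.swap_apply_def, Fin.ext_iff, i, j]
    split_ifs <;> rfl
  -- After reindexing the inversions of v by the transposition, the two counts differ only in the
  -- pair (i, j).
  have e : invCount n v = (Finset.univ.filter fun p : Fin n × Fin n =>
      Equiv.swap i j p.1 < Equiv.swap i j p.2 ∧
        v (Equiv.swap i j p.2 : Fin n) < v (Equiv.swap i j p.1 : Fin n)).card := by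
    refine (Finset.card_bijective (fun p => (Equiv.swap i j p.1, Equiv.swap i j p.2)) ?_ ?_).symm
    · exact ((Equiv.swap i j).prodCongr (Equiv.swap i j)).bijective
    · simp
  rw [e, invCount]
  refine card_filter_add_one _ _ (i, j) (fun ⟨p, q⟩ => ?_) ?_
  · rw [sortAt_of_lt h]
    simp only [Function.comp, Fin.lt_def, hσ, Prod.mk.injEq, Fin.ext_iff, i, j]
    simp only [Equiv.swap_apply_def]
    grind
  · simp [Fin.lt_def, i, j]

theorem Supported.apply_of_lt {a b p : ℕ} {x : Function.End (ℕ → ℕ)} (h : Supported a b x)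
    (hp : b < p) (v : ℕ → ℕ) : x v p = v p := by
  induction h using Submonoid.closure_induction generalizing v with
  | one => rfl
  | mul x y _ _ h1 h2 => exact (h1 (y v)).trans (h2 v)
  | mem x hx =>
    obtain ⟨k, ⟨-, hk⟩, rfl⟩ := hx
    change (if p = k then _ else if p = k + 1 then _ else v p) = v p
    rw [if_neg (by omega), if_neg (by omega)]

/-! ### Following the pipes along a row -/

/-- The label of the pipe below column `k`, once the columns `≥ j` have been read. -/
def belowVal (x : ℕ → Tile) (j : ℕ) (v : ℕ → ℕ) (k : ℕ) : Option ℕ :=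
  if j ≤ k then
    if (x k).down = true then some (v (upCount x k + if (x k).left = true then 1 else 0)) else none
  else if (x k).up = true then some (v (upCount x k)) else none

/-- The label of the pipe that leaves column `j` to the left. -/
def leftVal (x : ℕ → Tile) (j : ℕ) (v : ℕ → ℕ) : Option ℕ :=
  if (x j).left = true then some (v (upCount x j)) else none

/-- The state `S`, reached with ignored crossings, after the columns `≥ j` of a row have been read:
`v` lists the pipes from left to right.  This does not depend on `S.toLeft`. -/
structure Labels (x : ℕ → Tile) (j : ℕ) (v : ℕ → ℕ) (S : PipeState n) : Prop where
  injective : v.Injective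
  below : ∀ k : Fin n, (S.below k).map Fin.val = belowVal x j v k
  crossed : ∀ p q : Fin n, ∀ a b, a < b → v a = p → v b = q → (s(p, q) ∈ S.crossings ↔ q < p)
  nodup : S.crossings.Nodup
  length : S.crossings.length = invCount n v

/-- Like `Labels`, including the pipe that leaves column `j` to the left. -/
structure Tracks (x : ℕ → Tile) (j : ℕ) (v : ℕ → ℕ) (S : PipeState n) : Prop
    extends Labels x j v S where
  toLeft : S.toLeft.map Fin.val = leftVal x j v

theorem NatRow.downCount_lt {x : ℕ → Tile} (hx : NatRow x) {j k : ℕ} (hjk : j < k)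
    (hj : (x j).down = true) :
    upCount x j + (if (x j).left = true then 1 else 0) <
      upCount x k + (if (x k).left = true then 1 else 0) := by
  have h := hx.upCount_next (y := fun j => if (x j).down = true then ver else hor)
    fun j => by by_cases h : (x j).down = true <;> simp [h, Tile.up]
  rw [← h, ← h]
  refine lt_of_lt_of_le ?_ (upCount_mono _ hjk)
  simp [upCount, hj, Tile.up]

theorem upCount_lt_of_up {x : ℕ → Tile} {j k : ℕ} (hjk : j < k) (hj : (x j).up = true) :
    upCount x j < upCount x k := by
  refine lt_of_lt_of_le ?_ (upCount_mono x hjk)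
  simp [upCount, hj]

/-- At a plus in column k the pipe from above has position `upCount x k` and the pipe from the right
the next one. A crossing exchanges their labels in the list, a bump does not. Two pipes have crossed
exactly if their labels are inverted, so in either case the effect is `sortAt`. -/
theorem Tracks.step {x : ℕ → Tile} {v : ℕ → ℕ} {S : PipeState n} {k : Fin n}
    (h : Tracks x (k + 1) v S) (hx : NatRow x) (hk : x k = plus → upCount x k + 1 < n) :
    Tracks x k (crossing x k v) (S.step true (x k) k) := by
  have hb := h.below k
  have hl := h.toLeft
  have hho := hx.horizontal k
  have hbo : ∀ i : Fin n, i ≠ k → belowVal x (k + 1) v i = belowVal x k v i := by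
    intro i hi
    have : (k : ℕ) + 1 ≤ i ↔ (k : ℕ) ≤ i := by
      have : (i : ℕ) ≠ k := fun h => hi (Fin.ext h)
      omega
    simp only [belowVal, this]
  have hup : upCount x (k + 1) = upCount x k + if (x k).up = true then 1 else 0 := rfl
  simp only [belowVal, leftVal, hup, ← hho] at hb hl
  by_cases hp : x k = plus
  · have hc : crossing x k v = sortAt (upCount x k) v := by rw [crossing, if_pos hp]
    have hu := hk hp
    rw [hc]
    simp only [hp, Tile.up, Tile.down, Tile.left, Tile.right, if_true, Nat.not_succ_le_self,
      if_false] at hb hl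
    obtain ⟨q, hq, hqv⟩ := Option.map_eq_some_iff.1 hb
    obtain ⟨p, hp', hpv⟩ := Option.map_eq_some_iff.1 hl
    have hx1 := h.crossed q p _ _ (Nat.lt_succ_self _) hqv.symm hpv.symm
    rw [Sym2.eq_swap] at hx1
    simp only [PipeState.step, hp, hp', hq, true_and, hx1]
    have hpos : ∀ i : Fin n, i ≠ k → ∀ v' : ℕ → ℕ,
        (∀ a, a ≠ upCount x k → a ≠ upCount x k + 1 → v' a = v a) →
          belowVal x k v' i = belowVal x (k + 1) v i := by
      intro i hi v' hv'
      rw [hbo i hi, belowVal, belowVal]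
      rcases lt_or_gt_of_ne hi with hik | hik
      · have e : ¬ (k : ℕ) ≤ i := by simpa using hik
        rw [if_neg e, if_neg e]
        split_ifs with hiu
        · have := upCount_lt_of_up hik hiu
          rw [hv' _ (by omega) (by omega)]
        · rfl
      · have e : (k : ℕ) ≤ i := hik.le
        rw [if_pos e, if_pos e]
        have := hx.downCount_lt hik (by rw [hp]; rfl)
        rw [if_pos (by rw [hp]; rfl)] at this
        split_ifs with h1 h2
        · rw [if_pos h2] at this
          rw [hv' _ (by omega) (by omega)]
        · rw [if_neg h2] at this
          rw [hv' _ (by omega) (by omega)]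
        · rfl
    have hne : v (upCount x k) ≠ v (upCount x k + 1) := h.injective.ne (by omega)
    rcases lt_or_gt_of_ne hne with hlt | hgt
    · rw [if_neg (by rw [Fin.lt_def]; omega)]
      have hs := sortAt_of_lt hlt
      refine ⟨⟨sortAt_injective h.injective, fun i => ?_, fun p₁ q₁ a b hab ha hb => ?_, ?_, ?_⟩, ?_⟩
      · by_cases hi : i = k
        · subst hi
          rw [hq, belowVal, if_pos le_rfl, hp, hs]
          simp [Tile.down, Tile.left, hqv]
        · rw [h.below, hpos i hi]
          intro a h1 h2
          simp [hs, Equiv.swap_apply_of_ne_of_ne h1 h2]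
      · simp only [hs, Function.comp] at ha hb
        have hinj := h.injective
        by_cases hab' : a = upCount x k ∧ b = upCount x k + 1
        · obtain ⟨rfl, rfl⟩ := hab'
          simp only [Equiv.swap_apply_left, Equiv.swap_apply_right] at ha hb
          have e1 : p₁ = p := Fin.ext (by omega)
          have e2 : q₁ = q := Fin.ext (by omega)
          subst e1 e2
          simp only [List.mem_cons, true_or, true_iff, Fin.lt_def]
          omega
        · have hlt' : Equiv.swap (upCount x k) (upCount x k + 1) a <
              Equiv.swap (upCount x k) (upCount x k + 1) b := by
            simp only [Equiv.swap_apply_def]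
            grind
          rw [List.mem_cons, h.crossed p₁ q₁ _ _ hlt' ha hb, or_iff_right]
          intro hh
          have hne : ∀ c d : Fin n, ∀ e f : ℕ, (c : ℕ) = v e → (d : ℕ) = v f → c = d → e = f :=
            fun c d e f h1 h2 h3 => hinj (by rw [← h1, ← h2, h3])
          rcases Sym2.eq_iff.1 hh with ⟨e1, e2⟩ | ⟨e1, e2⟩
          · have := hne _ _ _ _ ha.symm hpv e1
            have := hne _ _ _ _ hb.symm hqv e2
            simp only [Equiv.swap_apply_def] at *
            grind
          · have := hne _ _ _ _ ha.symm hqv e1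
            have := hne _ _ _ _ hb.symm hpv e2
            simp only [Equiv.swap_apply_def] at *
            grind
      · refine List.nodup_cons.2 ⟨fun hmem => ?_, h.nodup⟩
        have := hx1.1 hmem
        rw [Fin.lt_def] at this
        omega
      · rw [List.length_cons, h.length, invCount_sortAt hlt hu]
      · change (some p).map Fin.val = _
        rw [leftVal, hp, hs]
        simp [Tile.left, hpv]
    · rw [if_pos (by rw [Fin.lt_def]; omega), sortAt_of_le hgt.le]
      refine ⟨⟨h.injective, fun i => ?_, h.crossed, h.nodup, h.length⟩, ?_⟩
      · change (Function.update S.below k (some p) i).map Fin.val = _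
        by_cases hi : i = k
        · subst hi
          rw [Function.update_self, belowVal, if_pos le_rfl, hp]
          simp [Tile.down, Tile.left, hpv]
        · rw [Function.update_of_ne hi, h.below, hpos i hi _ fun _ _ _ => rfl]
      · rw [leftVal, hp]
        simp [Tile.left, hqv]
  · have hc : crossing x k v = v := by rw [crossing, if_neg hp]; rfl
    rw [hc]
    have hbelow : ∀ t, t.map Fin.val = belowVal x k v k → ∀ i : Fin n,
        (Function.update S.below k t i).map Fin.val = belowVal x k v i := by
      intro t ht i
      by_cases hi : i = k
      · subst hi; simpa using ht
      · rw [Function.update_of_ne hi, h.below, hbo i hi]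
    have hbelow' : (S.below k).map Fin.val = belowVal x k v k →
        ∀ i : Fin n, (S.below i).map Fin.val = belowVal x k v i := by
      intro ht i
      by_cases hi : i = k
      · subst hi; exact ht
      · rw [h.below, hbo i hi]
    cases ht : x k <;> simp only [ht, PipeState.step] at hb hl hp ⊢ <;>
      simp only [Tile.up, Tile.down, Tile.left, Tile.right, Bool.false_eq_true, if_false, if_true,
        add_zero, not_true_eq_false, Nat.not_succ_le_self] at hb hl hp
    · exact ⟨⟨h.injective, hbelow' (by simpa [belowVal, ht, Tile.down] using hb), h.crossed, h.nodup, h.length⟩,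
        by simpa [leftVal, ht, Tile.left] using hl⟩
    · exact ⟨⟨h.injective, hbelow' (by simpa [belowVal, ht, Tile.down] using hb), h.crossed, h.nodup, h.length⟩,
        by simpa [leftVal, ht, Tile.left] using hl⟩
    · exact ⟨⟨h.injective, hbelow' (by simpa [belowVal, ht, Tile.down, Tile.left] using hb), h.crossed, h.nodup, h.length⟩,
        by simpa [leftVal, ht, Tile.left] using hl⟩
    · exact ⟨⟨h.injective, hbelow _ (by simpa [belowVal, ht, Tile.down, Tile.left] using hl), h.crossed, h.nodup, h.length⟩,
        by simp [leftVal, ht, Tile.left]⟩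
    · exact ⟨⟨h.injective, hbelow _ (by simp [belowVal, ht, Tile.down]), h.crossed, h.nodup, h.length⟩,
        by simpa [leftVal, ht, Tile.left] using hb⟩
    · exact ⟨⟨h.injective, hbelow _ (by simp [belowVal, ht, Tile.down]), h.crossed, h.nodup, h.length⟩,
        by simpa [leftVal, ht, Tile.left] using hb⟩


/-- The states `S` and `S'` are reached by following the same pipes, where `S` ignores repeated
crossings and `S'` does not. -/
structure Agree (S S' : PipeState n) : Prop where
  below : ∀ k, (S.below k).isSome = (S'.below k).isSome
  toLeft : S.toLeft.isSome = S'.toLeft.isSome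
  eq_or : S = S' ∨ ¬ S'.crossings.Nodup ∧ S.crossings.length < S'.crossings.length

/-- The two readings coincide up to the first repeated crossing. From then on the second list
contains a duplicate and stays strictly longer, because it grows at every plus at which the first
one grows. -/
theorem Agree.step {S S' : PipeState n} (h : Agree S S') (t : Tile) (j : Fin n) :
    Agree (S.step true t j) (S'.step false t j) := by
  have hu : ∀ a b : Option (Fin n), a.isSome = b.isSome → ∀ k,
      (Function.update S.below j a k).isSome = (Function.update S'.below j b k).isSome := by
    intro a b hab k
    by_cases hk : k = j
    · subst hk; simpa using hab
    · simpa [Function.update_of_ne hk] using h.below k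
  cases t
  · exact h
  · exact h
  · exact h
  · have hb := h.below j
    have hl := h.toLeft
    rcases hl1 : S.toLeft with _ | p <;> rcases hb1 : S.below j with _ | q <;>
      rcases hl2 : S'.toLeft with _ | p' <;> rcases hb2 : S'.below j with _ | q' <;>
      simp only [hl1, hl2, hb1, hb2, Option.isSome_some, Option.isSome_none, reduceCtorEq] at hb hl
    · simpa [PipeState.step, hl1, hl2, hb1, hb2] using h
    · simpa [PipeState.step, hl1, hl2, hb1, hb2] using h
    · simpa [PipeState.step, hl1, hl2, hb1, hb2] using h
    · simp only [PipeState.step, hl1, hl2, hb1, hb2, true_and, Bool.false_eq_true, false_and,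
        if_false]
      split_ifs with hm
      · refine ⟨fun k => ?_, rfl, .inr ?_⟩
        · rw [← h.below k]
          by_cases hk : k = j
          · subst hk; simp [hb1]
          · simp [Function.update_of_ne hk]
        · rcases h.eq_or with rfl | ⟨h1, h2⟩
          · rw [hl1] at hl2
            rw [hb1] at hb2
            cases hl2
            cases hb2
            simp [hm]
          · simp only [List.nodup_cons, List.length_cons]
            exact ⟨fun h3 => h1 h3.2, by omega⟩
      · refine ⟨h.below, rfl, ?_⟩
        rcases h.eq_or with rfl | ⟨h1, h2⟩
        · rw [hl1] at hl2
          rw [hb1] at hb2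
          cases hl2
          cases hb2
          exact .inl rfl
        · simp only [List.nodup_cons, List.length_cons]
          exact .inr ⟨fun h3 => h1 h3.2, by omega⟩
  · refine ⟨hu _ _ h.toLeft, rfl, ?_⟩
    rcases h.eq_or with rfl | h1
    · exact .inl rfl
    · exact .inr h1
  · refine ⟨hu _ _ rfl, h.below j, ?_⟩
    rcases h.eq_or with rfl | h1
    · exact .inl rfl
    · exact .inr h1
  · refine ⟨hu _ _ rfl, h.below j, ?_⟩
    rcases h.eq_or with rfl | h1
    · exact .inl rfl
    · exact .inr h1

/-- Which edges carry a pipe depends only on the tiles, so two pipes really meet at every plus. -/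
theorem Tracks.length_step {x : ℕ → Tile} {v : ℕ → ℕ} {S S' : PipeState n} {k : Fin n}
    (h : Tracks x (k + 1) v S) (hx : NatRow x) (ha : Agree S S') :
    (S'.step false (x k) k).crossings.length =
      S'.crossings.length + if x k = plus then 1 else 0 := by
  have hb := h.below k
  have hl := h.toLeft
  have hb' := ha.below k
  have hl' := ha.toLeft
  have hho := hx.horizontal k
  simp only [belowVal, leftVal, ← hho, Nat.not_succ_le_self, if_false] at hb hl
  cases ht : x k <;> simp only [PipeState.step, reduceCtorEq, if_false, if_true, add_zero]
  simp only [ht, Tile.up, Tile.right, if_true] at hb hl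
  obtain ⟨q, hq, -⟩ := Option.map_eq_some_iff.1 hb
  obtain ⟨p, hp, -⟩ := Option.map_eq_some_iff.1 hl
  rw [hq, eq_comm, Option.isSome_some, Option.isSome_iff_exists] at hb'
  rw [hp, eq_comm, Option.isSome_some, Option.isSome_iff_exists] at hl'
  obtain ⟨q', hq'⟩ := hb'
  obtain ⟨p', hp'⟩ := hl'
  simp [hq', hp']

theorem foldr_finRange_induction {σ τ : Type*} {n : ℕ} (P : ℕ → σ → τ → Prop) (f : Fin n → σ → σ)
    (g : Fin n → τ → τ) {s : σ} {t : τ} (h0 : P n s t)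
    (h : ∀ (k : Fin n) s t, P (k + 1) s t → P k (f k s) (g k t)) :
    P 0 ((List.finRange n).foldr f s) ((List.finRange n).foldr g t) := by
  induction n generalizing P with
  | zero => simpa using h0
  | succ n ih =>
    rw [List.finRange_succ, List.foldr_cons, List.foldr_cons, List.foldr_map, List.foldr_map]
    exact h 0 _ _ (ih (fun k => P (k + 1)) _ _ h0 fun k s t => h k.succ s t)

theorem foldl_finRange_induction {σ τ : Type*} {n : ℕ} (P : ℕ → σ → τ → Prop) (f : σ → Fin n → σ)
    (g : τ → Fin n → τ) {s : σ} {t : τ} (h0 : P 0 s t)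
    (h : ∀ (k : Fin n) s t, P k s t → P (k + 1) (f s k) (g t k)) :
    P n ((List.finRange n).foldl f s) ((List.finRange n).foldl g t) := by
  induction n generalizing P s t with
  | zero => simpa using h0
  | succ n ih =>
    rw [List.finRange_succ, List.foldl_cons, List.foldl_cons, List.foldl_map, List.foldl_map]
    exact ih (fun k => P (k + 1)) _ _ (h 0 _ _ h0) fun k s t => h k.succ s t

/-- The number of plus tiles of a row in the columns `j, …, n - 1`. -/
def plusFrom (n : ℕ) (x : ℕ → Tile) (j : ℕ) : ℕ := ((Finset.Ico j n).filter (x · = plus)).card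

theorem plusFrom_eq {x : ℕ → Tile} {j : ℕ} (hj : j < n) :
    plusFrom n x j = plusFrom n x (j + 1) + if x j = plus then 1 else 0 := by
  rw [plusFrom, plusFrom, ← Finset.insert_Ico_add_one_left_eq_Ico hj, Finset.filter_insert]
  split_ifs <;> simp

theorem row_induction {D : Grid n} {i : Fin n} {x : ℕ → Tile} {v : ℕ → ℕ} {S S' : PipeState n}
    (hx : NatRow x) (hxD : ∀ k : Fin n, x k = D i k) (hn : (x n).left = true)
    (hu : upCount x n = i) (hv : v i = i) (h : Labels x n v S) (ha : Agree S S') :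
    Labels x 0 (segProd x 0 n v) (S.row true D i) ∧ Agree (S.row true D i) (S'.row false D i) ∧
      (S'.row false D i).crossings.length = S'.crossings.length + plusFrom n x 0 := by
  have key := foldr_finRange_induction
    (fun j (T T' : PipeState n) => j ≤ n → Tracks x j (segProd x j n v) T ∧ Agree T T' ∧
      T'.crossings.length = S'.crossings.length + plusFrom n x j)
    (fun j T => T.step true (D i j) j) (fun j T => T.step false (D i j) j)
    (s := ⟨S.below, some i, S.crossings⟩) (t := ⟨S'.below, some i, S'.crossings⟩)
    (fun _ => ?_) (fun k T T' hT _ => ?_)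
  · obtain ⟨h1, h2, h3⟩ := key (Nat.zero_le _)
    rw [PipeState.row, PipeState.row, List.foldl_reverse, List.foldl_reverse]
    exact ⟨h1.toLabels, h2, h3⟩
  · refine ⟨?_, ⟨ha.below, rfl, ?_⟩, by simp [plusFrom]⟩
    · rw [segProd_self]
      refine ⟨⟨h.injective, h.below, h.crossed, h.nodup, h.length⟩, ?_⟩
      rw [leftVal, if_pos hn, hu]
      exact congrArg some hv.symm
    · rcases ha.eq_or with rfl | h1
      · exact .inl rfl
      · exact .inr h1
  · obtain ⟨h1, h2, h3⟩ := hT k.2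
    rw [← hxD]
    refine ⟨?_, h2.step _ _, ?_⟩
    · rw [segProd_succ_left k.2]
      refine h1.step hx fun hp => ?_
      have := hx.upCount_lt k.2 hp
      have := i.2
      omega
    · rw [h1.length_step hx h2, h3, plusFrom_eq k.2]
      omega

/-- The rows of a grid, with vertical tiles below it. -/
def extRow (D : Grid n) (m : ℕ) : ℕ → Tile :=
  if h : m < n then natRow (D ⟨m, h⟩) else natRow fun _ : Fin n => ver

theorem extRow_val (D : Grid n) (i : Fin n) : extRow D i = natRow (D i) := by simp [extRow]

theorem IsMBPD.extRow_vertical {D : Grid n} (hD : IsMBPD D) (i : Fin n) (j : ℕ) :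
    (extRow D i j).down = (extRow D (i + 1) j).up := by
  have hi := i.2
  rw [extRow_val]
  by_cases h : (i : ℕ) + 1 < n
  · have := extRow_val D ⟨i + 1, h⟩
    simp only at this
    rw [this]
    exact natRow_down_eq_up (fun j => hD.vertical i ⟨i + 1, h⟩ j rfl) j
  · rw [extRow, dif_neg h]
    exact natRow_down_eq_up (fun j => by rw [hD.bottom_border i j (by omega)]; rfl) j

theorem IsMBPD.trace_induction {D : Grid n} (hD : IsMBPD D) :
    Labels (extRow D n) n (gridWord D n id) (trace true D) ∧ Agree (trace true D) (trace false D) ∧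
      (trace false D).crossings.length = ∑ i : Fin n, plusFrom n (natRow (D i)) 0 := by
  have key := foldl_finRange_induction
    (fun m (S S' : PipeState n) => m ≤ n → Labels (extRow D m) n (gridWord D m id) S ∧
      Agree S S' ∧ S'.crossings.length = ∑ i ∈ Finset.range m, plusFrom n (extRow D i) 0)
    (PipeState.row true D) (PipeState.row false D)
    (s := ⟨fun _ => none, none, []⟩) (t := ⟨fun _ => none, none, []⟩)
    (fun _ => ?_) (fun i S S' hS _ => ?_)
  · obtain ⟨h1, h2, h3⟩ := key le_rfl
    refine ⟨h1, h2, ?_⟩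
    rw [trace, h3, Finset.sum_range]
    simp only [extRow_val]
  · refine ⟨⟨fun _ _ h => h, fun k => ?_, fun p q a b hab ha hb => ?_, List.nodup_nil, ?_⟩,
      ⟨fun _ => rfl, rfl, .inl rfl⟩, by simp⟩
    · have hk := k.2
      have : (extRow D 0 k).up = false := by
        have := extRow_val D ⟨0, by omega⟩
        simp only at this
        rw [this, natRow_val]
        exact hD.top_border _ _ rfl
      rw [belowVal, if_neg (by omega), this]
      simp
    · simp only [gridWord] at ha hb
      change a = p at ha
      change b = q at hb
      simp only [List.not_mem_nil, false_iff, Fin.lt_def]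
      omega
    · rw [List.length_nil, eq_comm, invCount, Finset.card_eq_zero, Finset.filter_eq_empty_iff]
      rintro ⟨p, q⟩ -
      simp only [gridWord, not_and, not_lt, Fin.lt_def]
      exact fun h => le_of_lt h
  · obtain ⟨h1, h2, h3⟩ := hS i.2.le
    have hi := i.2
    have hx := (hD.rowValid i).natRow (by omega)
    -- The rows above only permute positions below i, so pipe i enters with its own label.
    have hv : gridWord D i id i = i := by
      rcases Nat.eq_zero_or_pos (i : ℕ) with h | h
      · rw [h]; rfl
      · exact (hD.supported_gridWord hi.le).apply_of_lt (by omega) id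
    rw [extRow_val] at h1
    obtain ⟨h4, h5, h6⟩ := row_induction hx (natRow_val _)
      (by rw [natRow_of_le _ le_rfl]; rfl) (hD.upCount_eq i) hv h1 h2
    refine ⟨?_, h5, by rw [h6, h3, Finset.sum_range_succ, extRow_val]⟩
    rw [gridWord_succ]
    refine ⟨h4.injective, fun k => ?_, h4.crossed, h4.nodup, h4.length⟩
    rw [h4.below]
    have hk := k.2
    have hvt := hD.extRow_vertical i
    rw [belowVal, if_pos (Nat.zero_le _), belowVal, if_neg (not_le.2 hk), ← hvt]
    rw [extRow_val] at hvt ⊢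
    rw [hx.upCount_next hvt]
    rfl


/-! ### Counting tiles, and reducedness -/

theorem upCount_eq_sum (x : ℕ → Tile) (m : ℕ) :
    upCount x m = ∑ j ∈ Finset.range m, (x j).up.toNat := by
  induction m with
  | zero => rfl
  | succ m ih =>
    rw [upCount, ih, Finset.sum_range_succ]
    cases (x m).up <;> rfl

theorem IsMBPD.below_trace {D : Grid n} (hD : IsMBPD D) (k : Fin n) :
    ((trace true D).below k).map Fin.val = some (gridWord D n id k) := by
  have hk := k.2
  have hx : ∀ j : ℕ, j < n → extRow D n j = ver := fun j hj => by simp [extRow, natRow, hj]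
  have hu : upCount (extRow D n) k = k := by
    rw [upCount_eq_sum]
    rw [Finset.sum_congr rfl fun j hj => by rw [hx j ((Finset.mem_range.1 hj).trans hk)]]
    simp [Tile.up]
  rw [hD.trace_induction.1.below, belowVal, if_neg (not_le.2 hk), hx k hk, hu]
  rfl

/-- The number of tiles of a given kind. -/
def tileCount (D : Grid n) (t : Tile) : ℕ := ∑ i, ∑ j, if D i j = t then 1 else 0

theorem plusFrom_natRow (x : Fin n → Tile) :
    plusFrom n (natRow x) 0 = ∑ j, if x j = plus then 1 else 0 := by
  rw [plusFrom, Finset.card_filter, Nat.Ico_zero_eq_range, Finset.sum_range]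
  simp only [natRow_val]

/-- Inversions of the final list count the crossings that are not ignored, while every plus is a
crossing when none is ignored. The two numbers agree exactly if no crossing is repeated. -/
theorem IsMBPD.crossings_facts {D : Grid n} (hD : IsMBPD D) :
    invCount n (gridWord D n id) ≤ tileCount D plus ∧
      (IsReduced D ↔ invCount n (gridWord D n id) = tileCount D plus) := by
  obtain ⟨h1, h2, h3⟩ := hD.trace_induction
  simp only [plusFrom_natRow] at h3
  rw [tileCount, ← h3, ← h1.length, IsReduced]
  rcases h2.eq_or with h | ⟨h4, h5⟩
  · rw [← h]
    exact ⟨le_rfl, by simpa using h1.nodup⟩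
  · exact ⟨h5.le, by simp [h4, h5.ne]⟩

theorem IsMBPD.sum_up {D : Grid n} (hD : IsMBPD D) (i : Fin n) : ∑ j, (D i j).up.toNat = i := by
  rw [← hD.upCount_eq i, upCount_eq_sum, Finset.sum_range]
  simp only [natRow_val]

theorem IsMBPD.sum_down {D : Grid n} (hD : IsMBPD D) (i : Fin n) :
    ∑ j, (D i j).down.toNat = i + 1 := by
  have hvt := hD.extRow_vertical i
  have h1 := ((hD.rowValid i).natRow i.pos).upCount_next
    (y := extRow D (i + 1)) (by rwa [extRow_val] at hvt) n
  rw [hD.upCount_eq, natRow_of_le _ le_rfl, upCount_eq_sum, Finset.sum_range] at h1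
  simp only [← hvt, extRow_val, natRow_val] at h1
  rw [h1]
  rfl

/-- Reflection in the main diagonal. -/
def Tile.transpose : Tile → Tile
  | hor => ver
  | ver => hor
  | t => t

theorem IsMBPD.transpose {D : Grid n} (hD : IsMBPD D) :
    IsMBPD fun i j => (D j i).transpose := by
  have e1 : ∀ t : Tile, t.transpose.right = t.down := by rintro ⟨⟩ <;> rfl
  have e2 : ∀ t : Tile, t.transpose.down = t.right := by rintro ⟨⟩ <;> rfl
  have e3 : ∀ t : Tile, t.transpose.left = t.up := by rintro ⟨⟩ <;> rfl
  have e4 : ∀ t : Tile, t.transpose.up = t.left := by rintro ⟨⟩ <;> rfl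
  refine ⟨?_, ?_, ?_, ?_, ?_, ?_⟩ <;> simp only [e1, e2, e3, e4]
  · exact fun i j => hD.bottom_border j i
  · exact fun i j => hD.top_border j i
  · exact fun i j => hD.right_border j i
  · exact fun i j => hD.left_border j i
  · exact fun i j k => hD.vertical j k i
  · exact fun i j k => hD.horizontal k i j

/-- For each tile, [plus] + 1 = [blank] + [connects up] + [connects right]. With indices starting
from 0, row i has i upward edges and, by transposition, column j has j + 1 edges to the right; these
total n², the number of tiles. -/
theorem IsMBPD.tileCount_plus {D : Grid n} (hD : IsMBPD D) :
    tileCount D plus = tileCount D blank := by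
  have e2 : ∀ t : Tile, t.transpose.down = t.right := by rintro ⟨⟩ <;> rfl
  have h1 : ∀ i j, (if D i j = plus then 1 else 0) + 1 =
      (if D i j = blank then 1 else 0) + ((D i j).up.toNat + (D i j).right.toNat) := fun i j => by
    cases D i j <;> rfl
  have h2 : ∑ i, ∑ j, (D i j).right.toNat = ∑ j : Fin n, ((j : ℕ) + 1) := by
    rw [Finset.sum_comm]
    refine Finset.sum_congr rfl fun j _ => ?_
    rw [← hD.transpose.sum_down j]
    simp only [e2]
  have h3 := Finset.sum_congr rfl fun i (_ : i ∈ Finset.univ) =>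
    Finset.sum_congr rfl fun j (_ : j ∈ Finset.univ) => h1 i j
  have h4 : ∀ m : ℕ, ∑ i : Fin m, (i : ℕ) + ∑ i : Fin m, ((i : ℕ) + 1) = m * m := fun m => by
    induction m with
    | zero => simp
    | succ m ih =>
      rw [Fin.sum_univ_castSucc, Fin.sum_univ_castSucc (f := fun i : Fin (m + 1) => (i : ℕ) + 1)]
      simp only [Fin.val_castSucc, Fin.val_last]
      linarith
  simp only [Finset.sum_add_distrib, h2, hD.sum_up] at h3
  simp only [Finset.sum_const, Finset.card_univ, Fintype.card_fin, smul_eq_mul, mul_one] at h3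
  have := h4 n
  simp only [Finset.sum_add_distrib, Finset.sum_const, Finset.card_univ, Fintype.card_fin,
    smul_eq_mul, mul_one] at this
  rw [tileCount, tileCount]
  omega

theorem sum_gridWeight (D : Grid n) :
    ∑ i, gridWeight D i = tileCount D blank + tileCount D mjt := by
  rw [tileCount, tileCount, ← Finset.sum_add_distrib]
  refine Finset.sum_congr rfl fun i _ => ?_
  rw [gridWeight, Finset.card_filter, ← Finset.sum_add_distrib]
  refine Finset.sum_congr rfl fun j _ => ?_
  cases D i j <;> rfl

theorem isUnmarked_iff {D : Grid n} : IsUnmarked D ↔ tileCount D mjt = 0 := by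
  simp [IsUnmarked, tileCount]

/-! ### Permutations as sequences -/

/-- The sequence of the preimages of `0, 1, …` -/
def seqOf (w : Equiv.Perm (Fin n)) (p : ℕ) : ℕ := if h : p < n then w⁻¹ ⟨p, h⟩ else p

theorem seqOf_val (w : Equiv.Perm (Fin n)) (p : Fin n) : seqOf w p = w⁻¹ p := by simp [seqOf]

theorem seqOf_one : seqOf (1 : Equiv.Perm (Fin n)) = id := by
  funext p
  simp [seqOf]

theorem permLength_eq (w : Equiv.Perm (Fin n)) : permLength w = invCount n (seqOf w) := by
  refine Finset.card_bijective (fun p => (w p.2, w p.1)) ?_ ?_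
  · exact ((Equiv.prodComm _ _).trans (w.prodCongr w)).bijective
  · rintro ⟨p, q⟩
    simp [seqOf_val, and_comm]

theorem simpleRefl_of_lt {a : Fin n} (ha : (a : ℕ) + 1 < n) :
    simpleRefl a = Equiv.swap a ⟨a + 1, ha⟩ := dif_pos ha

theorem seqOf_injective (w : Equiv.Perm (Fin n)) : (seqOf w).Injective := by
  intro p q h
  simp only [seqOf] at h
  split_ifs at h with h1 h2 h2
  · simpa using w⁻¹.injective (Fin.ext h)
  · have := (w⁻¹ ⟨p, h1⟩).2; omega
  · have := (w⁻¹ ⟨q, h2⟩).2; omega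
  · exact h

/-- Taking preimages turns left multiplication into an action on positions, which is how `sortAt`
acts. -/
theorem seqOf_simpleRefl_mul {a : Fin n} (ha : (a : ℕ) + 1 < n) (w : Equiv.Perm (Fin n)) :
    seqOf (simpleRefl a * w) = seqOf w ∘ Equiv.swap (a : ℕ) (a + 1) := by
  funext p
  rw [simpleRefl_of_lt ha]
  simp only [seqOf, mul_inv_rev, Equiv.swap_inv, Function.comp]
  by_cases hp : p < n
  · have : Equiv.swap (a : ℕ) (a + 1) p < n := by
      rw [Equiv.swap_apply_def]; split_ifs <;> omega
    rw [dif_pos hp, dif_pos this, Equiv.Perm.mul_apply]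
    congr 2
    simp only [Equiv.swap_apply_def, Fin.ext_iff]
    split_ifs <;> rfl
  · have : Equiv.swap (a : ℕ) (a + 1) p = p := Equiv.swap_apply_of_ne_of_ne (by omega) (by omega)
    rw [this, dif_neg hp, dif_neg hp]

theorem permLength_simpleRefl_mul {a : Fin n} (ha : (a : ℕ) + 1 < n) (w : Equiv.Perm (Fin n)) :
    (seqOf w a < seqOf w (a + 1) ∧ permLength (simpleRefl a * w) = permLength w + 1 ∧
      seqOf (simpleRefl a * w) = sortAt a (seqOf w)) ∨
    (seqOf w (a + 1) < seqOf w a ∧ permLength w = permLength (simpleRefl a * w) + 1) := by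
  rcases lt_or_gt_of_ne ((seqOf_injective w).ne (by omega : (a : ℕ) ≠ a + 1)) with h | h
  · have e := (seqOf_simpleRefl_mul ha w).trans (sortAt_of_lt h).symm
    refine .inl ⟨h, ?_, e⟩
    rw [permLength_eq, permLength_eq, e, invCount_sortAt h ha]
  · refine .inr ⟨h, ?_⟩
    have e := seqOf_simpleRefl_mul ha w
    have h' : seqOf (simpleRefl a * w) a < seqOf (simpleRefl a * w) (a + 1) := by
      simpa [e] using h
    have e' : seqOf w = sortAt a (seqOf (simpleRefl a * w)) := by
      rw [sortAt_of_lt h', e]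
      funext p
      simp
    rw [permLength_eq, permLength_eq, ← invCount_sortAt h' ha, ← e']

theorem seqOf_demazureMul {a : Fin n} (ha : (a : ℕ) + 1 < n) (w : Equiv.Perm (Fin n)) :
    seqOf (demazureMul a w) = sortAt a (seqOf w) := by
  rw [demazureMul]
  rcases permLength_simpleRefl_mul ha w with ⟨-, h2, h3⟩ | ⟨h1, h2⟩
  · rw [if_pos (by omega), h3]
  · rw [if_neg (by omega), sortAt_of_le h1.le]

/-- Letting the biletters of `B` act on a sequence. -/
def pairSeq (B : List (Fin n × Fin n)) (v : ℕ → ℕ) : ℕ → ℕ := B.foldl (fun v p => sortAt p.2 v) v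

theorem seqOf_pairPerm {B : List (Fin n × Fin n)} (hB : ∀ p ∈ B, IsBiletter p) :
    seqOf (pairPerm B) = pairSeq B id := by
  rw [← seqOf_one (n := n), pairPerm, pairSeq]
  generalize (1 : Equiv.Perm (Fin n)) = w
  induction B generalizing w with
  | nil => rfl
  | cons p B ih =>
    rw [List.foldl_cons, List.foldl_cons, ← seqOf_demazureMul (hB p (by simp)).2]
    exact ih (fun q hq => hB q (by simp [hq])) _

/-- The ordinary product u and the Demazure product w agree as long as every letter increases the
length. From the first failure on, both lengths stay strictly below the number k of letters used, so
neither can reach the full length. -/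
theorem isReducedPair_iff {B : List (Fin n × Fin n)} (hB : ∀ p ∈ B, IsBiletter p) :
    IsReducedPair B ↔ permLength (pairPerm B) = B.length := by
  suffices h : ∀ (w u : Equiv.Perm (Fin n)) (k : ℕ), permLength w ≤ k →
      w = u ∨ permLength w < k ∧ permLength u < k →
      (permLength ((B.reverse.map fun p => simpleRefl p.2).prod * u) = k + B.length ↔
        permLength (B.foldl (fun w p => demazureMul p.2 w) w) = k + B.length) by
    have h0 : permLength (1 : Equiv.Perm (Fin n)) = 0 := by
      rw [permLength, Finset.card_eq_zero, Finset.filter_eq_empty_iff]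
      exact fun p _ hp => lt_asymm hp.1 hp.2
    simpa [pairPerm, IsReducedPair] using h 1 1 0 h0.le (.inl rfl)
  induction B with
  | nil =>
    rintro w u k - (rfl | ⟨h1, h2⟩)
    · simp
    · simp [h1.ne, h2.ne]
  | cons p B ih =>
    intro w u k hk h
    have hp := (hB p (by simp)).2
    rw [List.foldl_cons, List.reverse_cons, List.map_append, List.prod_append, List.map_singleton,
      List.prod_singleton, mul_assoc, List.length_cons, ← add_assoc, add_right_comm]
    have h1 := permLength_simpleRefl_mul hp w
    have h2 := permLength_simpleRefl_mul hp u
    refine ih (fun q hq => hB q (by simp [hq])) _ _ _ ?_ ?_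
    · rw [demazureMul]
      split_ifs <;> omega
    · rw [demazureMul]
      rcases h with rfl | h
      · split_ifs with h3
        · exact .inl rfl
        · exact .inr (by omega)
      · split_ifs with h3 <;> exact .inr (by omega)


/-! ### The identity grid -/

theorem isMBPD_idGrid : IsMBPD (idGrid n) := by
  refine ⟨fun i j h => ?_, fun i j h => ?_, fun i j h => ?_, fun i j h => ?_, fun i j k h => ?_,
    fun i k j h => ?_⟩ <;>
  simp only [idGrid, Fin.ext_iff, Fin.lt_def] <;> split_ifs <;>
    first
    | rfl
    | omega

/-- A light tile lacking an upper or a left edge is determined by these two edges. Starting at the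
top left corner, the borders and the tiles already found force this situation everywhere. -/
theorem eq_idGrid {D : Grid n} (hD : IsMBPD D) (hl : ∀ i j, (D i j).heavy = false) :
    D = idGrid n := by
  have key : ∀ (i j : Fin n), ((D i j).up = decide (j < i)) → ((D i j).left = decide (i < j)) →
      D i j = idGrid n i j := by
    intro i j h1 h2
    have h3 := hl i j
    rcases lt_trichotomy i j with h | h | h
    · rw [idGrid, if_neg h.ne, if_pos h]
      have e1 : (D i j).up = false := by rw [h1]; simpa using h.le
      have e2 : (D i j).left = true := by rw [h2]; simpa using h
      revert e1 e2 h3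
      cases D i j <;> simp [Tile.up, Tile.left, Tile.heavy]
    · rw [idGrid, if_pos h]
      have e1 : (D i j).up = false := by rw [h1]; simpa using h.le
      have e2 : (D i j).left = false := by rw [h2]; simpa using h.ge
      revert e1 e2 h3
      cases D i j <;> simp [Tile.up, Tile.left, Tile.heavy]
    · rw [idGrid, if_neg h.ne', if_neg h.asymm]
      have e1 : (D i j).up = true := by rw [h1]; simpa using h
      have e2 : (D i j).left = false := by rw [h2]; simpa using h.le
      revert e1 e2 h3
      cases D i j <;> simp [Tile.up, Tile.left, Tile.heavy]
  suffices h : ∀ a b (hi : a < n) (hj : b < n), D ⟨a, hi⟩ ⟨b, hj⟩ = idGrid n ⟨a, hi⟩ ⟨b, hj⟩ from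
    funext fun i => funext fun j => h i j i.2 j.2
  intro a
  induction a with
  | zero =>
    intro b
    induction b with
    | zero =>
      refine fun hi hj => key _ _ ?_ ?_
      · simp [hD.top_border ⟨0, hi⟩ ⟨0, hj⟩ rfl]
      · simp [hD.left_border ⟨0, hi⟩ ⟨0, hj⟩ rfl]
    | succ b ih =>
      refine fun hi hj => key _ _ ?_ ?_
      · simp [hD.top_border ⟨0, hi⟩ ⟨b + 1, hj⟩ rfl]
      · rw [← hD.horizontal ⟨0, hi⟩ ⟨b, by omega⟩ ⟨b + 1, hj⟩ rfl, ih hi (by omega)]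
        simp only [idGrid, Fin.ext_iff, Fin.lt_def]
        split_ifs <;> simp [Tile.right] <;> omega
  | succ a iha =>
    have hup : ∀ b (hi : a + 1 < n) (hj : b < n),
        (D ⟨a + 1, hi⟩ ⟨b, hj⟩).up = decide ((⟨b, hj⟩ : Fin n) < ⟨a + 1, hi⟩) := fun b hi hj => by
      rw [← hD.vertical ⟨a, by omega⟩ ⟨a + 1, hi⟩ ⟨b, hj⟩ rfl, iha b (by omega) hj]
      simp only [idGrid, Fin.ext_iff, Fin.lt_def]
      split_ifs <;> simp [Tile.down] <;> omega
    intro b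
    induction b with
    | zero =>
      refine fun hi hj => key _ _ (hup _ _ _) ?_
      simp [hD.left_border ⟨a + 1, hi⟩ ⟨0, hj⟩ rfl]
    | succ b ih =>
      refine fun hi hj => key _ _ (hup _ _ _) ?_
      rw [← hD.horizontal ⟨a + 1, hi⟩ ⟨b, by omega⟩ ⟨b + 1, hj⟩ rfl, ih hi (by omega)]
      simp only [idGrid, Fin.ext_iff, Fin.lt_def]
      split_ifs <;> simp [Tile.right] <;> omega

/-! ### Determinism -/

theorem Window.not_jt_right {x y : Fin n → Tile} {c c' : Fin n} (h : Window x y c c' True) (j : Fin n)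
    (hj : c < j) : y j ≠ jt := by
  have h1 := h.seg j hj
  have h2 := h.last
  simp only [not_true_eq_false, false_and, true_and, false_or] at h2
  have h3 := h2.2.2 j
  rcases lt_trichotomy j c' with h | h | h <;> grind

theorem GridMove.star_unique {D D₁ D₂ : Grid n} {r s s₂ c c' c₂ c₂' : Fin n}
    (h₁ : GridMove D D₁ r s c c' True) (h₂ : GridMove D D₂ r s₂ c₂ c₂' False) : False := by
  obtain rfl := next_row_unique h₁.next_row h₂.next_row
  have w₁ := h₁.rows.window
  have w₂ := h₂.rows.window
  have hc : c = c₂ := by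
    have := w₁.rightmost c₂
    have := w₂.rightmost c
    have := w₁.heavy
    have := w₂.heavy
    rcases lt_trichotomy c c₂ with h | h | h <;> grind
  subst hc
  exact w₁.not_jt_right c₂' w₂.lt (by simpa using w₂.last)

theorem Peel.unique {D D₁ D₂ : Grid n} {i a b : Fin n} (hD : IsMBPD D) (h₁ : Peel D i a D₁)
    (h₂ : Peel D i b D₂) : a = b ∧ D₁ = D₂ := by
  induction h₁ with
  | star h =>
    cases h₂ with
    | star h' => exact ⟨rfl, h.unique hD h'⟩
    | step h' _ => exact (h.star_unique h').elim
  | step h _ ih =>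
    cases h₂ with
    | star h' => exact (h'.star_unique h).elim
    | step h' h'' =>
      obtain rfl := next_row_unique h.next_row h'.next_row
      obtain rfl := h.unique hD h'
      exact ih (h.isMBPD_iff.1 hD) h''

theorem Peel.source_unique {D D₁ D₂ : Grid n} {i a : Fin n} (hD : IsMBPD D) (h₁ : Peel D₁ i a D)
    (h₂ : Peel D₂ i a D) : D₁ = D₂ := by
  induction h₁ generalizing D₂ with
  | star h =>
    cases h₂ with
    | star h' => exact h.source_unique hD h'
    | step h' h'' =>
      have := h'.next_row
      have := Fin.le_def.1 h''.le
      omega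
  | step h hp ih =>
    cases h₂ with
    | star h' =>
      have := h.next_row
      have := Fin.le_def.1 hp.le
      omega
    | step h' h'' =>
      obtain rfl := next_row_unique h.next_row h'.next_row
      obtain rfl := ih hD h''
      exact h.source_unique (hp.isMBPD_iff.2 hD) h'

/-! ### Iterated peeling -/

/-- Peeling off the biletters of `B` leads from `D` to the identity grid. -/
inductive Peels : Grid n → List (Fin n × Fin n) → Prop
  | nil : Peels (idGrid n) []
  | cons {D D' : Grid n} {i a : Fin n} {B : List (Fin n × Fin n)} :
      Peel D i a D' → Peels D' B → Peels D ((i, a) :: B)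

theorem Peels.exists_peel {D : Grid n} {i a : Fin n} {B : List (Fin n × Fin n)}
    (h : Peels D ((i, a) :: B)) : ∃ D', Peel D i a D' ∧ Peels D' B := by
  cases h with
  | cons h h' => exact ⟨_, h, h'⟩

theorem Peels.isMBPD {D : Grid n} {B : List (Fin n × Fin n)} (h : Peels D B) : IsMBPD D := by
  induction h with
  | nil => exact isMBPD_idGrid
  | cons h _ ih => exact h.isMBPD_iff.2 ih

theorem Peels.isBiletter {D : Grid n} {B : List (Fin n × Fin n)} (h : Peels D B) :
    ∀ p ∈ B, IsBiletter p := by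
  induction h with
  | nil => simp
  | cons h _ ih => exact List.forall_mem_cons.2 ⟨⟨h.le, h.succ_lt⟩, ih⟩

theorem gridWeight_idGrid (i : Fin n) : gridWeight (idGrid n) i = 0 := by
  refine gridWeight_eq_zero.2 fun j => ?_
  rw [idGrid]
  split_ifs <;> rfl

theorem Peels.weight {D : Grid n} {B : List (Fin n × Fin n)} (h : Peels D B) (k : Fin n) :
    gridWeight D k = pairWeight B k := by
  induction h with
  | nil => simpa [pairWeight] using gridWeight_idGrid k
  | cons h _ ih =>
    rw [h.weight, ih, pairWeight, pairWeight, List.countP_cons]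
    simp [eq_comm]

theorem Peels.length {D : Grid n} {B : List (Fin n × Fin n)} (h : Peels D B) :
    B.length = ∑ i, gridWeight D i := by
  induction h with
  | nil => simp [gridWeight_idGrid]
  | cons h _ ih => simp [h.weight, Finset.sum_add_distrib, ih]

theorem Peels.gridWord {D : Grid n} {B : List (Fin n × Fin n)} (h : Peels D B) (v : ℕ → ℕ) :
    gridWord D n v = pairSeq B v := by
  induction h generalizing v with
  | nil =>
    rw [gridWord_of_ne_plus (fun i j => ?_) le_rfl]
    · rfl
    · rw [idGrid]
      split_ifs <;> simp
  | cons h hB ih =>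
    rw [h.gridWord (h.isMBPD_iff.2 hB.isMBPD)]
    exact ih _

theorem Peels.unique {D₁ D₂ : Grid n} {B : List (Fin n × Fin n)} (h₁ : Peels D₁ B)
    (h₂ : Peels D₂ B) : D₁ = D₂ := by
  induction h₁ generalizing D₂ with
  | nil => cases h₂; rfl
  | cons h hB ih =>
    cases h₂ with
    | cons h' hB' =>
      obtain rfl := ih hB'
      exact h.source_unique hB.isMBPD h'

theorem Peels.lightBelow {D : Grid n} {B : List (Fin n × Fin n)} {i a : Fin n} (h : Peels D B)
    (hB : ∀ p ∈ B, BiletterGT (i, a) p) : LightBelow D i := by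
  intro j hj
  rw [h.weight, pairWeight, List.countP_eq_zero]
  intro p hp
  rcases hB p hp with h | ⟨h, -⟩
  · simpa using (h.trans hj).ne
  · simpa [← (show i = p.1 from h)] using hj.ne

theorem BiletterGT.trans {p q r : Fin n × Fin n} (h : BiletterGT p q) (h' : BiletterGT q r) :
    BiletterGT p r := by
  unfold BiletterGT at *
  grind

/-! ### The recursions -/

theorem isMaxHeavy_iff {D : Grid n} {i c : Fin n} : IsMaxHeavy D i c ↔
    (D i c).heavy = true ∧ (∀ j, c < j → (D i j).heavy = false) ∧ LightBelow D i := by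
  simp only [IsMaxHeavy, LightBelow, gridWeight_eq_zero]
  constructor
  · rintro ⟨h1, h2⟩
    refine ⟨h1, fun j hj => ?_, fun k hk j => ?_⟩
    · have := h2 i j
      grind
    · have := h2 k j
      grind
  · rintro ⟨h1, h2, h3⟩
    refine ⟨h1, fun k j hkj => ?_⟩
    have := h2 j
    have := h3 k
    rcases lt_trichotomy k i with h | h | h
    · exact .inl h
    · refine .inr ⟨h, ?_⟩
      subst h
      by_contra hc
      have := h2 j (not_le.1 hc)
      simp [this] at hkj
    · have := h3 k h j
      simp [this] at hkj

theorem GridMove.isMaxHeavy {D D' : Grid n} {r s c c' : Fin n} {star : Prop}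
    (h : GridMove D D' r s c c' star) (hl : LightBelow D r) : IsMaxHeavy D r c :=
  isMaxHeavy_iff.2 ⟨h.rows.window.heavy, h.rows.window.rightmost, hl⟩

theorem PhiRel.peels {D : MBPD n} {B : List (Fin n × Fin n)} (h : PhiRel D B) :
    Peels D.1 B ∧ B.Pairwise BiletterGT := by
  have key : ∀ {D D' : Grid n} {i a : Fin n} {B : List (Fin n × Fin n)}, Peel D i a D' →
      LightBelow D i → Peels D' B → B.Pairwise BiletterGT →
      ((i, a) :: B).Pairwise BiletterGT := by
    intro D D' i a B h1 hl h2 h3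
    refine List.pairwise_cons.2 ⟨fun p hp => ?_, h3⟩
    -- It suffices to compare with the next biletter. Its row is not below i, as everything there is
    -- light; in row i itself, `Peel.lt_of_peel` applies.
    have hhead : ∀ q ∈ B.head?, BiletterGT (i, a) q := by
      cases h2 with
      | nil => simp
      | @cons _ D'' j b B h4 h5 =>
        intro q hq
        obtain rfl : q = (j, b) := by simpa [eq_comm] using hq
        have h6 := h4.weight j
        have h7 := h1.lightBelow_iff.1 hl j
        rcases lt_trichotomy j i with h | rfl | h
        · exact .inl h
        · exact .inr ⟨rfl, h1.lt_of_peel (h1.isMBPD_iff.2 (h4.isMBPD_iff.2 h5.isMBPD)) hl h4⟩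
        · simp [h7 h] at h6
    cases B with
    | nil => simp at hp
    | cons q B =>
      rcases List.mem_cons.1 hp with rfl | hp
      · exact hhead _ (by simp)
      · exact (hhead q (by simp)).trans ((List.pairwise_cons.1 h3).1 p hp)
  induction h with
  | nil D h => exact ⟨h ▸ .nil, .nil⟩
  | terminal D D' i c B h1 h2 _ ih =>
    obtain ⟨s, c', h3⟩ := (isfStarMove_iff D.2 D'.2).1 h2
    exact ⟨.cons (.star h3) ih.1, key (.star h3) (isMaxHeavy_iff.1 h1).2.2 ih.1 ih.2⟩
  | nonterminal D D' i i' c a B h1 h2 h3 _ ih =>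
    obtain ⟨s, c', h4⟩ := (isfMove_iff D.2 D'.2).1 h2
    obtain rfl := next_row_unique h4.next_row h3
    obtain ⟨ih1, ih2⟩ := ih
    obtain ⟨D'', h5, h6⟩ := ih1.exists_peel
    exact ⟨.cons (.step h4 h5) h6,
      key (.step h4 h5) (isMaxHeavy_iff.1 h1).2.2 h6 (List.pairwise_cons.1 ih2).2⟩

theorem Peel.phiRel {D D' : Grid n} {i a : Fin n} (h : Peel D i a D') (hD : IsMBPD D)
    (hD' : IsMBPD D') (hl : LightBelow D i) {B : List (Fin n × Fin n)}
    (hB : PhiRel ⟨D', hD'⟩ B) : PhiRel ⟨D, hD⟩ ((i, a) :: B) := by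
  induction h with
  | star h =>
    exact .terminal _ ⟨_, hD'⟩ _ _ _ (h.isMaxHeavy hl) ((isfStarMove_iff hD hD').2 ⟨_, _, h⟩) hB
  | step h _ ih =>
    have hD₁ := h.isMBPD_iff.1 hD
    have hs := h.next_row
    refine .nonterminal _ ⟨_, hD₁⟩ _ _ _ _ _ (h.isMaxHeavy hl)
      ((isfMove_iff hD hD₁).2 ⟨_, _, h⟩) hs (ih hD₁ hD' ?_ hB)
    exact h.lightBelow_iff.1 (hl.mono (by rw [Fin.le_def]; omega))

theorem phiRel_iff {D : MBPD n} {B : List (Fin n × Fin n)} :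
    PhiRel D B ↔ Peels D.1 B ∧ B.Pairwise BiletterGT := by
  refine ⟨PhiRel.peels, fun ⟨h, hB⟩ => ?_⟩
  obtain ⟨D, hD⟩ := D
  simp only at h
  induction h with
  | nil => exact .nil _ rfl
  | cons h h' ih =>
    obtain ⟨h1, h2⟩ := List.pairwise_cons.1 hB
    exact h.phiRel hD h'.isMBPD (h.lightBelow_iff.2 (h'.lightBelow h1)) (ih h2 h'.isMBPD ⟨h', h2⟩)

theorem Peel.psiRel {D D' : Grid n} {i a : Fin n} (h : Peel D i a D') (hD : IsMBPD D)
    (hD' : IsMBPD D') {B : List (Fin n × Fin n)} (hB : PsiRel B ⟨D', hD'⟩) :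
    PsiRel ((i, a) :: B) ⟨D, hD⟩ := by
  induction h with
  | star h => exact .star ⟨_, hD'⟩ _ _ _ hB ((iseStarMove_iff hD hD').2 ⟨_, _, _, h⟩)
  | step h hp ih =>
    have hD₁ := h.isMBPD_iff.1 hD
    have hs := h.next_row
    have := Fin.le_def.1 hp.le
    exact .move ⟨_, hD₁⟩ _ _ _ _ _ hs (by rw [Fin.lt_def]; omega) (ih hD₁ hD' hB)
      ((iseMove_iff hD hD₁).2 ⟨_, _, _, h⟩)

/-- No order condition is needed: the order of the biletters only matters for the existence of the
E-moves. -/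
theorem psiRel_iff {D : MBPD n} {B : List (Fin n × Fin n)} : PsiRel B D ↔ Peels D.1 B := by
  constructor
  · intro h
    induction h with
    | nil D h => exact h ▸ .nil
    | star D' D i B _ h ih =>
      obtain ⟨s, c, c', h1⟩ := (iseStarMove_iff D.2 D'.2).1 h
      exact .cons (.star h1) ih
    | move D' D i i' a B h1 h2 _ h3 ih =>
      obtain ⟨s, c, c', h4⟩ := (iseMove_iff D.2 D'.2).1 h3
      obtain rfl := next_row_unique h4.next_row h1
      obtain ⟨D'', h5, h6⟩ := ih.exists_peel
      exact .cons (.step h4 h5) h6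
  · obtain ⟨D, hD⟩ := D
    intro h
    simp only at h
    induction h with
    | nil => exact .nil _ rfl
    | cons h h' ih => exact h.psiRel hD h'.isMBPD (ih h'.isMBPD)

/-! ### Existence -/

/-- The row below the rightmost heavy tile is light. If it has a J further right, an f-move lowers
the heavy tile and the argument repeats; otherwise an f*-move ends the peel. The bottom border keeps
heavy tiles out of the last row, so this terminates. -/
theorem exists_peel_of_lightBelow {D : Grid n} {i : Fin n} (hD : IsMBPD D) (hl : LightBelow D i)
    (hi : gridWeight D i ≠ 0) : ∃ a D', Peel D i a D' := by
  obtain ⟨m, hm⟩ : ∃ m, m = n - i := ⟨_, rfl⟩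
  induction m using Nat.strong_induction_on generalizing D i with | _ m ih
  have hin := i.2
  obtain ⟨k, hk⟩ := exists_heavy_of_weight hi
  obtain ⟨c, -, hc, hmax⟩ := exists_max_heavy hk
  have hi1 : (i : ℕ) + 1 < n := by
    by_contra h
    have := hD.bottom_border i c (by omega)
    rw [Tile.down_of_heavy hc] at this
    simp at this
  have hs : ((⟨i + 1, hi1⟩ : Fin n) : ℕ) = i + 1 := rfl
  generalize (⟨i + 1, hi1⟩ : Fin n) = s at hs
  have his : i < s := by rw [Fin.lt_def]; omega
  have hli := gridWeight_eq_zero.1 (hl s his)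
  by_cases h : ∃ k, c < k ∧ D s k = jt
  · obtain ⟨k, h1, h2⟩ := h
    obtain ⟨D₁, c', h3, -, h4⟩ := exists_fMove hD hs hc hmax h1 h2 fun j _ => hli j
    obtain ⟨a, D', h5⟩ := ih (n - s) (by omega) h3 (h4.lightBelow_iff.1 (hl.mono his.le))
      (by rw [h4.weight_bot]; omega) rfl
    exact ⟨a, D', .step h4 h5⟩
  · push Not at h
    obtain ⟨D', c', -, h1⟩ := exists_fStarMove hD hs hc hmax h hli
    exact ⟨i, D', .star h1⟩

theorem exists_phiRel (D : MBPD n) : ∃ B, PhiRel D B := by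
  classical
  obtain ⟨D, hD⟩ := D
  obtain ⟨m, hm⟩ : ∃ m, m = ∑ i, gridWeight D i := ⟨_, rfl⟩
  induction m generalizing D with
  | zero =>
    refine ⟨[], .nil _ (eq_idGrid hD fun i => gridWeight_eq_zero.1 ?_)⟩
    exact (Finset.sum_eq_zero_iff.1 hm.symm) i (Finset.mem_univ i)
  | succ m ih =>
    obtain ⟨k, -, hk⟩ := Finset.exists_ne_zero_of_sum_ne_zero (by rw [← hm]; omega)
    obtain ⟨i, hi, hmax⟩ := (Finset.univ.filter fun i => gridWeight D i ≠ 0).exists_max_image id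
      ⟨k, by simpa using hk⟩
    simp only [Finset.mem_filter, Finset.mem_univ, true_and, id] at hi hmax
    have hl : LightBelow D i := fun j hj => by
      by_contra h
      exact absurd (hmax j h) (not_le.2 hj)
    obtain ⟨a, D', h⟩ := exists_peel_of_lightBelow hD hl hi
    have hD' := h.isMBPD_iff.1 hD
    obtain ⟨B, hB⟩ := ih D' hD' (by simp [h.weight, Finset.sum_add_distrib] at hm; omega)
    exact ⟨_, h.phiRel hD hD' hl hB⟩

theorem exists_peels {B : List (Fin n × Fin n)} (hb : ∀ p ∈ B, IsBiletter p)
    (hB : B.Pairwise BiletterGT) : ∃ D, Peels D B := by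
  induction B with
  | nil => exact ⟨_, .nil⟩
  | cons p B ih =>
    obtain ⟨i, a⟩ := p
    obtain ⟨h1, h2⟩ := List.pairwise_cons.1 hB
    obtain ⟨h3, h4⟩ := List.forall_mem_cons.1 hb
    obtain ⟨D', h5⟩ := ih h4 h2
    -- If row i is not light, the decreasing order forces the next biletter to be (i, b) with a < b,
    -- as `exists_peel` requires.
    obtain ⟨D, -, h6⟩ := exists_peel h5.isMBPD h3.1 h3.2 (h5.lightBelow h1) (by
      refine or_iff_not_imp_left.2 fun hw => ?_
      rw [h5.weight, pairWeight] at hw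
      obtain ⟨p, hp, hpi⟩ := List.countP_pos_iff.1 (Nat.pos_of_ne_zero hw)
      simp only [decide_eq_true_eq] at hpi
      cases h5 with
      | nil => simp at hp
      | @cons _ D'' j b B h7 h8 =>
        have hj : j = i := by
          have e1 := h1 (j, b) (by simp)
          rcases List.mem_cons.1 hp with rfl | hp
          · exact hpi
          · have e2 := (List.pairwise_cons.1 h2).1 p hp
            unfold BiletterGT at e1 e2
            grind
        subst hj
        have e1 := h1 (j, b) (by simp)
        refine ⟨b, D'', h7, ?_⟩
        unfold BiletterGT at e1
        grind)
    exact ⟨D, .cons h6 h5⟩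

/-- The first biletter is read off from D: strict decrease makes its row the lowest heavy one, and
the peel from there is deterministic. -/
theorem Peels.list_unique {D : Grid n} {B B' : List (Fin n × Fin n)} (h1 : Peels D B)
    (h2 : B.Pairwise BiletterGT) (h3 : Peels D B') (h4 : B'.Pairwise BiletterGT) : B = B' := by
  induction h1 generalizing B' with
  | nil =>
    have := h3.length
    simp only [gridWeight_idGrid, Finset.sum_const_zero, List.length_eq_zero_iff] at this
    exact this.symm
  | @cons D D' i a B h1 h1' ih =>
    cases h3 with
    | nil =>
      have := h1.weight i
      simp [gridWeight_idGrid] at this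
    | @cons _ D'' j b B' h3 h3' =>
      obtain ⟨e1, e2⟩ := List.pairwise_cons.1 h2
      obtain ⟨e3, e4⟩ := List.pairwise_cons.1 h4
      have l1 := h1.lightBelow_iff.2 (h1'.lightBelow e1)
      have l2 := h3.lightBelow_iff.2 (h3'.lightBelow e3)
      have w1 := h1.weight i
      have w2 := h3.weight j
      have hij : i = j := by
        rcases lt_trichotomy i j with h | h | h
        · have := l1 j h
          simp at w2
          omega
        · exact h
        · have := l2 i h
          simp at w1
          omega
      subst hij
      obtain ⟨rfl, rfl⟩ := h1.unique (h1.isMBPD_iff.2 h1'.isMBPD) h3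
      rw [ih e2 h3' e4]

/-! ### Permutations and reducedness -/

theorem Peels.hasPerm_iff {D : Grid n} {B : List (Fin n × Fin n)} (h : Peels D B)
    (w : Equiv.Perm (Fin n)) : HasPerm D w ↔ w = pairPerm B := by
  have key : ∀ i, (trace true D).below (w i) = some i ↔ (pairPerm B)⁻¹ (w i) = i := fun i => by
    rw [← (Option.map_injective Fin.val_injective).eq_iff, h.isMBPD.below_trace, h.gridWord,
      ← seqOf_pairPerm h.isBiletter, seqOf_val]
    simp [Fin.val_inj]
  rw [HasPerm, forall_congr' key, Equiv.ext_iff]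
  exact forall_congr' fun i => by rw [Equiv.Perm.inv_eq_iff_eq, eq_comm]

/-- The length of B equals the number of plus tiles plus the number of marked J's, and the number of
inversions is at most the former; equality of length and inversions therefore splits into the two
conditions on D. -/
theorem Peels.isReduced_iff {D : Grid n} {B : List (Fin n × Fin n)} (h : Peels D B) :
    IsUnmarked D ∧ IsReduced D ↔ IsReducedPair B := by
  obtain ⟨h1, h2⟩ := h.isMBPD.crossings_facts
  have h3 := h.length
  rw [sum_gridWeight, ← h.isMBPD.tileCount_plus] at h3
  rw [isReducedPair_iff h.isBiletter, permLength_eq, seqOf_pairPerm h.isBiletter, ← h.gridWord, h2,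
    isUnmarked_iff]
  omega

end BPD

theorem theorem1p1 (n : ℕ) :
    ∃ (Φ : BPD.MBPD n → BPD.RCP n) (Ψ : BPD.RCP n → BPD.MBPD n),
      -- the two iterations are well defined, and their outcomes are `Φ` and `Ψ`
      (∀ D L, BPD.PhiRel D L ↔ L = (Φ D).1) ∧
      (∀ B D, BPD.PsiRel B.1 D ↔ D = Ψ B) ∧
      -- mutually inverse
      Function.LeftInverse Ψ Φ ∧ Function.RightInverse Ψ Φ ∧
      -- weights
      (∀ D, BPD.pairWeight (Φ D).1 = BPD.gridWeight D.1) ∧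
      (∀ B, BPD.gridWeight (Ψ B).1 = BPD.pairWeight B.1) ∧
      -- associated permutations
      (∀ D w, BPD.HasPerm D.1 w ↔ w = BPD.pairPerm (Φ D).1) ∧
      (∀ B w, BPD.HasPerm (Ψ B).1 w ↔ w = BPD.pairPerm B.1) ∧
      -- restriction to the reduced case
      Set.BijOn Φ (BPD.reducedBPD n) (BPD.reducedRCP n) ∧
      Set.BijOn Ψ (BPD.reducedRCP n) (BPD.reducedBPD n) := by
  choose f hf using BPD.exists_phiRel (n := n)
  have hf' := fun D => BPD.phiRel_iff.1 (hf D)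
  choose g hg using fun B : BPD.RCP n => BPD.exists_peels B.2.1 B.2.2
  let Φ : BPD.MBPD n → BPD.RCP n := fun D => ⟨f D, (hf' D).1.isBiletter, (hf' D).2⟩
  let Ψ : BPD.RCP n → BPD.MBPD n := fun B => ⟨g B, (hg B).isMBPD⟩
  have hΦ : ∀ D, BPD.Peels D.1 (Φ D).1 := fun D => (hf' D).1
  have hΨ : ∀ B, BPD.Peels (Ψ B).1 B.1 := hg
  have h1 : ∀ D L, BPD.PhiRel D L ↔ L = (Φ D).1 := fun D L =>
    ⟨fun h => (BPD.phiRel_iff.1 h).1.list_unique (BPD.phiRel_iff.1 h).2 (hf' D).1 (hf' D).2,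
      fun h => h ▸ hf D⟩
  have h2 : Function.LeftInverse Ψ Φ := fun D => Subtype.ext ((hΨ (Φ D)).unique (hΦ D))
  -- The other composite only needs that B determines D. Here D must determine B, which is where
  -- strict decrease enters.
  have h3 : Function.RightInverse Ψ Φ := fun B =>
    Subtype.ext ((h1 _ _).1 (BPD.phiRel_iff.2 ⟨hΨ B, B.2.2⟩)).symm
  have h4 : Set.MapsTo Φ (BPD.reducedBPD n) (BPD.reducedRCP n) := fun D hD =>
    (hΦ D).isReduced_iff.1 hD
  have h5 : Set.MapsTo Ψ (BPD.reducedRCP n) (BPD.reducedBPD n) := fun B hB =>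
    (hΨ B).isReduced_iff.2 hB
  exact ⟨Φ, Ψ, h1, fun B D => BPD.psiRel_iff.trans
    ⟨fun h => Subtype.ext (h.unique (hΨ B)), fun h => h ▸ hΨ B⟩, h2, h3,
    fun D => funext fun k => ((hΦ D).weight k).symm, fun B => funext fun k => (hΨ B).weight k,
    fun D => (hΦ D).hasPerm_iff, fun B => (hΨ B).hasPerm_iff,
    Set.InvOn.bijOn ⟨h2.leftInvOn _, h3.leftInvOn _⟩ h4 h5,
    Set.InvOn.bijOn ⟨h3.leftInvOn _, h2.leftInvOn _⟩ h5 h4⟩
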